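/- Let $F$ be a global field with $\operatorname{char} F\neq 2$. Let $A$ be a central division $F$-algebra of degree $8$ (so $\dim_F A=64$) containing a biquadratic extension $K=F(\sqrt a,\sqrt b)$, $[K:F]=4$, $a,b\in F^\times$, such that the quadratic form $\langle a,b,ab\rangle$ is not isometric to $\langle 1,1,1\rangle$ over $F$. Let $v_1,v_2$ be two nondyadic valuations of $F$ (that is, with residue fields $\overline F_{v_1},\overline F_{v_2}$ of characteristic different from $2$) such that: 1. $v_1$ and $v_2$ extend to valuations of $A$; 2. the inertia fields of $v_1$ and $v_2$ in $K/F$ are two distinct quadratic extensions of $F$; 3. $|\overline F_{v_1}|\not\equiv 1 \pmod 4$; 4. $|\overline F_{v_2}|\not\equiv 1 \pmod 4$. Then there is no Galois field extension $M/F$ of degree $8$ with $K\subseteq M\subseteq A$. Consequently, let $\Gamma=\mathbb Z\times\mathbb Z$, equipped with any total order that makes it an ordered group. Let $\sigma,\tau\in\operatorname{Gal}(K/F)$ be given by $\sigma(\sqrt a)=-\sqrt a$, $\sigma(\sqrt b)=\sqrt b$, $\tau(\sqrt a)=\sqrt a$, $\tau(\sqrt b)=-\sqrt b$, and put $\varepsilon(r,s)=\sigma^r\tau^s$.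 For each $\rho\in\operatorname{Gal}(K/F)$ let $u_\rho\in A^\times$ satisfy $\rho(x)=u_\rho^{-1}xu_\rho$ for all $x\in K$, with $u_{\mathrm{Id}}=1$. Let $\mathcal D=C_A(K)((\Gamma))$ be the Mal'cev–Neumann ring of formal series $\sum_{\gamma\in\Gamma}a_\gamma r_\gamma$ with coefficients $r_\gamma$ in the centralizer $C_A(K)$ and well-ordered support, added componentwise and multiplied by the rules $$r\,a_\gamma=a_\gamma\,(u_{\varepsilon(\gamma)}^{-1}\,r\,u_{\varepsilon(\gamma)})\quad(r\in C_A(K)),\qquad a_\gamma a_\delta=a_{\gamma+\delta}\,u_{\varepsilon(\gamma)\varepsilon(\delta)}^{-1}u_{\varepsilon(\gamma)}u_{\varepsilon(\delta)} .$$ Then $\mathcal D$ is a division algebra, finite-dimensional of degree $8$ over its center, and it is not a crossed product: it has no maximal commutative subalgebra that is a Galois field extension of its center. -/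

import Mathlib

universe uF uK uA uV₁ uV₂ uΓ

/-- A global field: a number field, or a finite extension of `𝔽_p(t)` for some prime `p`. -/
def IsGlobalField (F : Type*) [Field F] : Prop :=
  NumberField F ∨
    ∃ (p : ℕ) (_ : Fact p.Prime) (_ : Algebra (RatFunc (ZMod p)) F), FunctionField (ZMod p) F

/-! ### Valuations -/

/-- The residue field of a (Krull) valuation on a field. -/
abbrev ValuationResidueField {F Γ₀ : Type*} [Field F] [LinearOrderedCommGroupWithZero Γ₀]
    (v : Valuation F Γ₀) : Type _ :=
  IsLocalRing.ResidueField v.valuationSubring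

/-- The valuation `v` of `F` extends to a valuation of the division algebra `A`: some valuation
of `A` restricts to (a valuation equivalent to) `v`.  The value group of the extension may be
larger than that of `v`. -/
def Valuation.ExtendsTo {F : Type uF} {Γ₀ : Type uΓ} [Field F]
    [LinearOrderedCommGroupWithZero Γ₀] (v : Valuation F Γ₀)
    (A : Type uA) [DivisionRing A] [Algebra F A] : Prop :=
  ∃ (Γ₁ : Type uA) (_ : LinearOrderedCommGroupWithZero Γ₁) (w : Valuation A Γ₁),
    v.HasExtension w

/-- The inertia group over `F` of a valuation ring `B` of `K`, as a subgroup of `Gal(K/F)`. -/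
noncomputable def inertiaGroup (F : Type*) {K : Type*} [Field F] [Field K] [Algebra F K]
    (B : ValuationSubring K) : Subgroup (K ≃ₐ[F] K) :=
  (B.inertiaSubgroup F).map (B.decompositionSubgroup F).subtype

/-- `E` is the inertia field in `K/F` of (an extension to `K` of) the valuation `v` of `F`: the
field fixed by the inertia group.  When `v` has just one extension to `K`, this determines `E`. -/
def IsValuationInertiaField {F K Γ₀ : Type*} [Field F] [Field K] [Algebra F K]
    [LinearOrderedCommGroupWithZero Γ₀] (v : Valuation F Γ₀) (E : IntermediateField F K) : Prop :=
  ∃ B : ValuationSubring K, B.comap (algebraMap F K) = v.valuationSubring ∧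
    E = IntermediateField.fixedField (inertiaGroup F B)

/-! ### Crossed products -/

/-- The finite-dimensional central division algebra `D` over `Z` is a crossed product: it has a
maximal commutative subalgebra that is (isomorphic over `Z` to) a Galois field extension `L` of
`Z`. -/
def IsCrossedProduct (Z : Type uF) (D : Type uA) [Field Z] [Ring D] [Algebra Z D] :
    Prop :=
  ∃ (L : Type uA) (_ : Field L) (_ : Algebra Z L) (j : L →ₐ[Z] D), IsGalois Z L ∧
    ∀ S : Subalgebra Z D, (∀ x ∈ S, ∀ y ∈ S, x * y = y * x) → j.range ≤ S → S = j.range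

/-- The division ring `D` has degree `n` over its center: its dimension there is finite and equal
to `n ^ 2` (here `0 < n`). -/
def HasDegreeOverCenter (D : Type*) [DivisionRing D] (n : ℕ) : Prop :=
  0 < n ∧ Module.finrank (Subring.center D) D = n ^ 2

/-- The division ring `D` is a crossed product over its center. -/
def IsCrossedProductOverCenter (D : Type*) [DivisionRing D] : Prop :=
  IsCrossedProduct (Subring.center D) D

/-- The ring `D` is a division ring, finite-dimensional of degree `n` over its center, and it is
not a crossed product. -/
def IsNoncrossedProductDivisionAlgebra (D : Type*) [Ring D] [Nontrivial D] (n : ℕ) : Prop :=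
  ∃ h : ∀ x : D, IsUnit x ∨ x = 0,
    @HasDegreeOverCenter D (DivisionRing.ofIsUnitOrEqZero h) n ∧
      ¬ @IsCrossedProductOverCenter D (DivisionRing.ofIsUnitOrEqZero h)

/-! ### Mal'cev-Neumann series -/

/-- A choice of units `u_σ ∈ Aˣ`, for `σ ∈ Gal(K/F)`, inducing by conjugation the automorphisms
of the subfield `K` of `A`, with `u_1 = 1`. -/
structure GaloisUnits {F K A : Type*} [Field F] [Field K] [Algebra F K] [Ring A] [Algebra F A]
    (ι : K →ₐ[F] A) where
  unit : (K ≃ₐ[F] K) → Aˣ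
  unit_one : unit 1 = 1
  conj : ∀ (σ : K ≃ₐ[F] K) (x : K),
    ι (σ x) = ((unit σ)⁻¹ : Aˣ) * ι x * (unit σ : A)

/-- The centralizer `C_A(K)` of the image of `K` in `A`. -/
abbrev centralizerOf {F K A : Type*} [Field F] [Field K] [Algebra F K] [Ring A] [Algebra F A]
    (ι : K →ₐ[F] A) : Subalgebra F A :=
  Subalgebra.centralizer F (Set.range ι)

section MalcevNeumann

variable {F K A Γ : Type*} [Field F] [Field K] [Algebra F K] [Ring A] [Algebra F A]
  {ι : K →ₐ[F] A} [AddCommGroup Γ] [LinearOrder Γ]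

/-- The formal series `∑ a_γ r_γ` with `r_γ ∈ C_A(K)` and well-ordered support in `Γ`
(for a linear order, partially well-ordered means well-ordered).  The data `U` and `ε` enter
only in the multiplication. -/
def MalcevNeumann (_U : GaloisUnits ι) (_ε : Multiplicative Γ →* (K ≃ₐ[F] K)) : Type _ :=
  HahnSeries Γ (centralizerOf ι)

namespace MalcevNeumann

/-- The automorphism `ε(γ)`. -/
abbrev gal {F K Γ : Type*} [Field F] [Field K] [Algebra F K] [AddCommGroup Γ]
    (ε : Multiplicative Γ →* (K ≃ₐ[F] K)) (γ : Γ) : K ≃ₐ[F] K :=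
  ε (Multiplicative.ofAdd γ)

theorem gal_add {F K Γ : Type*} [Field F] [Field K] [Algebra F K] [AddCommGroup Γ]
    (ε : Multiplicative Γ →* (K ≃ₐ[F] K)) (γ δ : Γ) :
    gal ε (γ + δ) = gal ε γ * gal ε δ := by
  simp [gal, ofAdd_add]

theorem comm_of_mem (r : centralizerOf ι) (x : K) : ι x * (r : A) = r * ι x :=
  (Subalgebra.mem_centralizer_iff F).1 r.2 _ ⟨x, rfl⟩

theorem mul_unit (U : GaloisUnits ι) (σ : K ≃ₐ[F] K) (x : K) :
    ι x * (U.unit σ : A) = U.unit σ * ι (σ x) := by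
  rw [U.conj, ← mul_assoc, ← mul_assoc, Units.mul_inv, one_mul]

theorem inv_mul_unit (U : GaloisUnits ι) (σ : K ≃ₐ[F] K) (x : K) :
    ι (σ x) * ((U.unit σ)⁻¹ : Aˣ) = ((U.unit σ)⁻¹ : Aˣ) * ι x := by
  rw [U.conj, mul_assoc, Units.mul_inv, mul_one]

/-- The conjugate `u_σ⁻¹ r u_σ` of `r ∈ C_A(K)`. -/
def conjBy (U : GaloisUnits ι) (σ : K ≃ₐ[F] K) (r : centralizerOf ι) : centralizerOf ι :=
  ⟨((U.unit σ)⁻¹ : Aˣ) * (r : A) * (U.unit σ : A), by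
    rw [Subalgebra.mem_centralizer_iff]
    rintro _ ⟨x, rfl⟩
    obtain ⟨y, rfl⟩ := σ.surjective x
    rw [← mul_assoc, ← mul_assoc, inv_mul_unit, mul_assoc _ (ι y), comm_of_mem,
      mul_assoc, mul_assoc, mul_unit]
    simp only [mul_assoc]⟩

/-- The factor `u_{ε(γ)ε(δ)}⁻¹ u_{ε(γ)} u_{ε(δ)} ∈ C_A(K)`. -/
def factor (U : GaloisUnits ι) (ε : Multiplicative Γ →* (K ≃ₐ[F] K)) (γ δ : Γ) :
    centralizerOf ι :=
  ⟨((U.unit (gal ε γ * gal ε δ))⁻¹ : Aˣ) * (U.unit (gal ε γ) : A) * (U.unit (gal ε δ) : A), by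
    rw [Subalgebra.mem_centralizer_iff]
    rintro _ ⟨x, rfl⟩
    obtain ⟨y, rfl⟩ := (gal ε γ * gal ε δ).surjective x
    rw [← mul_assoc, ← mul_assoc, inv_mul_unit, mul_assoc _ (ι y), mul_unit, mul_assoc,
      mul_assoc, mul_unit, ← gal_add, add_comm γ δ, gal_add]
    simp only [mul_assoc, AlgEquiv.mul_apply]⟩

variable {U : GaloisUnits ι} {ε : Multiplicative Γ →* (K ≃ₐ[F] K)}

/-- The coefficient `r_γ` of `∑ a_γ r_γ`. -/
def coeff (f : MalcevNeumann U ε) (γ : Γ) : centralizerOf ι :=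
  HahnSeries.coeff (R := centralizerOf ι) f γ

/-- The monomial `a_γ r`. -/
noncomputable def single (U : GaloisUnits ι) (ε : Multiplicative Γ →* (K ≃ₐ[F] K)) (γ : Γ)
    (r : centralizerOf ι) : MalcevNeumann U ε :=
  HahnSeries.single (R := centralizerOf ι) γ r

noncomputable instance : AddCommGroup (MalcevNeumann U ε) :=
  inferInstanceAs (AddCommGroup (HahnSeries Γ (centralizerOf ι)))

noncomputable instance : One (MalcevNeumann U ε) := ⟨single U ε 0 1⟩

/-- The embedding `∑ a_γ r_γ ↦ ∑ t^γ u_{ε(γ)} r_γ` into the series over `A` in a central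
indeterminate; it serves to check the ring axioms. -/
noncomputable def toSeries (f : MalcevNeumann U ε) : HahnSeries Γ A where
  coeff γ := (U.unit (gal ε γ) : A) * (f.coeff γ : A)
  isPWO_support' := by
    refine Set.IsPWO.mono (HahnSeries.isPWO_support (R := centralizerOf ι) f) fun γ hγ h => hγ ?_
    have h' : f.coeff γ = 0 := h
    simp [h']

theorem toSeries_injective :
    Function.Injective (toSeries : MalcevNeumann U ε → HahnSeries Γ A) := by
  intro f g h
  refine HahnSeries.ext (Γ := Γ) (R := centralizerOf ι) (funext fun γ => Subtype.ext ?_)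
  have := congrArg (fun s => HahnSeries.coeff s γ) h
  exact (Units.mul_right_inj _).1 this

theorem toSeries_add (f g : MalcevNeumann U ε) :
    toSeries (f + g) = toSeries f + toSeries g := by
  ext γ
  exact mul_add _ _ _

theorem toSeries_zero : toSeries (0 : MalcevNeumann U ε) = 0 := by
  ext γ
  exact mul_zero _

theorem toSeries_one : toSeries (1 : MalcevNeumann U ε) = 1 := by
  ext γ
  change (U.unit (gal ε γ) : A) *
    ((HahnSeries.single (R := centralizerOf ι) (0 : Γ) 1).coeff γ : A) = _
  by_cases h : γ = 0
  · subst h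
    simp [gal, U.unit_one]
  · simp [HahnSeries.coeff_one, h]

variable [IsOrderedAddMonoid Γ]

/-- The product determined by `r a_γ = a_γ (u_{ε(γ)}⁻¹ r u_{ε(γ)})` and
`a_γ a_δ = a_{γ+δ} u_{ε(γ)ε(δ)}⁻¹ u_{ε(γ)} u_{ε(δ)}`: that is, `(a_γ r) (a_δ s)` is
`a_{γ+δ} (u_{ε(γ)ε(δ)}⁻¹ u_{ε(γ)} u_{ε(δ)}) (u_{ε(δ)}⁻¹ r u_{ε(δ)}) s`, summed over the (finitely
many) pairs of indices with a given sum. -/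
noncomputable instance : Mul (MalcevNeumann U ε) where
  mul f g :=
    { coeff := fun γ => ∑ ij ∈ Finset.antidiagonal
          (HahnSeries.isPWO_support (R := centralizerOf ι) f)
          (HahnSeries.isPWO_support (R := centralizerOf ι) g) γ,
        factor U ε ij.1 ij.2 * conjBy U (gal ε ij.2) (f.coeff ij.1) * g.coeff ij.2
      isPWO_support' := by
        refine Set.IsPWO.mono (Finset.isPWO_support_antidiagonal
          (hs := HahnSeries.isPWO_support (R := centralizerOf ι) f)
          (ht := HahnSeries.isPWO_support (R := centralizerOf ι) g)) fun γ hγ => ?_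
        exact Finset.nonempty_of_sum_ne_zero hγ }

theorem toSeries_mul (f g : MalcevNeumann U ε) :
    toSeries (f * g) = toSeries f * toSeries g := by
  have hs : ∀ f : MalcevNeumann U ε, (toSeries f).support =
      HahnSeries.support (R := centralizerOf ι) f := by
    intro f
    ext γ
    refine not_congr (Iff.trans (Units.mul_right_eq_zero _) ?_)
    exact ZeroMemClass.coe_eq_zero
  ext γ
  rw [HahnSeries.coeff_mul]
  change (U.unit (gal ε γ) : A) * ((∑ ij ∈ Finset.antidiagonal
          (HahnSeries.isPWO_support (R := centralizerOf ι) f)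
          (HahnSeries.isPWO_support (R := centralizerOf ι) g) γ,
        factor U ε ij.1 ij.2 * conjBy U (gal ε ij.2) (f.coeff ij.1) * g.coeff ij.2 :
        centralizerOf ι) : A) = _
  rw [AddSubmonoidClass.coe_finsetSum, Finset.mul_sum]
  refine Finset.sum_congr (by ext; simp [hs]) fun ij hij => ?_
  have hγ : ij.1 + ij.2 = γ := (Finset.mem_antidiagonal.1 hij).2.2
  simp only [MulMemClass.coe_mul, factor, conjBy, toSeries, ← hγ, gal_add]
  simp only [← mul_assoc, Units.mul_inv, one_mul]
  rw [mul_assoc _ _ ((U.unit (gal ε ij.2))⁻¹ : Aˣ).val, Units.mul_inv, mul_one]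

noncomputable instance : Ring (MalcevNeumann U ε) where
  __ := (inferInstance : AddCommGroup (MalcevNeumann U ε))
  left_distrib f g h := toSeries_injective <| by
    simp only [toSeries_mul, toSeries_add, mul_add]
  right_distrib f g h := toSeries_injective <| by
    simp only [toSeries_mul, toSeries_add, add_mul]
  zero_mul f := toSeries_injective <| by simp only [toSeries_mul, toSeries_zero, zero_mul]
  mul_zero f := toSeries_injective <| by simp only [toSeries_mul, toSeries_zero, mul_zero]
  mul_assoc f g h := toSeries_injective <| by simp only [toSeries_mul, mul_assoc]
  one_mul f := toSeries_injective <| by simp only [toSeries_mul, toSeries_one, one_mul]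
  mul_one f := toSeries_injective <| by simp only [toSeries_mul, toSeries_one, mul_one]

instance [Nontrivial A] : Nontrivial (MalcevNeumann U ε) :=
  ⟨⟨0, 1, fun h => zero_ne_one (α := HahnSeries Γ A) <| by
    rw [← toSeries_zero (U := U) (ε := ε), h, toSeries_one]⟩⟩

end MalcevNeumann
end MalcevNeumann

/-! Suppose that M is Galois of degree 8 over F with K ⊆ M ⊆ A. Put G = Gal(M/F) and V = Gal(K/F), a
Klein four-group, and let {1, z} be the kernel of G → V. By Skolem–Noether (`exists_conj_eq`) every
g ∈ G is induced by conjugation in A. A valuation of A has a commutative value group, so it is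
unchanged by conjugation and restricts to a G-invariant valuation of M
(`Valuation.ExtendsTo.exists_invariant`). Over a global field it is discrete with finite residue
field as soon as it is nontrivial (`IsGlobalField.isFiniteDiscrete`).

The inertia group T of each vᵢ is therefore normal in G, and G/T is cyclic because it acts
faithfully on a finite field. T is cyclic by the tame character t ↦ residue of t(π)/π, which is
injective because G is a 2-group and the residue characteristic is odd. The image of T in V has
order 2. If some t ∈ T with t² = z were central, then t(π)/π would be congruent to an element of F
with square ≡ -1, which is impossible when |F̄ᵥ| ≢ 1 mod 4. Two such subgroups with different images
force every lift of a nontrivial element of V to have square z (`mul_self_eq_of_tameInertia`), so G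
is the quaternion group. Witt's criterion (`weightedSumSquares_equivalent_of_quaternion`) then gives
⟨a, b, ab⟩ ≅ ⟨1, 1, 1⟩, a contradiction.

For the series ring D, sending a_γ to t^γ u_{ε(γ)}, with t^γ central, identifies D with the series
over A whose coefficient at γ lies in A_{ε(γ)}, where A_σ = {d : x d = d σ(x) for x ∈ K}. Since A is
the direct sum of the A_σ, the center Z of D consists of the series over F supported in ker ε, and
[D : Z] = dim A = 64. Moreover D is a domain, hence a division ring.

A Galois maximal subfield L of D would have degree 8 over Z. Its constant terms commute with one
another and with K, and their minimal polynomials split because automorphisms of L over Z preserve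
integrality. Together with K they generate a Galois extension of F inside A of degree 4 or 8. Degree
8 is excluded by the first part, so they lie in K (`residueSubalgebra_le_range`). An independence
argument on leading terms then gives [L : Z] · dim C_A(K) ≤ 64
(`finrank_mul_le_of_residueSubalgebra_le`). As dim C_A(K) = 16, this yields [L : Z] ≤ 4, a
contradiction. -/

/-! ### Galois subfields of central division algebras: twisted centralizers and Skolem–Noether. -/

section CentralDivision

open Module

variable {F A M : Type*} [Field F] [DivisionRing A] [Algebra F A]

/-- Artin–Whaples: in a central division algebra, `∑ xᵢ d yᵢ = 0` for all `d` with `xᵢ` linearly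
independent forces every `yᵢ` to vanish. -/
theorem eq_zero_of_forall_sum_mul_mul_eq_zero [Algebra.IsCentral F A] {κ : Type*} {x : κ → A}
    (hx : LinearIndependent F x) (s : Finset κ) :
    ∀ y : κ → A, (∀ d : A, ∑ i ∈ s, x i * d * y i = 0) → ∀ i ∈ s, y i = 0 := by
  classical
  induction s using Finset.induction_on with
  | empty => simp
  | insert a s ha ih =>
    intro y hy
    have key : y a = 0 := by
      by_contra hya
      have hy' : ∀ d : A, x a * d + ∑ i ∈ s, x i * d * (y i * (y a)⁻¹) = 0 := by
        intro d
        have := congrArg (· * (y a)⁻¹) (hy d)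
        simp only [Finset.sum_insert ha, add_mul, Finset.sum_mul, zero_mul] at this
        rw [mul_assoc _ (y a), mul_inv_cancel₀ hya, mul_one] at this
        simpa only [mul_assoc] using this
      have hc : ∀ i ∈ s, ∃ c : F, y i * (y a)⁻¹ = algebraMap F A c := by
        intro i hi
        rw [← Algebra.IsCentral.mem_center_iff F, Subalgebra.mem_center_iff]
        intro e
        have := ih (fun i => e * (y i * (y a)⁻¹) - (y i * (y a)⁻¹) * e) (fun d => by
          have h1 := hy' (d * e)
          have h2 := congrArg (· * e) (hy' d)
          simp only [add_mul, Finset.sum_mul, zero_mul] at h2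
          have h3 := h1.trans h2.symm
          rw [← mul_assoc, add_right_inj] at h3
          simp only [mul_sub, Finset.sum_sub_distrib]
          rw [sub_eq_zero]
          simpa only [mul_assoc] using h3) i hi
        exact sub_eq_zero.1 this
      choose! c hc using hc
      have h1 : ∑ i ∈ insert a s, (if i = a then 1 else c i) • x i = 0 := by
        have := hy' 1
        rw [Finset.sum_insert ha]
        simp only [if_true, one_smul]
        rw [mul_one] at this
        rw [← this]
        congr 1
        refine Finset.sum_congr rfl fun i hi => ?_
        rw [if_neg (fun h : i = a => ha (h ▸ hi)), hc i hi, mul_one, Algebra.smul_def, Algebra.commutes]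
      have := linearIndependent_iff'.1 hx _ _ h1 a (Finset.mem_insert_self a s)
      simp at this
    have h2 := ih y (fun d => by
      have := hy d
      rwa [Finset.sum_insert ha, key, mul_zero, zero_add] at this)
    intro i hi
    rcases Finset.mem_insert.1 hi with rfl | hi
    exacts [key, h2 i hi]

variable [Field M] [Algebra F M]

/-- The elements `d` of `A` with `x d = d σ(x)` for all `x ∈ M`. -/
def twistedCentralizer (j : M →ₐ[F] A) (σ : M ≃ₐ[F] M) : Submodule F A where
  carrier := {d | ∀ x, j x * d = d * j (σ x)}
  add_mem' h h' x := by rw [mul_add, add_mul, h x, h' x]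
  zero_mem' x := by simp
  smul_mem' c d h x := by rw [mul_smul_comm, smul_mul_assoc, h x]

theorem mem_twistedCentralizer {j : M →ₐ[F] A} {σ : M ≃ₐ[F] M} {d : A} :
    d ∈ twistedCentralizer j σ ↔ ∀ x, j x * d = d * j (σ x) := Iff.rfl

theorem twistedCentralizer_one (j : M →ₐ[F] A) :
    twistedCentralizer j 1 = (Subalgebra.centralizer F (Set.range j)).toSubmodule := by
  ext d
  simp [mem_twistedCentralizer, Subalgebra.mem_centralizer_iff]

/-- Left multiplication by a nonzero u in the σ-component carries the ordinary centralizer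
isomorphically onto that component. -/
theorem finrank_twistedCentralizer (j : M →ₐ[F] A) (σ : M ≃ₐ[F] M) {u : A} (hu : u ≠ 0)
    (hmem : u ∈ twistedCentralizer j σ) :
    finrank F (twistedCentralizer j σ) = finrank F (twistedCentralizer j 1) := by
  have hinv : ∀ x, j (σ x) * u⁻¹ = u⁻¹ * j x := fun x => by
    rw [eq_comm, inv_mul_eq_iff_eq_mul₀ hu, ← mul_assoc, ← hmem x, mul_assoc,
      mul_inv_cancel₀ hu, mul_one]
  refine (LinearEquiv.finrank_eq (LinearEquiv.ofLinearMap
    (((LinearMap.mulLeft F u).comp (twistedCentralizer j 1).subtype).codRestrict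
      (twistedCentralizer j σ) fun d x => ?_)
    (((LinearMap.mulLeft F u⁻¹).comp (twistedCentralizer j σ).subtype).codRestrict
      (twistedCentralizer j 1) fun d x => ?_) ?_ ?_)).symm
  · have h := d.2 (σ x)
    simp only [LinearMap.comp_apply, LinearMap.mulLeft_apply, Submodule.subtype_apply]
    rw [← mul_assoc, hmem x, mul_assoc, h, mul_assoc]
    rfl
  · obtain ⟨y, rfl⟩ := σ.surjective x
    have h := d.2 y
    simp only [LinearMap.comp_apply, LinearMap.mulLeft_apply, Submodule.subtype_apply]
    rw [← mul_assoc, hinv, mul_assoc, h, mul_assoc]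
    rfl
  · exact LinearMap.ext fun d => Subtype.ext (mul_inv_cancel_left₀ hu (d : A))
  · exact LinearMap.ext fun d => Subtype.ext (inv_mul_cancel_left₀ hu (d : A))

variable [FiniteDimensional F M] [IsGalois F M]

section DualBasis

variable {κ : Type*} [Fintype κ] [DecidableEq κ] (b : Basis κ F M)

/-- Trace duality says that the matrices (σ(bᵢ)) and (σ(bᵢ*)) have product 1 in one order. They are
square because |Gal(M/F)| = [M : F], so the product in the other order is 1 too; this is the
asserted orthogonality. -/
theorem sum_mul_traceDual [DecidableEq (M ≃ₐ[F] M)] (σ τ : M ≃ₐ[F] M) :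
    ∑ i, σ (b i) * τ (b.traceDual i) = if σ = τ then 1 else 0 := by
  classical
  let P : Matrix κ (M ≃ₐ[F] M) M := fun i σ => σ (b i)
  let Q : Matrix (M ≃ₐ[F] M) κ M := fun σ i => σ (b.traceDual i)
  have hPQ : P * Q = 1 := by
    ext i k
    have := congrArg (algebraMap F M) (b.trace_mul_traceDual (K := F) i k)
    rw [trace_eq_sum_automorphisms] at this
    simp only [map_mul] at this
    rw [Matrix.mul_apply, Matrix.one_apply]
    simp only [P, Q, this]
    split_ifs <;> simp
  have hcard : Fintype.card κ = Fintype.card (M ≃ₐ[F] M) := by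
    rw [← finrank_eq_card_basis b, ← Nat.card_eq_fintype_card, IsGalois.card_aut_eq_finrank]
  have hQP := (Matrix.mul_eq_one_comm_of_card_eq (R := M) (A := P) (B := Q) (eq := hcard)).1 hPQ
  have := congrFun (congrFun hQP τ) σ
  rw [Matrix.mul_apply, Matrix.one_apply] at this
  simp only [P, Q] at this
  simp_rw [eq_comm (a := σ)]
  rw [← this]
  exact Finset.sum_congr rfl fun i _ => mul_comm _ _

theorem sum_trace_smul (x : M) : ∑ i, Algebra.trace F M (x * b.traceDual i) • b i = x := by
  conv_rhs => rw [← b.sum_repr x]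
  refine Finset.sum_congr rfl fun i _ => ?_
  congr 1
  have := b.traceDual.traceDual_repr_apply (K := F) x i
  rw [Basis.traceDual_traceDual] at this
  rw [this, Algebra.traceForm_apply]

theorem sum_trace_smul' (x : M) :
    ∑ i, Algebra.trace F M (x * b i) • b.traceDual i = x := by
  conv_rhs => rw [← b.traceDual.sum_repr x]
  refine Finset.sum_congr rfl fun i _ => ?_
  rw [b.traceDual_repr_apply (K := F) x i, Algebra.traceForm_apply]

variable (j : M →ₐ[F] A)

/-- The element ∑ bᵢ ⊗ bᵢ* of M ⊗ M is unchanged in moving a factor x across the tensor sign: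
expanding x bᵢ in the basis and bₖ* x in the dual basis gives the same trace coefficients. So d ↦ ∑
bᵢ d σ(bᵢ*) maps A into its σ-component. -/
theorem sum_casimir_mem (σ : M ≃ₐ[F] M) (d : A) :
    ∑ i, j (b i) * d * j (σ (b.traceDual i)) ∈ twistedCentralizer j σ := by
  intro x
  rw [Finset.mul_sum, Finset.sum_mul]
  have h1 : ∀ i, j x * (j (b i) * d * j (σ (b.traceDual i))) =
      ∑ k, Algebra.trace F M (x * b i * b.traceDual k) •
        (j (b k) * d * j (σ (b.traceDual i))) := by
    intro i
    rw [← mul_assoc, ← mul_assoc, ← map_mul]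
    conv_lhs => rw [← sum_trace_smul b (x * b i)]
    simp only [map_sum, map_smul, Finset.sum_mul, smul_mul_assoc]
  have h2 : ∀ k, j (b k) * d * j (σ (b.traceDual k)) * j (σ x) =
      ∑ i, Algebra.trace F M (x * b i * b.traceDual k) •
        (j (b k) * d * j (σ (b.traceDual i))) := by
    intro k
    rw [mul_assoc, ← map_mul, ← map_mul]
    conv_lhs => rw [← sum_trace_smul' b (b.traceDual k * x)]
    simp only [map_sum, map_smul, Finset.mul_sum, mul_smul_comm]
    refine Finset.sum_congr rfl fun i _ => ?_
    congr 2
    ring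
  rw [Finset.sum_congr rfl fun i _ => h1 i, Finset.sum_congr rfl fun i _ => h2 i,
    Finset.sum_comm]

end DualBasis

/-- If the component vanished, every ∑ bᵢ d σ(bᵢ*) would be zero, and Artin–Whaples would kill the
whole dual basis. -/
theorem twistedCentralizer_ne_bot [Algebra.IsCentral F A] (j : M →ₐ[F] A) (σ : M ≃ₐ[F] M) :
    ∃ u ∈ twistedCentralizer j σ, u ≠ 0 := by
  classical
  by_contra! h
  let b := finBasis F M
  have hind : LinearIndependent F fun i => j (b i) :=
    b.linearIndependent.map' j.toLinearMap (LinearMap.ker_eq_bot.2 j.injective)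
  have h0 := eq_zero_of_forall_sum_mul_mul_eq_zero hind Finset.univ
    (fun i => j (σ (b.traceDual i))) fun d => h _ (sum_casimir_mem b j σ d)
  have h1 := sum_mul_traceDual b 1 1
  have h2 : ∀ i, b.traceDual i = 0 := fun i => by
    have := h0 i (Finset.mem_univ i)
    simpa using this
  simp [h2] at h1

/-- Skolem–Noether for Galois subfields of central division algebras. -/
theorem exists_conj_eq [Algebra.IsCentral F A] (j : M →ₐ[F] A) (σ : M ≃ₐ[F] M) :
    ∃ u : A, u ≠ 0 ∧ ∀ x, j (σ x) = u⁻¹ * j x * u := by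
  obtain ⟨u, hu, hu0⟩ := twistedCentralizer_ne_bot j σ
  refine ⟨u, hu0, fun x => ?_⟩
  rw [mul_assoc, hu x, inv_mul_cancel_left₀ hu0]

/-- Summing the projections over σ replaces σ(bᵢ*) by the trace of bᵢ*, and ∑ Tr(bᵢ*) bᵢ = 1. -/
theorem exists_sum_twistedCentralizer (j : M →ₐ[F] A) (d : A) :
    ∃ f : (M ≃ₐ[F] M) → A, (∀ σ, f σ ∈ twistedCentralizer j σ) ∧ ∑ σ, f σ = d := by
  classical
  let b := finBasis F M
  refine ⟨fun σ => _, fun σ => sum_casimir_mem b j σ d, ?_⟩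
  rw [Finset.sum_comm]
  have h3 : ∀ i, ∑ σ : M ≃ₐ[F] M, j (b i) * d * j (σ (b.traceDual i)) =
      j (Algebra.trace F M (1 * b.traceDual i) • b i) * d := by
    intro i
    rw [← Finset.mul_sum, ← map_sum, one_mul, ← trace_eq_sum_automorphisms, AlgHom.commutes,
      map_smul, smul_mul_assoc, Algebra.smul_def, Algebra.commutes]
  rw [Finset.sum_congr rfl fun i _ => h3 i, ← Finset.sum_mul, ← map_sum, sum_trace_smul,
    map_one, one_mul]

theorem finrank_eq_sum_twistedCentralizer [FiniteDimensional F A] (j : M →ₐ[F] A) :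
    finrank F A = ∑ σ : M ≃ₐ[F] M, finrank F (twistedCentralizer j σ) := by
  classical
  let b := finBasis F M
  let φ : (∀ σ : M ≃ₐ[F] M, twistedCentralizer j σ) →ₗ[F] A :=
    LinearMap.lsum F (fun σ => twistedCentralizer j σ) F fun σ => (twistedCentralizer j σ).subtype
  have hφ : ∀ f, φ f = ∑ σ, (f σ : A) := fun f => by simp [φ]
  have hinj : Function.Injective φ := by
    rw [injective_iff_map_eq_zero]
    intro f hf
    ext τ
    -- Applying the τ-projection to a sum of components isolates the τ-component, by the
    -- orthogonality relations; hence the sum is direct.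
    have h1 : ∑ i, j (b i) * φ f * j (τ (b.traceDual i)) = f τ := by
      have h2 : ∀ i, j (b i) * φ f * j (τ (b.traceDual i)) =
          ∑ σ : M ≃ₐ[F] M, (f σ : A) * j (σ (b i) * τ (b.traceDual i)) := by
        intro i
        rw [hφ, Finset.mul_sum, Finset.sum_mul]
        refine Finset.sum_congr rfl fun σ _ => ?_
        rw [(f σ).2, mul_assoc, map_mul]
      rw [Finset.sum_congr rfl fun i _ => h2 i, Finset.sum_comm]
      simp_rw [← Finset.mul_sum, ← map_sum, sum_mul_traceDual]
      simp
    rw [hf] at h1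
    simpa using h1.symm
  have hsurj : Function.Surjective φ := by
    intro d
    obtain ⟨f, hf, hd⟩ := exists_sum_twistedCentralizer j d
    exact ⟨fun σ => ⟨f σ, hf σ⟩, by rw [hφ, ← hd]⟩
  rw [← (LinearEquiv.ofBijective φ ⟨hinj, hsurj⟩).finrank_eq, finrank_pi_fintype]

theorem finrank_eq_mul_finrank_centralizer [FiniteDimensional F A] (j : M →ₐ[F] A)
    (hu : ∀ σ : M ≃ₐ[F] M, ∃ u ∈ twistedCentralizer j σ, u ≠ 0) :
    finrank F A =
      finrank F M * finrank F (Subalgebra.centralizer F (Set.range j)) := by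
  rw [finrank_eq_sum_twistedCentralizer j, Finset.sum_congr rfl fun σ _ => by
    obtain ⟨u, hu, hu0⟩ := hu σ
    exact finrank_twistedCentralizer j σ hu0 hu]
  rw [Finset.sum_const, Finset.card_univ, ← Nat.card_eq_fintype_card,
    IsGalois.card_aut_eq_finrank, smul_eq_mul, twistedCentralizer_one]
  rfl

theorem finrank_sq_le_of_commutative [Algebra.IsCentral F A] [FiniteDimensional F A]
    (j : M →ₐ[F] A) : finrank F M ^ 2 ≤ finrank F A := by
  rw [finrank_eq_mul_finrank_centralizer j (twistedCentralizer_ne_bot j), sq]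
  refine Nat.mul_le_mul_left _ ?_
  have h : j.range ≤ Subalgebra.centralizer F (Set.range j) := by
    rintro _ ⟨x, rfl⟩
    rw [Subalgebra.mem_centralizer_iff]
    rintro _ ⟨y, rfl⟩
    change j y * j x = j x * j y
    rw [← map_mul, mul_comm, map_mul]
  calc finrank F M = finrank F j.range :=
        (AlgEquiv.ofInjective j j.injective).toLinearEquiv.finrank_eq
    _ ≤ _ := Submodule.finrank_mono (s := j.range.toSubmodule)
        (t := (Subalgebra.centralizer F (Set.range j)).toSubmodule) h

/-- An element c centralizing M generates with M a commutative subalgebra, so maximality makes M its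
own centralizer. -/
theorem finrank_sq_eq_of_maximal [Algebra.IsCentral F A] [FiniteDimensional F A]
    (j : M →ₐ[F] A)
    (hmax : ∀ S : Subalgebra F A, (∀ x ∈ S, ∀ y ∈ S, x * y = y * x) → j.range ≤ S → S = j.range) :
    finrank F M ^ 2 = finrank F A := by
  rw [finrank_eq_mul_finrank_centralizer j (twistedCentralizer_ne_bot j), sq]
  congr 1
  have h : Subalgebra.centralizer F (Set.range j) = j.range := by
    refine le_antisymm (fun c hc => ?_) ?_
    · rw [Subalgebra.mem_centralizer_iff] at hc
      have hcomm : ∀ x ∈ insert c (Set.range j), ∀ y ∈ insert c (Set.range j), x * y = y * x := by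
        rintro _ (rfl | ⟨x, rfl⟩) _ (rfl | ⟨y, rfl⟩)
        · rfl
        · exact (hc _ ⟨y, rfl⟩).symm
        · exact hc _ ⟨x, rfl⟩
        · rw [← map_mul, mul_comm, map_mul]
      rw [← hmax (Algebra.adjoin F (insert c (Set.range j)))]
      · exact Algebra.subset_adjoin (Set.mem_insert _ _)
      · intro x hx y hy
        have := Algebra.isMulCommutative_adjoin F hcomm
        exact congrArg Subtype.val (mul_comm' (⟨x, hx⟩ : Algebra.adjoin F _) ⟨y, hy⟩)
      · rintro _ ⟨x, rfl⟩
        exact Algebra.subset_adjoin (Set.mem_insert_of_mem _ ⟨x, rfl⟩)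
    · rintro _ ⟨x, rfl⟩
      rw [Subalgebra.mem_centralizer_iff]
      rintro _ ⟨y, rfl⟩
      change j y * j x = j x * j y
      rw [← map_mul, mul_comm, map_mul]
  rw [h]
  exact (AlgEquiv.ofInjective j j.injective).toLinearEquiv.finrank_eq

end CentralDivision

/-! ### Central extensions of the Klein four-group with two tame inertia subgroups. -/

section GroupTheory

theorem eq_of_sq_eq_one_of_isCyclic {C : Type*} [Group C] [Finite C] [IsCyclic C] {x y : C}
    (hx : x * x = 1) (hy : y * y = 1) (hx1 : x ≠ 1) (hy1 : y ≠ 1) : x = y := by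
  classical
  have := Fintype.ofFinite C
  by_contra h
  have h1 := IsCyclic.card_pow_eq_one_le (α := C) (n := 2) (by norm_num)
  have h2 : ({1, x, y} : Finset C) ⊆ Finset.univ.filter fun a : C => a ^ 2 = 1 := by
    intro a ha
    simp only [Finset.mem_insert, Finset.mem_singleton] at ha
    rcases ha with rfl | rfl | rfl <;> simp [sq, *]
  have h3 := Finset.card_le_card h2
  rw [Finset.card_eq_three.2 ⟨1, x, y, hx1.symm, hy1.symm, h, rfl⟩] at h3
  omega

variable {G V : Type*} [Group G] [Group V]

/-- The group-theoretic properties of a tame inertia subgroup `T` of a group `G` with respect to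
an extension `π : G → V` with kernel `{1, z}`, when `T` has image `{1, v}` in `V`. -/
structure TameInertia (π : G →* V) (z : G) (v : V) (T : Subgroup G) : Prop where
  normal : T.Normal
  cyclic : IsCyclic T
  cyclic_quotient : IsCyclic (G ⧸ T)
  map_eq : ∀ t ∈ T, π t = 1 ∨ π t = v
  exists_map : ∃ t ∈ T, π t ≠ 1
  noncentral : ∀ t ∈ T, t * t = z → ∃ g, g * t ≠ t * g

variable {π : G →* V} {z : G}

theorem TameInertia.exists_generator {v : V} {T : Subgroup G} (h : TameInertia π z v T) :
    ∃ t, T = Subgroup.zpowers t ∧ π t = v ∧ v ≠ 1 := by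
  obtain ⟨t, ht⟩ := (Subgroup.isCyclic_iff_exists_zpowers_eq_top T).1 h.cyclic
  have htT : t ∈ T := ht ▸ Subgroup.mem_zpowers t
  obtain ⟨s, hs, hs1⟩ := h.exists_map
  have ht1 : π t ≠ 1 := by
    intro h1
    rw [← ht] at hs
    obtain ⟨k, rfl⟩ := Subgroup.mem_zpowers_iff.1 hs
    exact hs1 (by rw [map_zpow, h1, one_zpow])
  have := (h.map_eq t htT).resolve_left ht1
  exact ⟨t, ht.symm, this, this ▸ ht1⟩

/-- If t₁² = 1, then {1, t₁} is normal, hence central, and its cyclic quotient makes G abelian. Then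
t₂² ≠ z, since a square root of z in T₂ is not central, and so t₂² = 1. Now t₂ and z give
involutions of the cyclic group G/⟨t₁⟩, which has only one, and comparing images in V gives a
contradiction. -/
theorem TameInertia.sq_generator [Finite G] (hker : ∀ g, π g = 1 ↔ g = 1 ∨ g = z) (hz : z ≠ 1)
    (hV : ∀ v : V, v * v = 1) {v₁ v₂ : V} (hv : v₁ ≠ v₂) {t₁ t₂ : G}
    (h₁ : TameInertia π z v₁ (Subgroup.zpowers t₁)) (h₂ : TameInertia π z v₂ (Subgroup.zpowers t₂))
    (hπ₁ : π t₁ = v₁) (hπ₂ : π t₂ = v₂) (hv₁ : v₁ ≠ 1) (hv₂ : v₂ ≠ 1) : t₁ * t₁ = z := by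
  have hsq : ∀ g, g * g = 1 ∨ g * g = z := fun g => (hker _).1 (by rw [map_mul, hV])
  have hπz : π z = 1 := (hker z).2 (Or.inr rfl)
  by_contra hne
  have ht₁ : t₁ * t₁ = 1 := (hsq t₁).resolve_right hne
  have hT : ∀ g ∈ Subgroup.zpowers t₁, g = 1 ∨ g = t₁ := by
    intro g hg
    obtain ⟨k, rfl⟩ := Subgroup.mem_zpowers_iff.1 hg
    rcases Int.even_or_odd' k with ⟨m, rfl | rfl⟩
    · left; rw [zpow_mul, zpow_two, ht₁, one_zpow]
    · right; rw [zpow_add, zpow_mul, zpow_two, ht₁, one_zpow, one_mul, zpow_one]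
  have ht₁1 : t₁ ≠ 1 := fun h => hv₁ (by rw [← hπ₁, h, map_one])
  have := h₁.normal
  have := h₁.cyclic_quotient
  have hcen : ∀ g, g * t₁ = t₁ * g := by
    intro g
    have h := hT _ (h₁.normal.conj_mem t₁ (Subgroup.mem_zpowers t₁) g)
    rcases h with h | h
    · exact absurd (by simpa using h) ht₁1
    · exact mul_inv_eq_iff_eq_mul.1 h
  have hcomm : ∀ a b : G, a * b = b * a := by
    refine (MonoidHom.isMulCommutative_of_isCyclic_of_ker_le_center
      (QuotientGroup.mk' (Subgroup.zpowers t₁)) ?_).is_comm.comm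
    rw [QuotientGroup.ker_mk', Subgroup.zpowers_le, Subgroup.mem_center_iff]
    exact hcen
  have ht₂ : t₂ * t₂ = 1 := by
    refine (hsq t₂).resolve_right fun h => ?_
    obtain ⟨g, hg⟩ := h₂.noncentral t₂ (Subgroup.mem_zpowers _) h
    exact hg (hcomm _ _)
  have hzT : z ∉ Subgroup.zpowers t₁ := by
    intro h
    rcases hT z h with h | h
    · exact hz h
    · exact hv₁ (by rw [← hπ₁, ← h, hπz])
  have ht₂T : ∀ w, π w = 1 → t₂ * w ∉ Subgroup.zpowers t₁ := by
    intro w hw h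
    rcases hT _ h with h | h
    · exact hv₂ (by rw [← hπ₂, ← mul_one (π t₂), ← hw, ← map_mul, h, map_one, hw])
    · exact hv (by rw [← hπ₂, ← mul_one (π t₂), ← hw, ← map_mul, h, hπ₁])
  have hz2 : z * z = 1 := by
    rcases hsq z with h | h
    · exact h
    · exact absurd (mul_eq_left.1 h) hz
  have heq : ((t₂ : G) : G ⧸ Subgroup.zpowers t₁) = (z : G) := by
    refine eq_of_sq_eq_one_of_isCyclic ?_ ?_ ?_ ?_
    · rw [← QuotientGroup.mk_mul, ht₂, QuotientGroup.mk_one]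
    · rw [← QuotientGroup.mk_mul, hz2, QuotientGroup.mk_one]
    · rw [Ne, QuotientGroup.eq_one_iff]
      simpa using ht₂T 1 (map_one π)
    · rwa [Ne, QuotientGroup.eq_one_iff]
  rw [QuotientGroup.eq] at heq
  have := (Subgroup.zpowers t₁).inv_mem heq
  rw [mul_inv_rev, inv_inv, hcomm] at this
  exact ht₂T _ (by rw [map_inv, hπz, inv_one]) this

/-- Two tame inertia groups with different images in `V` force `G` to be a quaternion group. -/
theorem mul_self_eq_of_tameInertia [Finite G] (hker : ∀ g, π g = 1 ↔ g = 1 ∨ g = z) (hz : z ≠ 1)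
    (hV : ∀ v : V, v * v = 1) (hVcard : Nat.card V = 4) {v₁ v₂ : V} (hv : v₁ ≠ v₂)
    {T₁ T₂ : Subgroup G} (h₁ : TameInertia π z v₁ T₁) (h₂ : TameInertia π z v₂ T₂) (g : G)
    (hg : π g ≠ 1) : g * g = z := by
  classical
  obtain ⟨t₁, rfl, hπ₁, hv₁⟩ := h₁.exists_generator
  obtain ⟨t₂, rfl, hπ₂, hv₂⟩ := h₂.exists_generator
  have hs₁ := TameInertia.sq_generator hker hz hV hv h₁ h₂ hπ₁ hπ₂ hv₁ hv₂
  have hs₂ := TameInertia.sq_generator hker hz hV hv.symm h₂ h₁ hπ₂ hπ₁ hv₂ hv₁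
  have hπz : π z = 1 := (hker z).2 (Or.inr rfl)
  have hz2 : z * z = 1 := by
    rcases (hker (z * z)).1 (by rw [map_mul, hV]) with h | h
    · exact h
    · exact absurd (mul_eq_left.1 h) hz
  have hzc : ∀ g, g * z = z * g := by
    intro g
    rcases (hker (g * z * g⁻¹)).1 (by rw [map_mul, map_mul, hπz, mul_one, map_inv,
      mul_inv_cancel]) with h | h
    · exact absurd (by simpa using h) hz
    · exact mul_inv_eq_iff_eq_mul.1 h
  have hlift : ∀ x y, π x = π y → x = y ∨ x = z * y := by
    intro x y h
    rcases (hker (x * y⁻¹)).1 (by rw [map_mul, map_inv, h, mul_inv_cancel]) with h | h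
    · left; exact mul_inv_eq_one.1 h
    · right; exact mul_inv_eq_iff_eq_mul.1 h
  have hVc : ∀ v w : V, v * w = w * v := by
    intro v w
    have h1 : (v * w)⁻¹ = v * w := inv_eq_of_mul_eq_one_right (hV _)
    rw [← h1, mul_inv_rev, inv_eq_of_mul_eq_one_right (hV _), inv_eq_of_mul_eq_one_right (hV _)]
  have hVall : ∀ v : V, v = 1 ∨ v = v₁ ∨ v = v₂ ∨ v = v₁ * v₂ := by
    have := Nat.finite_of_card_ne_zero (α := V) (by omega)
    have := Fintype.ofFinite V
    have h3 : v₁ * v₂ ≠ 1 := fun h => hv (by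
      rw [← inv_eq_of_mul_eq_one_right h, inv_eq_of_mul_eq_one_right (hV _)])
    have hc : ({1, v₁, v₂, v₁ * v₂} : Finset V).card = 4 := by
      rw [Finset.card_insert_of_notMem, Finset.card_insert_of_notMem,
        Finset.card_insert_of_notMem, Finset.card_singleton]
      · simpa using hv₁
      · simp [hv, hv₂]
      · simp [hv₁.symm, hv₂.symm, h3.symm]
    have hu := (Finset.card_eq_iff_eq_univ _).1 (hc.trans (by
      rw [← hVcard, Nat.card_eq_fintype_card]))
    intro v
    have := Finset.mem_univ v
    rw [← hu] at this
    simpa using this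
  have hgen : ∀ x, x = 1 ∨ x = t₁ ∨ x = t₂ ∨ x = t₁ * t₂ ∨
      x = z ∨ x = z * t₁ ∨ x = z * t₂ ∨ x = z * (t₁ * t₂) := by
    intro x
    rcases hVall (π x) with h | h | h | h
    · have := (hker x).1 h
      tauto
    · have := hlift x t₁ (h.trans hπ₁.symm)
      tauto
    · have := hlift x t₂ (h.trans hπ₂.symm)
      tauto
    · have := hlift x (t₁ * t₂) (h.trans (by rw [map_mul, hπ₁, hπ₂]))
      tauto
  -- Since z is central and z, t₁, t₂ generate G, commuting with t₂ would make t₁ central.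
  have hnc : t₁ * t₂ ≠ t₂ * t₁ := by
    intro hc
    obtain ⟨x, hx⟩ := h₁.noncentral t₁ (Subgroup.mem_zpowers _) hs₁
    have c1 : Commute t₁ t₂ := hc
    have cz : Commute z t₁ := (hzc t₁).symm
    have c12 : Commute (t₁ * t₂) t₁ := (Commute.refl t₁).mul_left c1.symm
    refine hx ?_
    change Commute x t₁
    rcases hgen x with rfl | rfl | rfl | rfl | rfl | rfl | rfl | rfl
    · exact Commute.one_left _
    · exact Commute.refl _
    · exact c1.symm
    · exact c12
    · exact cz
    · exact cz.mul_left (Commute.refl _)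
    · exact cz.mul_left c1.symm
    · exact cz.mul_left c12
  have hconj : t₁ * t₂ = z * (t₂ * t₁) := by
    rcases hlift (t₁ * t₂) (t₂ * t₁) (by rw [map_mul, map_mul, hVc]) with h | h
    · exact absurd h hnc
    · exact h
  have hs₃ : (t₁ * t₂) * (t₁ * t₂) = z := by
    calc (t₁ * t₂) * (t₁ * t₂) = z * (t₂ * t₁) * (t₁ * t₂) := by rw [← hconj]
      _ = z * t₂ * (t₁ * t₁) * t₂ := by simp only [mul_assoc]
      _ = z := by
        rw [hs₁, mul_assoc z, hzc t₂, ← mul_assoc, hz2, one_mul, hs₂]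
  have hzmul : ∀ x, (z * x) * (z * x) = x * x := by
    intro x
    calc (z * x) * (z * x) = z * (x * z) * x := by simp only [mul_assoc]
      _ = x * x := by rw [hzc, ← mul_assoc, hz2, one_mul]
  rcases hgen g with rfl | rfl | rfl | rfl | rfl | rfl | rfl | rfl
  · exact absurd (map_one π) hg
  · exact hs₁
  · exact hs₂
  · exact hs₃
  · exact absurd hπz hg
  · rw [hzmul, hs₁]
  · rw [hzmul, hs₂]
  · rw [hzmul, hs₃]

end GroupTheory

/-! ### Witt's criterion for quaternion extensions. -/

section Witt

variable {F M : Type*} [Field F] [Field M] [Algebra F M]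

theorem weightedSumSquares_equivalent_of_orthogonal {a b c : F} (ha : a ≠ 0) (hb : b ≠ 0)
    (hc : c ≠ 0) (m : Fin 3 → Fin 3 → F)
    (h00 : ∑ k, m 0 k * m 0 k = a) (h11 : ∑ k, m 1 k * m 1 k = b)
    (h22 : ∑ k, m 2 k * m 2 k = c) (h01 : ∑ k, m 0 k * m 1 k = 0)
    (h02 : ∑ k, m 0 k * m 2 k = 0) (h12 : ∑ k, m 1 k * m 2 k = 0) :
    (QuadraticMap.weightedSumSquares F ![a, b, c]).Equivalent
      (QuadraticMap.weightedSumSquares F ![(1 : F), 1, 1]) := by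
  let f : (Fin 3 → F) →ₗ[F] (Fin 3 → F) := Matrix.toLin' (Matrix.transpose (Matrix.of m))
  have hf : ∀ x k, f x k = m 0 k * x 0 + m 1 k * x 1 + m 2 k * x 2 := by
    intro x k
    simp [f, Matrix.mulVec, dotProduct, Fin.sum_univ_three]
  simp only [Fin.sum_univ_three] at h00 h11 h22 h01 h02 h12
  have hinj : Function.Injective f := by
    rw [injective_iff_map_eq_zero]
    intro x hx
    have h0 := congrFun hx 0
    have h1 := congrFun hx 1
    have h2 := congrFun hx 2
    rw [hf, Pi.zero_apply] at h0 h1 h2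
    have e0 : a * x 0 = 0 := by
      linear_combination m 0 0 * h0 + m 0 1 * h1 + m 0 2 * h2 - x 0 * h00 - x 1 * h01 - x 2 * h02
    have e1 : b * x 1 = 0 := by
      linear_combination m 1 0 * h0 + m 1 1 * h1 + m 1 2 * h2 - x 0 * h01 - x 1 * h11 - x 2 * h12
    have e2 : c * x 2 = 0 := by
      linear_combination m 2 0 * h0 + m 2 1 * h1 + m 2 2 * h2 - x 0 * h02 - x 1 * h12 - x 2 * h22
    ext k
    fin_cases k
    · simpa [ha] using e0
    · simpa [hb] using e1
    · simpa [hc] using e2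
  refine ⟨⟨LinearEquiv.ofInjectiveEndo f hinj, fun x => ?_⟩⟩
  change QuadraticMap.weightedSumSquares F ![(1 : F), 1, 1] (f x) = _
  simp only [QuadraticMap.weightedSumSquares_apply, Fin.sum_univ_three, hf, smul_eq_mul]
  simp
  linear_combination x 0 ^ 2 * h00 + x 1 ^ 2 * h11 + x 2 ^ 2 * h22 + 2 * x 0 * x 1 * h01 +
    2 * x 0 * x 2 * h02 + 2 * x 1 * x 2 * h12

/-- If the sum of squares vanished for all anti-invariant elements, applying this to y, (1+α)y,
(1+β)y and (1+αβ)y would kill all four combinations of the conjugate squares with the signs of the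
characters of V. Their sum is 4y². -/
theorem exists_anti_invariant_sum_sq_ne_zero (h2 : (2 : M) ≠ 0) {α β : M}
    (hα : α ≠ 0) (hβ : β ≠ 0) {s t z : M ≃ₐ[F] M} (hsα : s α = -α) (hsβ : s β = β) (htα : t α = α)
    (htβ : t β = -β) (hzα : z α = α) (hzβ : z β = β) (hz : z * z = 1) (hz1 : z ≠ 1) :
    ∃ y, z y = -y ∧ y ^ 2 + (s y) ^ 2 + (t y) ^ 2 + (s (t y)) ^ 2 ≠ 0 := by
  obtain ⟨w, hw⟩ : ∃ w, z w ≠ w := by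
    by_contra! h
    exact hz1 (AlgEquiv.ext h)
  have hzz : ∀ x, z (z x) = x := fun x => congrArg (fun f : M ≃ₐ[F] M => f x) hz
  set y := w - z w with hy
  have hy0 : y ≠ 0 := sub_ne_zero.2 hw.symm
  have hzy : z y = -y := by rw [hy, map_sub, hzz]; ring
  by_contra! h
  have e1 := h y hzy
  have eα := h ((1 + α) * y) (by rw [map_mul, map_add, map_one, hzα, hzy]; ring)
  have eβ := h ((1 + β) * y) (by rw [map_mul, map_add, map_one, hzβ, hzy]; ring)
  have eγ := h ((1 + α * β) * y) (by rw [map_mul, map_add, map_one, map_mul, hzα, hzβ, hzy]; ring)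
  simp only [map_mul, map_add, map_one, hsα, hsβ, htα, htβ, map_neg] at eα eβ eγ
  have h2α : (2 * α) ≠ 0 := mul_ne_zero h2 hα
  have h2β : (2 * β) ≠ 0 := mul_ne_zero h2 hβ
  have h2γ : (2 * (α * β)) ≠ 0 := mul_ne_zero h2 (mul_ne_zero hα hβ)
  have fα : y ^ 2 - (s y) ^ 2 + (t y) ^ 2 - (s (t y)) ^ 2 = 0 :=
    mul_left_cancel₀ h2α (by linear_combination eα - (1 + α ^ 2) * e1)
  have fβ : y ^ 2 + (s y) ^ 2 - (t y) ^ 2 - (s (t y)) ^ 2 = 0 :=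
    mul_left_cancel₀ h2β (by linear_combination eβ - (1 + β ^ 2) * e1)
  have fγ : y ^ 2 - (s y) ^ 2 - (t y) ^ 2 + (s (t y)) ^ 2 = 0 :=
    mul_left_cancel₀ h2γ (by linear_combination eγ - (1 + (α * β) ^ 2) * e1)
  have : (2 * 2) * y ^ 2 = 0 := by linear_combination e1 + fα + fβ + fγ
  exact mul_ne_zero (mul_ne_zero h2 h2) (pow_ne_zero 2 hy0) this

/-- Witt's criterion: if `F(√a, √b)` embeds in a Galois extension whose automorphism group is
generated by quaternion-like lifts `s`, `t`, then `⟨a, b, ab⟩ ≅ ⟨1, 1, 1⟩`. -/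
theorem weightedSumSquares_equivalent_of_quaternion (h2 : (2 : F) ≠ 0) {a b : F} {α β : M}
    (hαa : α ^ 2 = algebraMap F M a) (hβb : β ^ 2 = algebraMap F M b)
    (hα : α ≠ 0) (hβ : β ≠ 0) {s t z : M ≃ₐ[F] M} (hsα : s α = -α) (hsβ : s β = β) (htα : t α = α)
    (htβ : t β = -β) (hz1 : z ≠ 1) (hss : s * s = z) (htt : t * t = z)
    (hst : (s * t) * (s * t) = z) (hzz : z * z = 1)
    (hfix : ∀ x, s x = x → t x = x → ∃ c, algebraMap F M c = x) :
    (QuadraticMap.weightedSumSquares F ![a, b, a * b]).Equivalent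
      (QuadraticMap.weightedSumSquares F ![(1 : F), 1, 1]) := by
  have h2M : (2 : M) ≠ 0 := by
    intro h
    exact h2 ((algebraMap F M).injective (by rw [map_ofNat, map_zero, h]))
  have hzα : z α = α := by rw [← htt, AlgEquiv.mul_apply, htα, htα]
  have hzβ : z β = β := by rw [← hss, AlgEquiv.mul_apply, hsβ, hsβ]
  obtain ⟨y, hzy, hN⟩ := exists_anti_invariant_sum_sq_ne_zero h2M hα hβ hsα hsβ htα htβ hzα hzβ
    hzz hz1
  have happ : ∀ {f g : M ≃ₐ[F] M}, f = g → ∀ x, f x = g x := fun h x => by rw [h]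
  have s0 : s (s y) = -y := (happ hss y).trans hzy
  have t0 : t (t y) = -y := (happ htt y).trans hzy
  have zt : z (t y) = -t y := by rw [← htt, AlgEquiv.mul_apply, t0, map_neg]
  have s1 : s (s (t y)) = -t y := (happ hss _).trans zt
  -- This is (st)² = z, rewritten with s⁻¹ = sz and t⁻¹ = zt.
  have hts : t * s = s * z * t := by
    have h1 : s⁻¹ = s * z := inv_eq_of_mul_eq_one_right (by rw [← mul_assoc, hss, hzz])
    have h2 : t⁻¹ = z * t := inv_eq_of_mul_eq_one_left (by rw [mul_assoc, htt, hzz])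
    calc t * s = s⁻¹ * ((s * t) * (s * t)) * t⁻¹ := by group
      _ = s * z * t := by
        rw [hst, h1, h2, mul_assoc s z z, hzz, mul_one, mul_assoc]
  have t1 : t (s y) = - s (t y) := by
    have := happ hts y
    simpa only [AlgEquiv.mul_apply, zt, map_neg] using this
  have t2 : t (s (t y)) = s y := by
    have := happ hts (t y)
    simp only [AlgEquiv.mul_apply, t0, map_neg, hzy, neg_neg] at this
    exact this
  set y₁ := s y
  set y₂ := t y
  set y₃ := s y₂
  set N := y ^ 2 + y₁ ^ 2 + y₂ ^ 2 + y₃ ^ 2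
  have hsN : s N = N := by
    simp only [N, map_add, map_pow, s0, s1]
    simp only [← show s y = y₁ from rfl, ← show s y₂ = y₃ from rfl]
    ring
  have htN : t N = N := by
    simp only [N, map_add, map_pow, t0, t1, t2]
    simp only [← show t y = y₂ from rfl]
    ring
  -- If κ and r transform under s and t by the same signs, then κ r / N is fixed by both and
  -- therefore lies in F.
  have key : ∀ (κ e r : M), s κ = e * κ → s r = e * r → e * e = 1 → ∀ e', t κ = e' * κ →
      t r = e' * r → e' * e' = 1 → ∃ c, algebraMap F M c = κ * r / N := by
    intro κ e r hκ hr he e' hκ' hr' he'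
    refine hfix _ ?_ ?_
    · rw [map_div₀, map_mul, hsN, hκ, hr]
      linear_combination (κ * r / N) * he
    · rw [map_div₀, map_mul, htN, hκ', hr']
      linear_combination (κ * r / N) * he'
  have sy : s y = y₁ := rfl
  have sy₂ : s y₂ = y₃ := rfl
  have ty : t y = y₂ := rfl
  have row1 : ∀ r, s r = -1 * r → t r = 1 * r → ∃ c, algebraMap F M c = α * r / N :=
    fun r h h' => key α (-1) r (by rw [hsα]; ring) h (by ring) 1 (by rw [htα]; ring) h' (by ring)
  have row2 : ∀ r, s r = 1 * r → t r = -1 * r → ∃ c, algebraMap F M c = β * r / N :=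
    fun r h h' => key β 1 r (by rw [hsβ]; ring) h (by ring) (-1) (by rw [htβ]; ring) h' (by ring)
  have row3 : ∀ r, s r = -1 * r → t r = -1 * r → ∃ c, algebraMap F M c = α * β * r / N :=
    fun r h h' => key (α * β) (-1) r (by rw [map_mul, hsα, hsβ]; ring) h (by ring) (-1)
      (by rw [map_mul, htα, htβ]; ring) h' (by ring)
  -- The nine entries are those of the Euler–Rodrigues rotation matrix of the quaternion (y, s y, t
  -- y, s t y), whose rows are orthogonal of norm N². Each row transforms by one nontrivial
  -- character of V; multiplying by β, α or αβ and dividing by N moves it into F and gives it norm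
  -- b, a or ab.
  obtain ⟨b0, hb0⟩ := row2 (y ^ 2 + y₁ ^ 2 - y₂ ^ 2 - y₃ ^ 2)
    (by simp only [map_add, map_sub, map_pow, s0, s1, sy, sy₂]; ring)
    (by simp only [map_add, map_sub, map_pow, t0, t1, t2, ty]; ring)
  obtain ⟨b1, hb1⟩ := row2 (2 * (y₁ * y₂ - y * y₃))
    (by simp only [map_sub, map_mul, map_ofNat, s0, s1, sy, sy₂]; ring)
    (by simp only [map_sub, map_mul, map_ofNat, t0, t1, t2, ty]; ring)
  obtain ⟨b2, hb2⟩ := row2 (2 * (y₁ * y₃ + y * y₂))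
    (by simp only [map_add, map_mul, map_ofNat, s0, s1, sy, sy₂]; ring)
    (by simp only [map_add, map_mul, map_ofNat, t0, t1, t2, ty]; ring)
  obtain ⟨a0, ha0⟩ := row1 (2 * (y₁ * y₂ + y * y₃))
    (by simp only [map_add, map_mul, map_ofNat, s0, s1, sy, sy₂]; ring)
    (by simp only [map_add, map_mul, map_ofNat, t0, t1, t2, ty]; ring)
  obtain ⟨a1, ha1⟩ := row1 (y ^ 2 - y₁ ^ 2 + y₂ ^ 2 - y₃ ^ 2)
    (by simp only [map_add, map_sub, map_pow, s0, s1, sy, sy₂]; ring)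
    (by simp only [map_add, map_sub, map_pow, t0, t1, t2, ty]; ring)
  obtain ⟨a2, ha2⟩ := row1 (2 * (y₂ * y₃ - y * y₁))
    (by simp only [map_sub, map_mul, map_ofNat, s0, s1, sy, sy₂]; ring)
    (by simp only [map_sub, map_mul, map_ofNat, t0, t1, t2, ty]; ring)
  obtain ⟨c0, hc0⟩ := row3 (2 * (y₁ * y₃ - y * y₂))
    (by simp only [map_sub, map_mul, map_ofNat, s0, s1, sy, sy₂]; ring)
    (by simp only [map_sub, map_mul, map_ofNat, t0, t1, t2, ty]; ring)
  obtain ⟨c1, hc1⟩ := row3 (2 * (y₂ * y₃ + y * y₁))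
    (by simp only [map_add, map_mul, map_ofNat, s0, s1, sy, sy₂]; ring)
    (by simp only [map_add, map_mul, map_ofNat, t0, t1, t2, ty]; ring)
  obtain ⟨c2, hc2⟩ := row3 (y ^ 2 - y₁ ^ 2 - y₂ ^ 2 + y₃ ^ 2)
    (by simp only [map_add, map_sub, map_pow, s0, s1, sy, sy₂]; ring)
    (by simp only [map_add, map_sub, map_pow, t0, t1, t2, ty]; ring)
  have hNN : N ≠ 0 := hN
  have ha : a ≠ 0 := fun h => pow_ne_zero 2 hα (by rw [hαa, h, map_zero])
  have hb : b ≠ 0 := fun h => pow_ne_zero 2 hβ (by rw [hβb, h, map_zero])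
  refine weightedSumSquares_equivalent_of_orthogonal ha hb (mul_ne_zero ha hb)
    ![![a0, a1, a2], ![b0, b1, b2], ![c0, c1, c2]] ?_ ?_ ?_ ?_ ?_ ?_ <;>
  · refine (algebraMap F M).injective ?_
    simp only [Fin.sum_univ_three, Matrix.cons_val_zero, Matrix.cons_val_one, Matrix.cons_val,
      map_add, map_mul, map_zero, ha0, ha1, ha2, hb0, hb1, hb2, hc0, hc1, hc2, ← hαa, ← hβb]
    field_simp
    simp only [N]
    ring

end Witt

/-! ### Valuations on finite-rank extensions of a principal ideal domain. -/

section DiscreteValuation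

open Module

theorem LinearIndependent.card_le_of_rank_le {R M : Type*} [CommRing R] [IsDomain R] [Field M]
    [Algebra R M] {N : ℕ} (hrank : Module.rank R M ≤ N) {κ : Type*}
    [Fintype κ] {y : κ → M} (hy : LinearIndependent R y) : Fintype.card κ ≤ N := by
  have h := hy.cardinal_lift_le_rank.trans (Cardinal.lift_le.2 hrank)
  simpa using h

variable {R M : Type*} [CommRing R] [IsDomain R] [IsPrincipalIdealRing R] [Field M]
  [Algebra R M]

section Valuation

variable {Γ₀ : Type*} [LinearOrderedCommGroupWithZero Γ₀] {v : Valuation M Γ₀}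

/-- If r also had value less than 1, a Bézout relation x p + y r = 1 would contradict v(1) = 1. -/
theorem valuation_eq_one_of_not_dvd (hR : ∀ r : R, v (algebraMap R M r) ≤ 1) {p : R}
    (hp : Prime p) (hvp : v (algebraMap R M p) < 1) {r : R} (hr : ¬ p ∣ r) :
    v (algebraMap R M r) = 1 := by
  obtain ⟨x, y, h⟩ := (hp.irreducible.coprime_iff_not_dvd).2 hr
  refine le_antisymm (hR r) (not_lt.1 fun hlt => ?_)
  have h1 : v (algebraMap R M (x * p + y * r)) < 1 := by
    rw [map_add, map_mul, map_mul]
    refine v.map_add_lt ?_ ?_ <;> rw [map_mul]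
    · exact mul_lt_one_of_nonneg_of_lt_one_right (hR x) zero_le hvp
    · exact mul_lt_one_of_nonneg_of_lt_one_right (hR y) zero_le hlt
  rw [h, map_one, map_one] at h1
  exact lt_irrefl _ h1

theorem exists_valuation_eq_pow (hR : ∀ r : R, v (algebraMap R M r) ≤ 1) {p : R}
    (hp : Prime p) (hvp : v (algebraMap R M p) < 1) {r : R} (hr : r ≠ 0) :
    ∃ n : ℕ, v (algebraMap R M r) = v (algebraMap R M p) ^ n := by
  obtain ⟨n, s, hs, rfl⟩ := WfDvdMonoid.max_power_factor hr hp.irreducible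
  refine ⟨n, ?_⟩
  rw [map_mul, map_mul, map_pow, map_pow, valuation_eq_one_of_not_dvd hR hp hvp hs, mul_one]

/-- Scalars have values that are powers of v(p), so the nonzero terms of a linear relation have
pairwise distinct values. The largest one cannot be cancelled. -/
theorem linearIndependent_of_valuation_ne (hinj : Function.Injective (algebraMap R M))
    (hR : ∀ r : R, v (algebraMap R M r) ≤ 1) {p : R}
    (hp : Prime p) (hvp : v (algebraMap R M p) < 1) {κ : Type*} {y : κ → M}
    (hy0 : ∀ i, y i ≠ 0)
    (hy : ∀ i j, i ≠ j → ∀ k l : ℕ,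
      v (algebraMap R M p) ^ k * v (y i) ≠ v (algebraMap R M p) ^ l * v (y j)) :
    LinearIndependent R y := by
  classical
  rw [linearIndependent_iff']
  intro s g hg
  by_contra! hne
  let s' := s.filter fun i => g i ≠ 0
  have hs' : s'.Nonempty := by
    obtain ⟨i, hi, hi0⟩ := hne
    exact ⟨i, Finset.mem_filter.2 ⟨hi, hi0⟩⟩
  obtain ⟨i, hi, hmax⟩ := s'.exists_max_image (fun i => v (g i • y i)) hs'
  have hi0 : g i ≠ 0 := (Finset.mem_filter.1 hi).2
  have hv : ∀ j, v (g j • y j) = v (algebraMap R M (g j)) * v (y j) := fun j => by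
    rw [Algebra.smul_def, map_mul]
  have hne0 : v (g i • y i) ≠ 0 := by
    rw [hv]
    refine mul_ne_zero ?_ ((Valuation.ne_zero_iff _).2 (hy0 i))
    rw [Valuation.ne_zero_iff]
    exact fun h => hi0 (hinj (h.trans (map_zero _).symm))
  have hsum : g i • y i + ∑ j ∈ s'.erase i, g j • y j = 0 := by
    rw [Finset.add_sum_erase s' (fun j => g j • y j) hi, ← hg]
    refine Finset.sum_filter_of_ne fun j _ hj h => hj ?_
    rw [h, zero_smul]
  have hlt : v (∑ j ∈ s'.erase i, g j • y j) < v (g i • y i) := by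
    refine v.map_sum_lt hne0 fun j hj => lt_of_le_of_ne (hmax j (Finset.mem_of_mem_erase hj)) ?_
    have hj0 : g j ≠ 0 := (Finset.mem_filter.1 (Finset.mem_of_mem_erase hj)).2
    obtain ⟨k, hk⟩ := exists_valuation_eq_pow hR hp hvp hi0
    obtain ⟨l, hl⟩ := exists_valuation_eq_pow hR hp hvp hj0
    rw [hv, hv, hk, hl]
    exact hy j i (Finset.ne_of_mem_erase hj) l k
  rw [← neg_eq_of_add_eq_zero_right hsum, Valuation.map_neg] at hlt
  exact lt_irrefl _ hlt

/-- A nontrivial valuation of a finite extension of the fraction field of a principal ideal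
domain, nonnegative on the latter, is discrete. -/
theorem exists_uniformizer (hinj : Function.Injective (algebraMap R M))
    [Algebra.IsAlgebraic R M] {N : ℕ} (hrank : Module.rank R M ≤ N)
    (hR : ∀ r : R, v (algebraMap R M r) ≤ 1) {p : R}
    (hp : Prime p) (hvp : v (algebraMap R M p) < 1) :
    ∃ π : M, π ≠ 0 ∧ v π < 1 ∧ ∀ x, x ≠ 0 → ∃ k : ℤ, v x = v π ^ k := by
  classical
  set γ := v (algebraMap R M p) with hγ
  have hp0 : algebraMap R M p ≠ 0 := fun h => hp.ne_zero (hinj (h.trans (map_zero _).symm))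
  have hγ0 : 0 < γ := (Valuation.pos_iff _).2 hp0
  -- Distinct values in [γ, 1) stay distinct modulo powers of γ. Elements with these values are
  -- independent over R, so there are at most N; an element with the largest such value will be the
  -- uniformizer.
  let S : Set Γ₀ := {δ | (∃ x, v x = δ) ∧ γ ≤ δ ∧ δ < 1}
  have hSfin : S.Finite := by
    by_contra hinf
    obtain ⟨s, hs, hcard⟩ := Set.Infinite.exists_subset_card_eq hinf (N + 1)
    choose! y hy using fun δ (h : δ ∈ S) => h.1
    have hind : LinearIndependent R fun i : s => y i := by
      refine linearIndependent_of_valuation_ne hinj hR hp hvp (fun i => ?_)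
        fun i j hij k l h => ?_
      · rw [← Valuation.ne_zero_iff v, hy _ (hs i.2)]
        exact (hγ0.trans_le (hs i.2).2.1).ne'
      · rw [hy _ (hs i.2), hy _ (hs j.2), ← hγ] at h
        have key : ∀ (i j : s) (k l : ℕ), γ ^ k * (i : Γ₀) = γ ^ l * j → k < l → False := by
          intro i j k l h hkl
          obtain ⟨m, rfl⟩ := Nat.exists_eq_add_of_lt hkl
          rw [add_assoc, pow_add, mul_assoc] at h
          have h1 := mul_left_cancel₀ (pow_ne_zero k hγ0.ne') h
          have h2 : γ ^ (m + 1) * (j : Γ₀) < γ := by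
            rw [pow_succ', mul_assoc]
            refine mul_lt_of_lt_one_right hγ0 ?_
            refine mul_lt_one_of_nonneg_of_lt_one_right (pow_le_one₀ hγ0.le hvp.le) zero_le
              (hs j.2).2.2
          rw [← h1] at h2
          exact absurd h2 (not_lt.2 (hs i.2).2.1)
        rcases lt_trichotomy k l with hkl | rfl | hkl
        · exact key i j k l h hkl
        · exact hij (Subtype.ext (mul_left_cancel₀ (pow_ne_zero k hγ0.ne') h))
        · exact key j i l k h.symm hkl
    have h1 := hind.card_le_of_rank_le hrank
    rw [Fintype.card_coe, hcard] at h1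
    omega
  have hγS : γ ∈ S := ⟨⟨_, rfl⟩, le_rfl, hvp⟩
  obtain ⟨δ, hδ, hmax⟩ := hSfin.toFinset.exists_max_image id ⟨γ, hSfin.mem_toFinset.2 hγS⟩
  rw [hSfin.mem_toFinset] at hδ
  obtain ⟨⟨π, rfl⟩, hπγ, hπ1⟩ := hδ
  have hπpos : 0 < v π := hγ0.trans_le hπγ
  have hle : ∀ x, v x < 1 → v x ≤ v π := by
    intro x hx
    rcases lt_or_ge (v x) γ with h | h
    · exact h.le.trans hπγ
    · exact hmax _ (hSfin.mem_toFinset.2 ⟨⟨x, rfl⟩, h, hx⟩)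
  have hpow : ∃ n : ℕ, v π ^ n < γ := by
    by_contra! h
    -- The exponent is shifted by one because the value 1 is excluded from `S`.
    refine Set.infinite_of_injective_forall_mem (f := fun n : ℕ => v π ^ (n + 1)) ?_ (fun n => ?_)
      hSfin
    · intro m n hmn
      exact Nat.succ_injective ((pow_right_strictAnti₀ hπpos hπ1).injective hmn)
    · exact ⟨⟨π ^ (n + 1), map_pow _ _ _⟩, h _, pow_lt_one₀ hπpos.le hπ1 n.succ_ne_zero⟩
  -- Some nonzero multiple r x⁻¹ is integral over R, so v(r) ≤ v(x); and v(r) is a power of γ, which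
  -- exceeds a power of v(π).
  have harch : ∀ x, x ≠ 0 → v x ≤ 1 → ∃ n : ℕ, v π ^ n ≤ v x := by
    intro x hx hx1
    have halg : IsAlgebraic R x⁻¹ := Algebra.IsAlgebraic.isAlgebraic x⁻¹
    obtain ⟨r, hr, hint⟩ := halg.exists_integral_multiple
    have h1 : v (r • x⁻¹) ≤ 1 := by
      have hOint : ∀ z : M, IsIntegral v.integer z → v z ≤ 1 := fun z hz => by
        obtain ⟨w, hw⟩ := (IsIntegrallyClosed.isIntegral_iff (R := v.integer) (K := M)).1 hz
        rw [← hw]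
        exact w.2
      refine hOint _ (hint.map_of_comp_eq ((algebraMap R M).codRestrict v.integer hR)
        (RingHom.id M) rfl)
    obtain ⟨n, hn⟩ := hpow
    obtain ⟨m, hm⟩ := exists_valuation_eq_pow hR hp hvp hr
    refine ⟨n * m, ?_⟩
    rw [Algebra.smul_def, map_mul, map_inv₀, ← div_eq_mul_inv, div_le_one₀
      ((Valuation.pos_iff v).2 hx), hm] at h1
    refine le_trans ?_ h1
    rw [pow_mul]
    exact pow_le_pow_left₀ zero_le hn.le m
  have hnat : ∀ x, x ≠ 0 → v x ≤ 1 → ∃ n : ℕ, v x = v π ^ n := by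
    intro x hx hx1
    have hex := harch x hx hx1
    -- Let n be least with v(π)ⁿ ≤ v(x). If n > 0, then x / πⁿ⁻¹ has value less than 1, hence at
    -- most v(π), which gives equality.
    refine ⟨Nat.find hex, le_antisymm ?_ (Nat.find_spec hex)⟩
    rcases Nat.eq_zero_or_pos (Nat.find hex) with h0 | h0
    · rw [h0, pow_zero]
      exact hx1
    · obtain ⟨m, hm⟩ := Nat.exists_eq_succ_of_ne_zero h0.ne'
      have h2 := not_le.1 (Nat.find_min hex (m := m) (by omega))
      have h3 : v (x / π ^ m) < 1 := by
        rw [map_div₀, map_pow]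
        exact (div_lt_one₀ (pow_pos hπpos m)).2 h2
      have h4 := hle _ h3
      rw [map_div₀, map_pow, div_le_iff₀ (pow_pos hπpos m), ← pow_succ'] at h4
      rwa [hm]
  refine ⟨π, (Valuation.pos_iff v).1 hπpos, hπ1, fun x hx => ?_⟩
  rcases le_total (v x) 1 with h | h
  · obtain ⟨n, hn⟩ := hnat x hx h
    exact ⟨n, by rw [hn, zpow_natCast]⟩
  · obtain ⟨n, hn⟩ := hnat x⁻¹ (inv_ne_zero hx)
      (by rw [map_inv₀]; exact inv_le_one_of_one_le₀ h)
    refine ⟨-n, ?_⟩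
    rw [zpow_neg, zpow_natCast, ← hn, map_inv₀, inv_inv]

end Valuation

/-- Lifts of residues independent over R/p are independent over R: in a relation all coefficients
are divisible by p, and dividing by p repeatedly would give a nonzero coefficient infinite
multiplicity. So the residue field has dimension at most N over the finite field R/p. -/
theorem finite_residueField_of_prime (hinj : Function.Injective (algebraMap R M))
    {N : ℕ} (hrank : Module.rank R M ≤ N) (O : ValuationSubring M)
    (hR : ∀ r : R, algebraMap R M r ∈ O) {p : R} (hp : Prime p)
    (hvp : O.valuation (algebraMap R M p) < 1) [Finite (R ⧸ Ideal.span {p})] :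
    Finite (IsLocalRing.ResidueField O) := by
  classical
  have hp0 : algebraMap R M p ≠ 0 := fun h => hp.ne_zero (hinj (h.trans (map_zero _).symm))
  let f : R →+* O := (algebraMap R M).codRestrict O.toSubring hR
  let res : R →+* IsLocalRing.ResidueField O := (IsLocalRing.residue O).comp f
  have hresp : res p = 0 := by
    refine (IsLocalRing.residue_eq_zero_iff _).2 ?_
    rw [ValuationSubring.valuation_lt_one_iff]
    exact hvp
  have : (Ideal.span {p}).IsMaximal :=
    PrincipalIdealRing.isMaximal_of_irreducible hp.irreducible
  let _ : Field (R ⧸ Ideal.span {p}) := Ideal.Quotient.field _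
  let _ : Algebra (R ⧸ Ideal.span {p}) (IsLocalRing.ResidueField O) :=
    (Ideal.Quotient.lift (Ideal.span {p}) res fun r hr => by
      obtain ⟨s, rfl⟩ := Ideal.mem_span_singleton.1 hr
      rw [map_mul, hresp, zero_mul]).toAlgebra
  have hsmul : ∀ (r : R) (x : IsLocalRing.ResidueField O),
      (Ideal.Quotient.mk (Ideal.span {p}) r) • x = res r * x := fun r x => rfl
  have hrank' : Module.rank (R ⧸ Ideal.span {p}) (IsLocalRing.ResidueField O) ≤ N := by
    refine rank_le fun s hs => ?_
    choose y hy using fun i : s => IsLocalRing.residue_surjective (R := O) i.1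
    have hind : LinearIndependent R fun i : s => (y i : M) := by
      rw [Fintype.linearIndependent_iff] at hs ⊢
      have hstep : ∀ g : s → R, ∑ i, g i • (y i : M) = 0 → ∀ i, p ∣ g i := by
        intro g hg i
        have h1 : ∑ i, f (g i) * y i = 0 := by
          refine Subtype.ext (Eq.trans ?_ hg)
          simp [f, Algebra.smul_def]
        have h2 := congrArg (IsLocalRing.residue O) h1
        rw [map_sum, map_zero] at h2
        have h3 := hs (fun i => Ideal.Quotient.mk _ (g i)) (by
          rw [← h2]
          refine Finset.sum_congr rfl fun i _ => ?_
          rw [hsmul, map_mul, hy]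
          rfl) i
        exact Ideal.mem_span_singleton.1 (Ideal.Quotient.eq_zero_iff_mem.1 h3)
      have hpow : ∀ (n : ℕ) (g : s → R), ∑ i, g i • (y i : M) = 0 → ∀ i, p ^ n ∣ g i := by
        intro n
        induction n with
        | zero => intro g _ i; simp
        | succ n ih =>
          intro g hg i
          choose g' hg' using hstep g hg
          have : ∑ i, g' i • (y i : M) = 0 := by
            refine mul_left_cancel₀ hp0 ?_
            rw [mul_zero, ← hg, Finset.mul_sum]
            refine Finset.sum_congr rfl fun i _ => ?_
            rw [hg' i, Algebra.smul_def, Algebra.smul_def, map_mul, mul_assoc]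
          rw [hg' i, pow_succ']
          exact mul_dvd_mul_left p (ih g' this i)
      intro g hg i
      by_contra h
      obtain ⟨n, hn⟩ := FiniteMultiplicity.of_prime_left hp h
      exact hn (hpow (n + 1) g hg i)
    have h1 := hind.card_le_of_rank_le hrank
    rwa [Fintype.card_coe] at h1
  have : Module.Finite (R ⧸ Ideal.span {p}) (IsLocalRing.ResidueField O) :=
    Module.rank_lt_aleph0_iff.1 (hrank'.trans_lt (Cardinal.natCast_lt_aleph0))
  exact Module.finite_of_finite (R ⧸ Ideal.span {p})

/-- The maximal ideal of O contracts to a prime of R. Were it zero, all nonzero elements of R would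
be units of O, and since each x has a nonzero multiple integral over R, O would be all of M. -/
theorem exists_prime_valuation_lt_one [Algebra.IsAlgebraic R M] (O : ValuationSubring M) (hO : O ≠ ⊤)
    (hR : ∀ r : R, algebraMap R M r ∈ O) :
    ∃ p : R, Prime p ∧ O.valuation (algebraMap R M p) < 1 := by
  let f : R →+* O := (algebraMap R M).codRestrict O.toSubring hR
  let P : Ideal R := (IsLocalRing.maximalIdeal O).comap f
  have hmem : ∀ r, r ∈ P ↔ O.valuation (algebraMap R M r) < 1 := fun r => by
    rw [Ideal.mem_comap, ValuationSubring.valuation_lt_one_iff]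
    rfl
  have hP : P ≠ ⊥ := by
    intro hbot
    refine hO (eq_top_iff.2 fun x _ => ?_)
    have halg : IsAlgebraic R x := Algebra.IsAlgebraic.isAlgebraic x
    obtain ⟨r, hr, hint⟩ := halg.exists_integral_multiple
    have h1 : r • x ∈ O := by
      obtain ⟨w, hw⟩ := (IsIntegrallyClosed.isIntegral_iff (R := O) (K := M)).1
        (hint.map_of_comp_eq f (RingHom.id M) rfl)
      have hw' : (w : M) = r • x := hw
      rw [← hw']
      exact w.2
    have h2 : O.valuation (algebraMap R M r) = 1 := by
      refine le_antisymm ((O.valuation_le_one_iff _).2 (hR r)) (not_lt.1 fun h => hr ?_)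
      rw [← hmem, hbot] at h
      exact h
    rw [← ValuationSubring.valuation_le_one_iff, Algebra.smul_def, map_mul, h2, one_mul] at h1
    exact (O.valuation_le_one_iff _).1 h1
  have : P.IsPrime := Ideal.comap_isPrime f _
  obtain ⟨p, hp⟩ := IsPrincipalIdealRing.principal P
  have hpP : p ∈ P := by
    rw [hp]
    exact Ideal.mem_span_singleton_self p
  refine ⟨p, ?_, (hmem p).1 hpP⟩
  have hp0 : p ≠ 0 := fun h => hP (by rw [hp, h]; simp)
  rw [← Ideal.span_singleton_prime hp0]
  have : P = Ideal.span {p} := hp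
  rwa [← this]

/-- The residue field is finite and the valuation is discrete. -/
def IsFiniteDiscrete {M : Type*} [Field M] (O : ValuationSubring M) : Prop :=
  Finite (IsLocalRing.ResidueField O) ∧ ∃ π : M, π ≠ 0 ∧ O.valuation π < 1 ∧
    ∀ x, x ≠ 0 → ∃ k : ℤ, O.valuation x = O.valuation π ^ k

theorem isFiniteDiscrete_of_pid (hinj : Function.Injective (algebraMap R M))
    [Algebra.IsAlgebraic R M] {N : ℕ} (hrank : Module.rank R M ≤ N) (O : ValuationSubring M) (hO : O ≠ ⊤)
    (hfin : ∀ p : R, Prime p → Finite (R ⧸ Ideal.span {p}))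
    (hR : ∀ r : R, algebraMap R M r ∈ O) : IsFiniteDiscrete O := by
  obtain ⟨p, hp, hvp⟩ := exists_prime_valuation_lt_one O hO hR
  have := hfin p hp
  exact ⟨finite_residueField_of_prime hinj hrank O hR hp hvp,
    exists_uniformizer hinj hrank (fun r => (O.valuation_le_one_iff _).2 (hR r)) hp hvp⟩

end DiscreteValuation

/-! ### Discreteness and finite residue fields over global fields. -/

section GlobalField

open Polynomial

variable {M : Type*} [Field M]

theorem isFiniteDiscrete_of_fractionRing (R K₀ : Type*) [CommRing R] [IsDomain R]
    [IsPrincipalIdealRing R] [Field K₀] [Algebra R K₀] [IsFractionRing R K₀] [Algebra K₀ M]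
    [Algebra R M] [IsScalarTower R K₀ M] [FiniteDimensional K₀ M] (O : ValuationSubring M)
    (hO : O ≠ ⊤) (hfin : ∀ p : R, Prime p → Finite (R ⧸ Ideal.span {p}))
    (hR : ∀ r : R, algebraMap R M r ∈ O) : IsFiniteDiscrete O := by
  have hinj : Function.Injective (algebraMap R M) := by
    rw [IsScalarTower.algebraMap_eq R K₀ M]
    exact (algebraMap K₀ M).injective.comp (IsFractionRing.injective R K₀)
  have : Algebra.IsAlgebraic R M := (IsFractionRing.comap_isAlgebraic_iff (K := K₀)).2 inferInstance
  refine isFiniteDiscrete_of_pid hinj (N := Module.finrank K₀ M) ?_ O hO hfin hR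
  rw [Module.finrank_eq_rank, IsLocalization.rank_eq K₀ (nonZeroDivisors R) le_rfl]

/-- The substitution X ↦ X⁻¹ reduces valuations with a pole at X to those for which X is integral.
-/
theorem exists_ratFunc_inv (k : Type*) [Field k] :
    ∃ ψ : RatFunc k →+* RatFunc k, ψ RatFunc.X = RatFunc.X⁻¹ ∧ Function.Surjective ψ := by
  have ht : Transcendental k (RatFunc.X : RatFunc k)⁻¹ := fun h =>
    RatFunc.transcendental_X (by simpa using h.inv)
  let ψ : RatFunc k →+* RatFunc k := IsFractionRing.lift (A := k[X])
    (g := (aeval (R := k) (RatFunc.X : RatFunc k)⁻¹).toRingHom)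
    (transcendental_iff_injective.1 ht)
  have hψ : ∀ f : k[X], ψ (algebraMap k[X] (RatFunc k) f) = aeval (RatFunc.X : RatFunc k)⁻¹ f :=
    fun f => IsFractionRing.lift_algebraMap _ f
  have hX : ψ RatFunc.X = RatFunc.X⁻¹ := by
    rw [← RatFunc.algebraMap_X, hψ, aeval_X, RatFunc.algebraMap_X]
  have hψψ : ψ.comp ψ = RingHom.id _ := by
    refine IsLocalization.ringHom_ext (nonZeroDivisors k[X]) (Polynomial.ringHom_ext (fun c => ?_) ?_)
    · simp only [RingHom.comp_apply, hψ, aeval_C, RingHom.id_apply]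
      rw [IsScalarTower.algebraMap_apply k k[X] (RatFunc k), hψ, algebraMap_eq, aeval_C,
        IsScalarTower.algebraMap_apply k k[X] (RatFunc k), algebraMap_eq]
    · simp only [RingHom.comp_apply, RatFunc.algebraMap_X, hX, map_inv₀, inv_inv, RingHom.id_apply]
  exact ⟨ψ, hX, fun x => ⟨ψ x, congrArg (fun f : RatFunc k →+* RatFunc k => f x) hψψ⟩⟩

/-- Here O contains the image of 𝔽_p[X], a principal ideal domain with finite residue rings. The
embedding is an explicit ring homomorphism so that it can be precomposed with X ↦ X⁻¹. -/
theorem isFiniteDiscrete_of_ratFunc {p : ℕ} [Fact p.Prime] (f : RatFunc (ZMod p) →+* M)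
    (hf : f.Finite) (O : ValuationSubring M) (hO : O ≠ ⊤) (hX : f RatFunc.X ∈ O) :
    IsFiniteDiscrete O := by
  let _ : Algebra (RatFunc (ZMod p)) M := f.toAlgebra
  let _ : Algebra (ZMod p)[X] M := (f.comp (algebraMap (ZMod p)[X] (RatFunc (ZMod p)))).toAlgebra
  have : IsScalarTower (ZMod p)[X] (RatFunc (ZMod p)) M := IsScalarTower.of_algebraMap_eq' rfl
  have : FiniteDimensional (RatFunc (ZMod p)) M := hf
  refine isFiniteDiscrete_of_fractionRing (ZMod p)[X] (RatFunc (ZMod p)) O hO (fun q hq => ?_)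
    fun r => ?_
  · have hfd : Module.Finite (ZMod p) (AdjoinRoot q) := by
      have := (AdjoinRoot.powerBasis hq.ne_zero).finite
      exact this
    exact Module.finite_of_finite (ZMod p) (M := AdjoinRoot q)
  · change f (algebraMap (ZMod p)[X] (RatFunc (ZMod p)) r) ∈ O
    induction r using Polynomial.induction_on' with
    | add r s hr hs => rw [map_add, map_add]; exact O.add_mem _ _ hr hs
    | monomial n c =>
      rw [← C_mul_X_pow_eq_monomial, map_mul, map_mul, map_pow, map_pow, RatFunc.algebraMap_X]
      refine O.mul_mem _ _ ?_ (pow_mem hX n)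
      have : f (algebraMap (ZMod p)[X] (RatFunc (ZMod p)) (C c)) = (c.val : M) := by
        have hc : (C c : (ZMod p)[X]) = (c.val : (ZMod p)[X]) := by
          rw [← map_natCast C, ZMod.natCast_zmod_val]
        rw [hc, map_natCast, map_natCast]
      rw [this]
      exact natCast_mem O _

/-- Nontrivial valuations of finite extensions of a global field are discrete with finite
residue field. -/
theorem IsGlobalField.isFiniteDiscrete {F : Type*} [Field F] (hF : IsGlobalField F) [Algebra F M]
    [FiniteDimensional F M] (O : ValuationSubring M) (hO : O ≠ ⊤) : IsFiniteDiscrete O := by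
  rcases hF with hF | ⟨p, hp, hA, hfin⟩
  · have : CharZero M := charZero_of_injective_algebraMap (algebraMap F M).injective
    have : FiniteDimensional ℚ M := FiniteDimensional.trans ℚ F M
    refine isFiniteDiscrete_of_fractionRing ℤ ℚ O hO (fun q hq => ?_) fun r => ?_
    · have : NeZero q := ⟨hq.ne_zero⟩
      infer_instance
    · rw [algebraMap_int_eq, eq_intCast]
      exact intCast_mem O r
  · let f : RatFunc (ZMod p) →+* M := (algebraMap F M).comp (algebraMap (RatFunc (ZMod p)) F)
    have hf : f.Finite := RingHom.Finite.comp (RingHom.finite_algebraMap.2 inferInstance)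
      (RingHom.finite_algebraMap.2 hfin)
    rcases O.mem_or_inv_mem (f RatFunc.X) with h | h
    · exact isFiniteDiscrete_of_ratFunc f hf O hO h
    · obtain ⟨ψ, hψ, hsurj⟩ := exists_ratFunc_inv (ZMod p)
      refine isFiniteDiscrete_of_ratFunc (f.comp ψ)
        (hf.comp (RingHom.Finite.of_surjective ψ hsurj)) O hO ?_
      rw [RingHom.comp_apply, hψ, map_inv₀]
      exact h

end GlobalField

/-! ### Galois-invariant valuation rings and their inertia groups. -/

section Decomposition

open scoped Pointwise

variable {F K : Type*} [Field F] [Field K] [Algebra F K]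

theorem ValuationSubring.smul_eq_of_forall_mem {O : ValuationSubring K}
    (hO : ∀ (σ : K ≃ₐ[F] K), ∀ x ∈ O, σ x ∈ O) (σ : K ≃ₐ[F] K) : σ • O = O := by
  refine SetLike.ext fun x => ?_
  rw [ValuationSubring.mem_smul_pointwise_iff_exists]
  constructor
  · rintro ⟨y, hy, rfl⟩
    exact hO σ y hy
  · intro hx
    exact ⟨σ⁻¹ x, hO _ _ hx, by
      rw [AlgEquiv.smul_def, ← AlgEquiv.mul_apply, mul_inv_cancel, AlgEquiv.one_apply]⟩

/-- A Galois-invariant valuation ring is the only one lying over its restriction. -/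
theorem ValuationSubring.eq_of_comap_eq [FiniteDimensional F K] [IsGalois F K]
    {O B : ValuationSubring K} (hO : ∀ (σ : K ≃ₐ[F] K), ∀ x ∈ O, σ x ∈ O)
    (h : B.comap (algebraMap F K) = O.comap (algebraMap F K)) : B = O := by
  set A₀ := O.comap (algebraMap F K) with hA₀
  let _ : Algebra A₀ O := (((algebraMap F K).comp A₀.subtype).codRestrict O.toSubring
    fun x => x.2).toAlgebra
  -- The Galois group acts on O with ring of invariants A₀, so each element of O is a root of its
  -- monic orbit polynomial over A₀.
  have hint : Algebra.IsIntegral A₀ O := by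
    have : Algebra.IsInvariant A₀ O (O.decompositionSubgroup F) := by
      refine ⟨fun b hb => ?_⟩
      have hb' : ∀ σ : K ≃ₐ[F] K, σ b = b := fun σ =>
        congrArg Subtype.val (hb ⟨σ, ValuationSubring.smul_eq_of_forall_mem hO σ⟩)
      obtain ⟨c, hc⟩ := (IsGalois.mem_range_algebraMap_iff_fixed (b : K)).2 hb'
      exact ⟨⟨c, by rw [hA₀, ValuationSubring.mem_comap, hc]; exact b.2⟩, Subtype.ext hc⟩
    exact Algebra.IsInvariant.isIntegral A₀ O (O.decompositionSubgroup F)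
  have hle : O ≤ B := by
    intro x hx
    have hmem : ∀ y ∈ A₀, algebraMap F K y ∈ B := fun y hy => by
      rw [← h] at hy
      exact hy
    let f : A₀ →+* B := ((algebraMap F K).comp A₀.subtype).codRestrict B.toSubring
      fun x => hmem x x.2
    have h1 : IsIntegral B x :=
      (hint.isIntegral ⟨x, hx⟩).map_of_comp_eq f O.subtype rfl
    obtain ⟨w, hw⟩ := (IsIntegrallyClosed.isIntegral_iff (R := B) (K := K)).1 h1
    rw [← hw]
    exact w.2
  -- Overrings of O correspond to primes of O. The prime of B contracts to the maximal ideal of A₀,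
  -- so by integrality it is maximal, and B = O.
  let Q : Ideal O := ValuationSubring.idealOfLE O B hle
  have hQ : Q.comap (algebraMap A₀ O) = IsLocalRing.maximalIdeal A₀ := by
    ext a
    have hmem : ∀ y : B, y ∈ IsLocalRing.maximalIdeal B ↔ (y : K) = 0 ∨ (y : K)⁻¹ ∉ B := by
      intro y
      rw [ValuationSubring.valuation_lt_one_iff]
      rcases eq_or_ne (y : K) 0 with h0 | h0
      · simp [h0]
      · rw [← ValuationSubring.valuation_le_one_iff, map_inv₀, not_le,
          one_lt_inv₀ ((Valuation.pos_iff _).2 h0)]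
        simp [h0]
    have h1 : a ∈ Q.comap (algebraMap A₀ O) ↔
        (algebraMap F K a = 0 ∨ (algebraMap F K a)⁻¹ ∉ B) := hmem _
    rw [h1, ValuationSubring.valuation_lt_one_iff, ← map_inv₀, ← ValuationSubring.mem_comap, h]
    rcases eq_or_ne (a : F) 0 with h0 | h0
    · simp [h0]
    · rw [← ValuationSubring.valuation_le_one_iff A₀, map_inv₀, not_le,
        one_lt_inv₀ ((Valuation.pos_iff _).2 h0)]
      simp [h0]
  have hmax : Q.IsMaximal := by
    refine Ideal.isMaximal_of_isIntegral_of_isMaximal_comap (R := A₀) Q ?_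
    rw [hQ]
    infer_instance
  have hQm : Q = IsLocalRing.maximalIdeal O := IsLocalRing.eq_maximalIdeal hmax
  refine le_antisymm (fun x hx => ?_) hle
  by_contra hxO
  have hx0 : x ≠ 0 := fun h0 => hxO (h0 ▸ O.zero_mem)
  have h1 : O.valuation x⁻¹ < 1 := by
    rw [map_inv₀, inv_lt_one₀ ((Valuation.pos_iff _).2 hx0)]
    exact not_le.1 fun h2 => hxO ((O.valuation_le_one_iff _).1 h2)
  have h2 : (⟨x⁻¹, (O.valuation_le_one_iff _).1 h1.le⟩ : O) ∈ Q := by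
    rw [hQm, ValuationSubring.valuation_lt_one_iff]
    exact h1
  have h3 : B.valuation x⁻¹ < 1 := (ValuationSubring.valuation_lt_one_iff B _).1 h2
  rw [map_inv₀, inv_lt_one₀ ((Valuation.pos_iff _).2 hx0)] at h3
  exact absurd ((B.valuation_le_one_iff _).2 hx) (not_le.2 h3)

theorem mem_inertiaSubgroup_iff {B : ValuationSubring K} (σ : B.decompositionSubgroup F) :
    σ ∈ B.inertiaSubgroup F ↔ ∀ x ∈ B, B.valuation ((σ : K ≃ₐ[F] K) x - x) < 1 := by
  have key : ∀ x : B, σ • IsLocalRing.residue B x = IsLocalRing.residue B x ↔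
      B.valuation ((σ : K ≃ₐ[F] K) x - x) < 1 := by
    intro x
    rw [← IsLocalRing.ResidueField.residue_smul, ← sub_eq_zero, ← map_sub,
      IsLocalRing.residue_eq_zero_iff, ValuationSubring.valuation_lt_one_iff]
    rfl
  constructor
  · intro h x hx
    refine (key ⟨x, hx⟩).1 ?_
    exact congrArg (fun f : RingAut _ => f (IsLocalRing.residue B ⟨x, hx⟩)) h
  · intro h
    refine RingEquiv.ext fun y => ?_
    obtain ⟨x, rfl⟩ := IsLocalRing.residue_surjective y
    exact (key x).2 (h x x.2)

theorem mem_inertiaGroup_iff {B : ValuationSubring K} {σ : K ≃ₐ[F] K} :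
    σ ∈ inertiaGroup F B ↔ σ • B = B ∧ ∀ x ∈ B, B.valuation (σ x - x) < 1 := by
  rw [inertiaGroup, Subgroup.mem_map]
  constructor
  · rintro ⟨τ, hτ, rfl⟩
    exact ⟨τ.2, (mem_inertiaSubgroup_iff τ).1 hτ⟩
  · rintro ⟨h1, h2⟩
    exact ⟨⟨σ, h1⟩, (mem_inertiaSubgroup_iff _).2 h2, rfl⟩

/-- Every ring automorphism fixes the prime field, so the group is a quotient of the cyclic Galois
group over 𝔽_p. -/
theorem isCyclic_ringAut_of_finite (κ : Type*) [Field κ] [Finite κ] : IsCyclic (RingAut κ) := by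
  obtain ⟨p, hp⟩ := CharP.exists κ
  have : Fact p.Prime := ⟨CharP.char_is_prime κ p⟩
  let _ : Algebra (ZMod p) κ := ZMod.algebra κ p
  let f : (κ ≃ₐ[ZMod p] κ) →* RingAut κ :=
    { toFun := fun e => e.toRingEquiv
      map_one' := rfl
      map_mul' := fun _ _ => rfl }
  refine isCyclic_of_surjective f fun e => ⟨AlgEquiv.ofRingEquiv (f := e) fun c => ?_, rfl⟩
  rw [← ZMod.natCast_zmod_val c, map_natCast, map_natCast]

/-- The action of `Gal(K/F)` on the residue field of an invariant valuation ring. -/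
theorem exists_hom_ker_eq_inertiaGroup {O : ValuationSubring K}
    (hO : ∀ (σ : K ≃ₐ[F] K), ∀ x ∈ O, σ x ∈ O) :
    ∃ f : (K ≃ₐ[F] K) →* RingAut (IsLocalRing.ResidueField O), f.ker = inertiaGroup F O := by
  let i : (K ≃ₐ[F] K) →* O.decompositionSubgroup F :=
    (MonoidHom.id _).codRestrict _ fun σ => ValuationSubring.smul_eq_of_forall_mem hO σ
  refine ⟨(MulSemiringAction.toRingAut (O.decompositionSubgroup F) _).comp i, ?_⟩
  ext σ
  rw [mem_inertiaGroup_iff]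
  change i σ ∈ O.inertiaSubgroup F ↔ _
  rw [mem_inertiaSubgroup_iff]
  exact ⟨fun h => ⟨ValuationSubring.smul_eq_of_forall_mem hO σ, h⟩, fun h => h.2⟩

theorem normal_inertiaGroup {O : ValuationSubring K}
    (hO : ∀ (σ : K ≃ₐ[F] K), ∀ x ∈ O, σ x ∈ O) : (inertiaGroup F O).Normal := by
  obtain ⟨f, hf⟩ := exists_hom_ker_eq_inertiaGroup hO
  rw [← hf]
  infer_instance

/-- The quotient acts faithfully on the finite residue field. -/
theorem isCyclic_quotient_inertiaGroup {O : ValuationSubring K}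
    (hO : ∀ (σ : K ≃ₐ[F] K), ∀ x ∈ O, σ x ∈ O) [(inertiaGroup F O).Normal]
    [Finite (IsLocalRing.ResidueField O)] : IsCyclic ((K ≃ₐ[F] K) ⧸ inertiaGroup F O) := by
  obtain ⟨f, hf⟩ := exists_hom_ker_eq_inertiaGroup hO
  have := isCyclic_ringAut_of_finite (IsLocalRing.ResidueField O)
  have h1 : IsCyclic ((K ≃ₐ[F] K) ⧸ f.ker) :=
    isCyclic_of_injective (QuotientGroup.kerLift f) (QuotientGroup.kerLift_injective f)
  exact isCyclic_of_surjective (QuotientGroup.quotientMulEquivOfEq hf)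
    (QuotientGroup.quotientMulEquivOfEq hf).surjective

end Decomposition

/-! ### The tame character and the commutation obstruction. -/

section TameInertia

variable {M Γ₀ : Type*} [Field M] [LinearOrderedCommGroupWithZero Γ₀] {w : Valuation M Γ₀}

theorem Valuation.eq_one_of_sub_one_lt {c : M} (hc : w (c - 1) < 1) : w c = 1 := by
  have := w.map_one_add_of_lt hc
  rwa [add_sub_cancel] at this

theorem Valuation.mul_sub_one_lt {c d : M} (hc : w (c - 1) < 1) (hd : w (d - 1) < 1) :
    w (c * d - 1) < 1 := by
  have h : c * d - 1 = c * (d - 1) + (c - 1) := by ring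
  rw [h]
  refine w.map_add_lt ?_ hc
  rwa [map_mul, Valuation.eq_one_of_sub_one_lt hc, one_mul]

theorem Valuation.inv_sub_one_lt {c : M} (hc : w (c - 1) < 1) : w (c⁻¹ - 1) < 1 := by
  have h1 := Valuation.eq_one_of_sub_one_lt hc
  have hc0 : c ≠ 0 := fun h => by simp [h] at h1
  have h : c⁻¹ - 1 = -(c⁻¹ * (c - 1)) := by field_simp; ring
  rw [h, Valuation.map_neg, map_mul, map_inv₀, h1, inv_one, one_mul]
  exact hc

theorem Valuation.zpow_sub_one_lt {c : M} (hc : w (c - 1) < 1) (k : ℤ) : w (c ^ k - 1) < 1 := by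
  have hnat : ∀ n : ℕ, w (c ^ n - 1) < 1 := by
    intro n
    induction n with
    | zero => simp
    | succ n ih => rw [pow_succ]; exact Valuation.mul_sub_one_lt ih hc
  obtain ⟨n, rfl | rfl⟩ := k.eq_nat_or_neg
  · rw [zpow_natCast]; exact hnat n
  · rw [zpow_neg, zpow_natCast]; exact Valuation.inv_sub_one_lt (hnat n)

variable {F : Type*} [Field F] [Algebra F M]

theorem mem_inertiaGroup_valuationSubring_iff (hinv : ∀ (g : M ≃ₐ[F] M) x, w (g x) = w x)
    {t : M ≃ₐ[F] M} :
    t ∈ inertiaGroup F w.valuationSubring ↔ ∀ x, w x ≤ 1 → w (t x - x) < 1 := by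
  rw [mem_inertiaGroup_iff]
  have h1 : ∀ x, w.valuationSubring.valuation x < 1 ↔ w x < 1 := fun x =>
    w.isEquiv_valuation_valuationSubring.lt_one_iff_lt_one.symm
  simp only [h1, Valuation.mem_valuationSubring_iff]
  refine ⟨fun h => h.2, fun h => ⟨ValuationSubring.smul_eq_of_forall_mem (fun g x hx => ?_) t, h⟩⟩
  rw [Valuation.mem_valuationSubring_iff] at hx ⊢
  rwa [hinv]

theorem inertia_div_sub_one_lt (hinv : ∀ (g : M ≃ₐ[F] M) x, w (g x) = w x)
    {t : M ≃ₐ[F] M} (ht : t ∈ inertiaGroup F w.valuationSubring) {e : M} (he : w e = 1) :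
    w (t e / e - 1) < 1 := by
  have he0 : e ≠ 0 := fun h => by simp [h] at he
  have h := (mem_inertiaGroup_valuationSubring_iff hinv).1 ht e he.le
  have h2 : t e / e - 1 = (t e - e) / e := by field_simp
  rwa [h2, map_div₀, he, div_one]

/-- An inertia element of order two moves a uniformizer nontrivially. -/
theorem not_div_sub_one_lt_of_sq_eq_one (hinv : ∀ (g : M ≃ₐ[F] M) x, w (g x) = w x)
    (h2 : w 2 = 1) {π : M} (hπ0 : π ≠ 0) (hπ : ∀ x, x ≠ 0 → ∃ k : ℤ, w x = w π ^ k)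
    {t : M ≃ₐ[F] M} (ht : t ∈ inertiaGroup F w.valuationSubring) (htt : t * t = 1) (ht1 : t ≠ 1) :
    ¬ w (t π / π - 1) < 1 := by
  intro hlt
  obtain ⟨y, hy⟩ : ∃ y, t y ≠ y := by
    by_contra! h
    exact ht1 (AlgEquiv.ext h)
  have htt' : ∀ x, t (t x) = x := fun x => congrArg (fun f : M ≃ₐ[F] M => f x) htt
  set x := y - t y with hx
  have hx0 : x ≠ 0 := sub_ne_zero.2 hy.symm
  have htx : t x = -x := by rw [hx, map_sub, htt']; ring
  obtain ⟨k, hk⟩ := hπ x hx0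
  have hπk : π ^ k ≠ 0 := zpow_ne_zero k hπ0
  set e := x / π ^ k with he
  have hwe : w e = 1 := by
    rw [he, map_div₀, map_zpow₀, hk, div_self]
    exact zpow_ne_zero _ ((Valuation.ne_zero_iff _).2 hπ0)
  -- Write x = e πᵏ with e a unit. Inertia moves e by a factor ≡ 1, and by assumption πᵏ as well,
  -- whereas t x = -x; and -1 ≢ 1 because 2 is a unit.
  have h3 := Valuation.mul_sub_one_lt (inertia_div_sub_one_lt hinv ht hwe)
    (Valuation.zpow_sub_one_lt hlt k)
  have h4 : t e / e * (t π / π) ^ k = -1 := by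
    have htπ : t π ≠ 0 := (map_ne_zero t).2 hπ0
    rw [he, map_div₀, map_zpow₀, htx, div_zpow]
    have : t π ^ k ≠ 0 := zpow_ne_zero k htπ
    field_simp
  rw [h4, show (-1 - 1 : M) = -2 by ring, Valuation.map_neg, h2] at h3
  exact lt_irrefl _ h3

/-- The tame character t ↦ residue of t(π)/π is multiplicative on inertia. A nontrivial kernel would
contain an involution, which must move π by a factor not congruent to 1. Finite groups embedding in
the multiplicative structure of a field are cyclic. -/
theorem isCyclic_inertiaGroup [FiniteDimensional F M]
    (hinv : ∀ (g : M ≃ₐ[F] M) x, w (g x) = w x) (hG : IsPGroup 2 (M ≃ₐ[F] M))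
    (h2 : w 2 = 1) {π : M} (hπ0 : π ≠ 0) (hπ : ∀ x, x ≠ 0 → ∃ k : ℤ, w x = w π ^ k) :
    IsCyclic (inertiaGroup F w.valuationSubring) := by
  set O := w.valuationSubring
  have hwπ : w π ≠ 0 := (Valuation.ne_zero_iff _).2 hπ0
  have hmem : ∀ t : M ≃ₐ[F] M, t π / π ∈ O := fun t => by
    rw [Valuation.mem_valuationSubring_iff, map_div₀, hinv, div_self hwπ]
  have hval : ∀ x, O.valuation x < 1 ↔ w x < 1 := fun x =>
    w.isEquiv_valuation_valuationSubring.lt_one_iff_lt_one.symm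
  have hres : ∀ x y : O, w (x - y) < 1 ↔ IsLocalRing.residue O x = IsLocalRing.residue O y := by
    intro x y
    rw [← sub_eq_zero (a := IsLocalRing.residue O x), ← map_sub, IsLocalRing.residue_eq_zero_iff,
      ValuationSubring.valuation_lt_one_iff, hval]
    rfl
  let f : inertiaGroup F O →* IsLocalRing.ResidueField O :=
    { toFun := fun t => IsLocalRing.residue O ⟨(t : M ≃ₐ[F] M) π / π, hmem t⟩
      map_one' := by
        rw [← map_one (IsLocalRing.residue O), ← hres]
        simp [hπ0]
      map_mul' := fun t s => by
        rw [← map_mul, ← hres]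
        have hts : (t : M ≃ₐ[F] M) ((s : M ≃ₐ[F] M) π / π) * ((t : M ≃ₐ[F] M) π / π) =
            (t : M ≃ₐ[F] M) ((s : M ≃ₐ[F] M) π) / π := by
          have : (t : M ≃ₐ[F] M) π ≠ 0 := (map_ne_zero _).2 hπ0
          rw [map_div₀]
          field_simp
        have h1 := (mem_inertiaGroup_valuationSubring_iff hinv).1 t.2 _ (hmem s)
        change w ((t : M ≃ₐ[F] M) ((s : M ≃ₐ[F] M) π) / π -
          ((t : M ≃ₐ[F] M) π / π) * ((s : M ≃ₐ[F] M) π / π)) < 1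
        rw [← hts, mul_comm ((t : M ≃ₐ[F] M) π / π), ← sub_mul, map_mul, map_div₀ w, hinv,
          div_self hwπ, mul_one]
        exact h1 }
  refine isCyclic_of_injective_ringHom f ?_
  rw [injective_iff_map_eq_one]
  intro t ht
  by_contra ht1
  obtain ⟨k, hk⟩ := (IsPGroup.iff_orderOf.1 hG) (t : M ≃ₐ[F] M)
  obtain ⟨m, rfl⟩ : ∃ m, k = m + 1 := by
    refine Nat.exists_eq_succ_of_ne_zero fun h => ht1 ?_
    rw [h, pow_zero, orderOf_eq_one_iff] at hk
    exact Subtype.ext hk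
  have hs : f (t ^ 2 ^ m) = 1 := by rw [map_pow, ht, one_pow]
  have hs1 : (t : M ≃ₐ[F] M) ^ 2 ^ m ≠ 1 := by
    intro h
    have := Nat.le_of_dvd (by positivity) (orderOf_dvd_of_pow_eq_one h)
    rw [hk, pow_succ] at this
    have : 0 < 2 ^ m := by positivity
    omega
  have hs2 : (t : M ≃ₐ[F] M) ^ 2 ^ m * (t : M ≃ₐ[F] M) ^ 2 ^ m = 1 := by
    rw [← pow_add, ← two_mul, ← pow_succ', ← hk, pow_orderOf_eq_one]
  refine not_div_sub_one_lt_of_sq_eq_one hinv h2 hπ0 hπ (t ^ 2 ^ m).2 hs2 hs1 ?_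
  rw [← map_one (IsLocalRing.residue O)] at hs
  exact (hres _ _).2 hs

/-- If `-1` is not a square in the residue field of the base, then a tame inertia element of
order four does not commute with the whole group. -/
theorem exists_mul_ne_mul_of_inertia [FiniteDimensional F M] [IsGalois F M]
    (hinv : ∀ (g : M ≃ₐ[F] M) x, w (g x) = w x) (hG : IsPGroup 2 (M ≃ₐ[F] M))
    (h2 : w 2 = 1) {π : M} (hπ0 : π ≠ 0) (hπ : ∀ x, x ≠ 0 → ∃ k : ℤ, w x = w π ^ k)
    (hsq : ¬ ∃ d : F, w (algebraMap F M d ^ 2 + 1) < 1) {t z : M ≃ₐ[F] M}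
    (ht : t ∈ inertiaGroup F w.valuationSubring) (htz : t * t = z) (hzz : z * z = 1)
    (hz : z ≠ 1) : ∃ g, g * t ≠ t * g := by
  by_contra! hcomm
  have hwπ : w π ≠ 0 := (Valuation.ne_zero_iff _).2 hπ0
  have hT := fun {t} => mem_inertiaGroup_valuationSubring_iff (w := w) hinv (t := t)
  have hzT : z ∈ inertiaGroup F w.valuationSubring := htz ▸ mul_mem ht ht
  have hw1 : ∀ s : M ≃ₐ[F] M, w (s π / π) = 1 := fun s => by rw [map_div₀, hinv, div_self hwπ]
  have hcoc : ∀ s ∈ inertiaGroup F w.valuationSubring,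
      w ((s * s) π / π - (s π / π) * (s π / π)) < 1 := by
    intro s hs
    have hne : s π ≠ 0 := (map_ne_zero s).2 hπ0
    have h1 : (s * s) π / π = s (s π / π) * (s π / π) := by
      rw [map_div₀, AlgEquiv.mul_apply]
      field_simp
    rw [h1, ← sub_mul, map_mul, hw1, mul_one]
    exact hT.1 hs _ (hw1 s).le
  set c := t π / π with hc
  set c' := z π / π with hc'
  -- Since z² = 1, the value c' of the tame character at z satisfies c'² ≡ 1; the factor c' - 1 is a
  -- unit, so c' ≡ -1. Consequently c² ≡ c' ≡ -1.
  have hc'1 : w (c' + 1) < 1 := by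
    have h1 := hcoc z hzT
    rw [hzz, AlgEquiv.one_apply, div_self hπ0, ← hc',
      show 1 - c' * c' = -((c' - 1) * (c' + 1)) by ring, Valuation.map_neg, map_mul] at h1
    have h3 := not_div_sub_one_lt_of_sq_eq_one hinv h2 hπ0 hπ hzT hzz hz
    have h4 : w (c' - 1) = 1 := by
      refine le_antisymm ((w.map_sub _ _).trans ?_) (not_lt.1 h3)
      rw [hw1, map_one, max_self]
    rwa [h4, one_mul] at h1
  have hcc : w (c ^ 2 + 1) < 1 := by
    have h1 := hcoc t ht
    rw [htz] at h1
    have h3 : c ^ 2 + 1 = (c' + 1) - (c' - c * c) := by ring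
    rw [h3]
    exact w.map_sub_lt hc'1 h1
  -- When g commutes with t, the quotient g(c)/c equals t(e)/e for the unit e = g(π)/π, and inertia
  -- makes this ≡ 1.
  have hfix : ∀ g : M ≃ₐ[F] M, w (g c - c) < 1 := by
    intro g
    have hne : g π ≠ 0 := (map_ne_zero g).2 hπ0
    have htne : t π ≠ 0 := (map_ne_zero t).2 hπ0
    have hwe : w (g π / π) = 1 := hw1 g
    have h1 := inertia_div_sub_one_lt hinv ht hwe
    have hgt : g (t π) = t (g π) := congrArg (fun f : M ≃ₐ[F] M => f π) (hcomm g)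
    have h3 : g c - c = c * (t (g π / π) / (g π / π) - 1) := by
      rw [hc, map_div₀, map_div₀, hgt]
      field_simp
    rw [h3, map_mul, hw1, one_mul]
    exact h1
  have hsum : w (algebraMap F M (Algebra.trace F M c) - (Nat.card (M ≃ₐ[F] M) : M) * c) < 1 := by
    rw [trace_eq_sum_automorphisms, Nat.card_eq_fintype_card]
    have : ∑ g : M ≃ₐ[F] M, g c - (Fintype.card (M ≃ₐ[F] M) : M) * c =
        ∑ g : M ≃ₐ[F] M, (g c - c) := by
      rw [Finset.sum_sub_distrib, Finset.sum_const, Finset.card_univ, nsmul_eq_mul]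
    rw [this]
    exact w.map_sum_lt one_ne_zero fun g _ => hfix g
  obtain ⟨n, hn⟩ := IsPGroup.iff_card.1 hG
  have hwn : w (Nat.card (M ≃ₐ[F] M) : M) = 1 := by
    rw [hn, Nat.cast_pow, map_pow, Nat.cast_ofNat, h2, one_pow]
  have hn0 : (Nat.card (M ≃ₐ[F] M) : M) ≠ 0 := fun h => by
    rw [h, map_zero] at hwn
    exact zero_ne_one hwn
  -- As all conjugates of c are ≡ c and |G| is a power of 2, hence a unit, the average Tr(c)/|G| is
  -- an element of F congruent to c. Its square is ≡ -1.
  refine hsq ⟨Algebra.trace F M c / (Nat.card (M ≃ₐ[F] M) : F), ?_⟩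
  rw [map_div₀, map_natCast]
  set T := algebraMap F M (Algebra.trace F M c)
  set N := (Nat.card (M ≃ₐ[F] M) : M)
  have hd : w (T / N - c) < 1 := by
    have : T / N - c = (T - N * c) / N := by field_simp
    rwa [this, map_div₀, hwn, div_one]
  have hdc : (T / N) ^ 2 + 1 = (T / N - c) * ((T / N - c) + (c + c)) + (c ^ 2 + 1) := by ring
  rw [hdc]
  refine w.map_add_lt ?_ hcc
  rw [map_mul]
  refine mul_lt_one_of_lt_of_le hd ?_
  refine w.map_add_le hd.le (w.map_add_le ?_ ?_) <;> exact (hw1 t).le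

/-- Such a d would reduce to a square root of -1 in a finite field of odd order q, which forces q ≡
1 mod 4. -/
theorem not_exists_sq_add_one_lt {Γ₁ : Type*} [LinearOrderedCommGroupWithZero Γ₁]
    (v : Valuation F Γ₁) [Finite (ValuationResidueField v)]
    (hchar : ringChar (ValuationResidueField v) ≠ 2)
    (hcard : ¬ Nat.card (ValuationResidueField v) ≡ 1 [MOD 4]) :
    ¬ ∃ d : F, v (d ^ 2 + 1) < 1 := by
  rintro ⟨d, hd⟩
  have hd1 : v d ≤ 1 := by
    by_contra! h
    have h1 : v (1 : F) < v (d ^ 2) := by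
      rw [map_one, map_pow]
      exact one_lt_pow₀ h two_ne_zero
    rw [Valuation.map_add_eq_of_lt_left v h1, map_pow] at hd
    exact absurd (one_lt_pow₀ h two_ne_zero) (not_lt.2 hd.le)
  let d' : v.valuationSubring := ⟨d, hd1⟩
  have hsq : IsLocalRing.residue _ d' ^ 2 + 1 = 0 := by
    rw [← map_pow, ← map_one (IsLocalRing.residue _), ← map_add, IsLocalRing.residue_eq_zero_iff,
      Valuation.mem_maximalIdeal_iff]
    exact hd
  have := Fintype.ofFinite (ValuationResidueField v)
  have h1 : IsSquare (-1 : ValuationResidueField v) :=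
    ⟨IsLocalRing.residue _ d', by rw [← sq]; exact (eq_neg_of_add_eq_zero_left hsq).symm⟩
  have h3 := FiniteField.isSquare_neg_one_iff.1 h1
  have h4 := FiniteField.odd_card_of_char_ne_two hchar
  rw [Nat.card_eq_fintype_card, Nat.ModEq] at hcard
  omega

theorem valuation_two_eq_one {Γ₁ : Type*} [LinearOrderedCommGroupWithZero Γ₁]
    (v : Valuation F Γ₁) (hchar : ringChar (ValuationResidueField v) ≠ 2) : v 2 = 1 := by
  have h2 : v 2 ≤ 1 := by
    rw [← one_add_one_eq_two]
    exact v.map_add_le v.map_one.le v.map_one.le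
  refine le_antisymm h2 (not_lt.1 fun h => hchar ?_)
  have h3 : (2 : ValuationResidueField v) = 0 := by
    rw [← map_ofNat (IsLocalRing.residue v.valuationSubring) 2, IsLocalRing.residue_eq_zero_iff,
      Valuation.mem_maximalIdeal_iff]
    exact h
  by_contra hne
  exact Ring.two_ne_zero hne h3

end TameInertia

/-! ### The inertia subgroup in Gal(M/F) attached to one valuation. -/

section NoGaloisExtension

/-- This turns the arithmetic hypotheses on one valuation into the group-theoretic data
`TameInertia`. The element σ generates the inertia group in Gal(K/F), so it determines the inertia
field E. -/
theorem exists_tameInertia {F K M Γ₀ V₁ : Type*} [Field F] [Field K] [Field M] [Algebra F K]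
    [Algebra F M] [Algebra K M] [IsScalarTower F K M] [FiniteDimensional F M] [IsGalois F M]
    [FiniteDimensional F K] [IsGalois F K] [LinearOrderedCommGroupWithZero Γ₀]
    [LinearOrderedCommGroupWithZero V₁]
    (hF : IsGlobalField F) (hG : IsPGroup 2 (M ≃ₐ[F] M)) (hK : Module.finrank F K = 4)
    (hV : ∀ σ : K ≃ₐ[F] K, σ * σ = 1) (v : Valuation F V₁)
    (hnd : ringChar (ValuationResidueField v) ≠ 2)
    (hres : ¬ Nat.card (ValuationResidueField v) ≡ 1 [MOD 4])
    (w : Valuation M Γ₀) (hvw : v.IsEquiv (w.comap (algebraMap F M)))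
    (hinv : ∀ (g : M ≃ₐ[F] M) x, w (g x) = w x) (E : IntermediateField F K)
    (hE : IsValuationInertiaField v E) (hquad : Module.finrank F E = 2) {z : M ≃ₐ[F] M}
    (hz : z ≠ 1) (hzz : z * z = 1) :
    ∃ σ T, TameInertia (AlgEquiv.restrictNormalHom K : (M ≃ₐ[F] M) →* (K ≃ₐ[F] K)) z σ T ∧
      ∀ x, x ∈ E ↔ σ x = x := by
  set π : (M ≃ₐ[F] M) →* (K ≃ₐ[F] K) := AlgEquiv.restrictNormalHom K with hπ
  have hπc : ∀ (g : M ≃ₐ[F] M) (x : K), algebraMap K M (π g x) = g (algebraMap K M x) :=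
    fun g x => AlgEquiv.restrictNormal_commutes g K x
  set wK := w.comap (algebraMap K M) with hwK
  have hinvK : ∀ (σ : K ≃ₐ[F] K) x, wK (σ x) = wK x := by
    intro σ x
    obtain ⟨g, rfl⟩ := AlgEquiv.restrictNormalHom_surjective (F := F) (K₁ := K) M σ
    rw [hwK, Valuation.comap_apply, Valuation.comap_apply, ← hinv g (algebraMap K M x)]
    exact congrArg w (hπc g x)
  have hvK : v.IsEquiv (wK.comap (algebraMap F K)) := by
    rw [hwK, ← Valuation.comap_comp, ← IsScalarTower.algebraMap_eq]
    exact hvw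
  obtain ⟨B, hB, rfl⟩ := hE
  -- The restriction of w to K is Galois-invariant, so its ring is the only one over v; the inertia
  -- field is therefore computed with w.
  have hBO : B = wK.valuationSubring := by
    refine ValuationSubring.eq_of_comap_eq (F := F) (fun σ x hx => ?_) ?_
    · rw [Valuation.mem_valuationSubring_iff] at hx ⊢
      rwa [hinvK]
    · rw [hB]
      ext x
      rw [Valuation.mem_valuationSubring_iff, ValuationSubring.mem_comap,
        Valuation.mem_valuationSubring_iff]
      exact hvK.le_one_iff_le_one
  subst hBO
  have hcardK : Nat.card (inertiaGroup F wK.valuationSubring) = 2 := by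
    have h1 := IntermediateField.finrank_fixedField_eq_card (inertiaGroup F wK.valuationSubring)
    have h2 := Module.finrank_mul_finrank F
      (IntermediateField.fixedField (inertiaGroup F wK.valuationSubring)) K
    rw [hquad, hK, h1] at h2
    omega
  obtain ⟨σ, hσ1, hσ⟩ : ∃ σ : K ≃ₐ[F] K, σ ≠ 1 ∧
      ∀ τ, τ ∈ inertiaGroup F wK.valuationSubring ↔ τ = 1 ∨ τ = σ := by
    obtain ⟨x, y, hxy, huniv⟩ := Nat.card_eq_two_iff.1 hcardK
    have hall : ∀ τ, τ ∈ inertiaGroup F wK.valuationSubring ↔ τ = x ∨ τ = y := by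
      intro τ
      constructor
      · intro h
        have : (⟨τ, h⟩ : inertiaGroup F wK.valuationSubring) ∈ ({x, y} : Set _) := by
          rw [huniv]; trivial
        rcases this with h | h
        · exact Or.inl (congrArg Subtype.val h)
        · exact Or.inr (congrArg Subtype.val h)
      · rintro (rfl | rfl)
        exacts [x.2, y.2]
    have hxy' : (x : K ≃ₐ[F] K) ≠ y := fun h => hxy (Subtype.ext h)
    rcases (hall 1).1 (one_mem _) with h | h
    · exact ⟨y, fun h' => hxy' (h.symm.trans h'.symm), fun τ => by rw [hall, ← h]⟩
    · exact ⟨x, fun h' => hxy' (h'.trans h), fun τ => by rw [hall, ← h, or_comm]⟩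
  -- A nontrivial inertia element moves some integral x, and σ x - x is a nonzero element of value
  -- less than 1. Thus the valuation is nontrivial on K, hence on M, and on F because K is integral
  -- over F.
  obtain ⟨y, hy0, hy1⟩ : ∃ y : K, y ≠ 0 ∧ wK y < 1 := by
    obtain ⟨x, hx⟩ : ∃ x, σ x ≠ x := by
      by_contra! h
      exact hσ1 (AlgEquiv.ext h)
    have hσT := (mem_inertiaGroup_valuationSubring_iff hinvK).1 ((hσ σ).2 (Or.inr rfl))
    rcases le_total (wK x) 1 with h | h
    · exact ⟨σ x - x, sub_ne_zero.2 hx, hσT x h⟩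
    · refine ⟨σ x⁻¹ - x⁻¹, sub_ne_zero.2 fun h' => hx ?_, hσT x⁻¹ ?_⟩
      · rw [map_inv₀] at h'
        exact inv_injective h'
      · rw [map_inv₀]
        exact inv_le_one_of_one_le₀ h
  have hyinv : ¬ wK y⁻¹ ≤ 1 := by
    rw [map_inv₀, not_le]
    exact (one_lt_inv₀ ((Valuation.pos_iff _).2 hy0)).2 hy1
  have hOF : v.valuationSubring ≠ ⊤ := by
    intro htop
    have hF1 : ∀ c : F, wK (algebraMap F K c) ≤ 1 := fun c => by
      have : c ∈ v.valuationSubring := by rw [htop]; trivial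
      exact hvK.le_one_iff_le_one.1 ((Valuation.mem_valuationSubring_iff _ _).1 this)
    let f : F →+* wK.valuationSubring := (algebraMap F K).codRestrict wK.valuationSubring.toSubring hF1
    have hint : IsIntegral wK.valuationSubring y⁻¹ :=
      (Algebra.IsIntegral.isIntegral (R := F) y⁻¹).map_of_comp_eq f (RingHom.id K) rfl
    obtain ⟨u, hu⟩ := (IsIntegrallyClosed.isIntegral_iff (R := wK.valuationSubring) (K := K)).1 hint
    exact hyinv (hu ▸ u.2)
  have hOM : w.valuationSubring ≠ ⊤ := by
    intro htop
    have : algebraMap K M y⁻¹ ∈ w.valuationSubring := by rw [htop]; trivial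
    exact hyinv ((Valuation.mem_valuationSubring_iff _ _).1 this)
  obtain ⟨hfinM, ϖ, hϖ0, -, hϖ⟩ := hF.isFiniteDiscrete w.valuationSubring hOM
  obtain ⟨hfinF, -⟩ := hF.isFiniteDiscrete v.valuationSubring hOF
  have hϖ' : ∀ x, x ≠ 0 → ∃ k : ℤ, w x = w ϖ ^ k := fun x hx => by
    obtain ⟨k, hk⟩ := hϖ x hx
    refine ⟨k, ?_⟩
    rw [← map_zpow₀] at hk ⊢
    exact w.isEquiv_valuation_valuationSubring.eq_iff.2 hk
  have hw2 : w 2 = 1 := by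
    have := hvw.eq_one_iff_eq_one.1 (valuation_two_eq_one v hnd)
    rwa [Valuation.comap_apply, map_ofNat] at this
  have hsq : ¬ ∃ d : F, w (algebraMap F M d ^ 2 + 1) < 1 := by
    rintro ⟨d, hd⟩
    refine not_exists_sq_add_one_lt v hnd hres ⟨d, hvw.lt_one_iff_lt_one.2 ?_⟩
    simpa using hd
  have hO : ∀ (g : M ≃ₐ[F] M), ∀ x ∈ w.valuationSubring, g x ∈ w.valuationSubring := by
    intro g x hx
    rw [Valuation.mem_valuationSubring_iff] at hx ⊢
    rwa [hinv]
  have hnormal := normal_inertiaGroup hO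
  have hcyc := isCyclic_quotient_inertiaGroup hO
  refine ⟨σ, inertiaGroup F w.valuationSubring, ⟨hnormal,
    isCyclic_inertiaGroup hinv hG hw2 hϖ0 hϖ', hcyc, fun t ht => ?_, ?_, fun t ht htz =>
      exists_mul_ne_mul_of_inertia hinv hG hw2 hϖ0 hϖ' hsq ht htz hzz hz⟩, fun x => ?_⟩
  · rw [← hσ, mem_inertiaGroup_valuationSubring_iff hinvK]
    intro x hx
    have := (mem_inertiaGroup_valuationSubring_iff hinv).1 ht (algebraMap K M x) hx
    rwa [← hπc, ← map_sub] at this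
  -- Otherwise the restriction map to V would factor through the cyclic quotient G/T, but V has
  -- order 4 and exponent 2.
  · by_contra! hall
    let f : (M ≃ₐ[F] M) ⧸ inertiaGroup F w.valuationSubring →* (K ≃ₐ[F] K) :=
      QuotientGroup.lift _ π hall
    have hf : Function.Surjective f := fun τ => by
      obtain ⟨g, hg⟩ := AlgEquiv.restrictNormalHom_surjective (F := F) (K₁ := K) M τ
      exact ⟨(g : (M ≃ₐ[F] M) ⧸ inertiaGroup F w.valuationSubring), hg⟩
    have := isCyclic_of_surjective f hf
    obtain ⟨g, hg⟩ := IsCyclic.exists_ofOrder_eq_natCard (α := K ≃ₐ[F] K)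
    rw [IsGalois.card_aut_eq_finrank, hK] at hg
    have h2 := orderOf_le_of_pow_eq_one (n := 2) (by norm_num) ((sq g).trans (hV g))
    omega
  · rw [IntermediateField.mem_fixedField_iff]
    constructor
    · intro h
      exact h σ ((hσ σ).2 (Or.inr rfl))
    · intro h τ hτ
      rcases (hσ τ).1 hτ with rfl | rfl
      exacts [rfl, h]

end NoGaloisExtension

/-! ### Galois theory of biquadratic extensions. -/

section Biquadratic

open Polynomial

theorem isGalois_of_adjoin_eq_top {F M : Type*} [Field F] [Field M] [Algebra F M] (S : Set M)
    (hS : IntermediateField.adjoin F S = ⊤)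
    (h : ∀ x ∈ S, IsSeparable F x ∧ ((minpoly F x).map (algebraMap F M)).Splits) :
    IsGalois F M := by
  have hsep : Algebra.IsSeparable F M := by
    rw [← separableClosure.eq_top_iff, eq_top_iff, ← hS, IntermediateField.adjoin_le_iff]
    exact fun x hx => mem_separableClosure_iff.2 (h x hx).1
  have hnorm : Normal F M := by
    refine normal_iff.2 fun x => ⟨(Algebra.IsSeparable.isSeparable F x).isIntegral, ?_⟩
    refine IntermediateField.splits_of_mem_adjoin F M (S := S)
      (fun y hy => ⟨(h y hy).1.isIntegral, (h y hy).2⟩) ?_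
    rw [hS]
    trivial
  exact { }

variable {F K : Type*} [Field F] [Field K] [Algebra F K]

theorem isSeparable_and_splits_of_sq (h2 : (2 : F) ≠ 0) {a : F} {α : K}
    (hα : α ^ 2 = algebraMap F K a) :
    IsSeparable F α ∧ ((minpoly F α).map (algebraMap F K)).Splits := by
  rcases eq_or_ne a 0 with rfl | ha
  · have hα0 : α = algebraMap F K 0 := by
      rw [map_zero] at hα ⊢
      exact pow_eq_zero_iff two_ne_zero |>.1 hα
    rw [hα0]
    refine ⟨isSeparable_algebraMap _, ?_⟩
    rw [minpoly.eq_X_sub_C, Polynomial.map_sub, map_X, map_C]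
    exact Splits.X_sub_C _
  · have hdvd : minpoly F α ∣ X ^ 2 - C a := minpoly.dvd F α (by simp [hα])
    refine ⟨(separable_X_pow_sub_C a (by exact_mod_cast h2) ha).of_dvd hdvd, ?_⟩
    have hprod : (X ^ 2 - C a : F[X]).map (algebraMap F K) = (X - C α) * (X + C α) := by
      rw [Polynomial.map_sub, Polynomial.map_pow, map_X, map_C, ← hα, C_pow]
      ring
    refine Splits.of_dvd ?_ ?_ (Polynomial.map_dvd (algebraMap F K) hdvd)
    · rw [hprod]
      exact (Splits.X_sub_C _).mul (Splits.X_add_C _)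
    · rw [hprod]
      exact mul_ne_zero (X_sub_C_ne_zero _) (X_add_C_ne_zero _)

theorem isGalois_of_biquadratic (h2 : (2 : F) ≠ 0) {a b : F} {α β : K}
    (hα : α ^ 2 = algebraMap F K a) (hβ : β ^ 2 = algebraMap F K b)
    (hgen : IntermediateField.adjoin F {α, β} = ⊤) : IsGalois F K := by
  refine isGalois_of_adjoin_eq_top {α, β} hgen ?_
  rintro x (rfl | rfl)
  exacts [isSeparable_and_splits_of_sq h2 hα, isSeparable_and_splits_of_sq h2 hβ]

theorem algEquiv_ext_of_adjoin {α β : K} (hgen : IntermediateField.adjoin F {α, β} = ⊤)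
    {σ τ : K ≃ₐ[F] K} (h1 : σ α = τ α) (h2 : σ β = τ β) : σ = τ := by
  refine AlgEquiv.ext fun x => ?_
  have hx : x ∈ IntermediateField.adjoin F {α, β} := by rw [hgen]; trivial
  induction hx using IntermediateField.adjoin_induction with
  | mem x hx =>
    rcases hx with rfl | rfl
    exacts [h1, h2]
  | algebraMap x => rw [AlgEquiv.commutes, AlgEquiv.commutes]
  | add x y _ _ hx hy => rw [map_add, map_add, hx, hy]
  | inv x _ hx => rw [map_inv₀, map_inv₀, hx]
  | mul x y _ _ hx hy => rw [map_mul, map_mul, hx, hy]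

theorem algEquiv_apply_sqrt {a : F} {α : K} (hα : α ^ 2 = algebraMap F K a) (σ : K ≃ₐ[F] K) :
    σ α = α ∨ σ α = -α := by
  rw [← sq_eq_sq_iff_eq_or_eq_neg, ← map_pow, hα, AlgEquiv.commutes]

/-- The automorphisms of a biquadratic extension realize all signs. -/
theorem exists_algEquiv_of_signs [IsGalois F K] [FiniteDimensional F K]
    (hK : Module.finrank F K = 4) {a b : F} {α β : K} (hα : α ^ 2 = algebraMap F K a)
    (hβ : β ^ 2 = algebraMap F K b) (hgen : IntermediateField.adjoin F {α, β} = ⊤) :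
    α ≠ 0 ∧ β ≠ 0 ∧ (∃ σ : K ≃ₐ[F] K, σ α = -α ∧ σ β = β) ∧
      (∃ τ : K ≃ₐ[F] K, τ α = α ∧ τ β = -β) := by
  classical
  have hcard : Fintype.card (K ≃ₐ[F] K) = 4 := by
    rw [← Nat.card_eq_fintype_card, IsGalois.card_aut_eq_finrank, hK]
  -- An automorphism is determined by its two signs. Both sides have four elements, so all sign
  -- patterns occur; this also forces α, β ≠ 0.
  let f : (K ≃ₐ[F] K) → Bool × Bool := fun σ => (decide (σ α = α), decide (σ β = β))
  have hinj : Function.Injective f := by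
    have key : ∀ {c : F} {γ : K}, γ ^ 2 = algebraMap F K c → ∀ σ τ : K ≃ₐ[F] K,
        decide (σ γ = γ) = decide (τ γ = γ) → σ γ = τ γ := by
      intro c γ hγ σ τ h
      rw [decide_eq_decide] at h
      rcases algEquiv_apply_sqrt hγ σ with h1 | h1
      · rw [h1, h.1 h1]
      · rcases algEquiv_apply_sqrt hγ τ with h2 | h2
        · rw [h2, h.2 h2]
        · rw [h1, h2]
    intro σ τ h
    exact algEquiv_ext_of_adjoin hgen (key hα σ τ (congrArg Prod.fst h))
      (key hβ σ τ (congrArg Prod.snd h))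
  have hbij : Function.Bijective f :=
    (Fintype.bijective_iff_injective_and_card f).2 ⟨hinj, by rw [hcard]; rfl⟩
  have hα0 : α ≠ 0 := by
    rintro rfl
    obtain ⟨σ, hσ⟩ := hbij.2 (false, false)
    have := congrArg Prod.fst hσ
    simp [f] at this
  have hβ0 : β ≠ 0 := by
    rintro rfl
    obtain ⟨σ, hσ⟩ := hbij.2 (false, false)
    have := congrArg Prod.snd hσ
    simp [f] at this
  obtain ⟨σ, hσ⟩ := hbij.2 (false, true)
  obtain ⟨τ, hτ⟩ := hbij.2 (true, false)
  simp only [f, Prod.mk.injEq, decide_eq_false_iff_not, decide_eq_true_eq] at hσ hτ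
  exact ⟨hα0, hβ0, ⟨σ, (algEquiv_apply_sqrt hα σ).resolve_left hσ.1, hσ.2⟩,
    ⟨τ, hτ.1, (algEquiv_apply_sqrt hβ τ).resolve_left hτ.2⟩⟩

theorem algEquiv_mul_self_of_biquadratic {a b : F} {α β : K} (hα : α ^ 2 = algebraMap F K a)
    (hβ : β ^ 2 = algebraMap F K b) (hgen : IntermediateField.adjoin F {α, β} = ⊤)
    (σ : K ≃ₐ[F] K) : σ * σ = 1 := by
  refine algEquiv_ext_of_adjoin hgen ?_ ?_
  · rcases algEquiv_apply_sqrt hα σ with h | h <;> simp [h]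
  · rcases algEquiv_apply_sqrt hβ σ with h | h <;> simp [h]

end Biquadratic

/-! ### Nonexistence of a Galois extension of degree 8 between K and A. -/

section NoGaloisExtension

/-- Automorphisms of M are conjugations in A, and a valuation with commutative value group does not
see conjugation. -/
theorem Valuation.ExtendsTo.exists_invariant {F : Type uF} {Γ₀ : Type uΓ} [Field F]
    [LinearOrderedCommGroupWithZero Γ₀] {v : Valuation F Γ₀} {A : Type uA} [DivisionRing A]
    [Algebra F A] [Algebra.IsCentral F A] (hv : v.ExtendsTo A) {M : Type*} [Field M] [Algebra F M]
    [FiniteDimensional F M] [IsGalois F M] (j : M →ₐ[F] A) :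
    ∃ (Γ₁ : Type uA) (_ : LinearOrderedCommGroupWithZero Γ₁) (w : Valuation M Γ₁),
      v.IsEquiv (w.comap (algebraMap F M)) ∧ ∀ (g : M ≃ₐ[F] M) x, w (g x) = w x := by
  obtain ⟨Γ₁, _, w, hw⟩ := hv
  refine ⟨Γ₁, inferInstance, w.comap j.toRingHom, ?_, fun g x => ?_⟩
  · have := hw.val_isEquiv_comap
    rwa [← AlgHom.comp_algebraMap j] at this
  · obtain ⟨u, hu0, hu⟩ := exists_conj_eq j g
    change w (j (g x)) = w (j x)
    rw [hu, map_mul, map_mul, mul_comm, ← mul_assoc, ← map_mul, mul_inv_cancel₀ hu0, map_one,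
      one_mul]

theorem not_exists_isGalois_of_degree_eight
    {F : Type uF} [Field F] (hF : IsGlobalField F) (hchar : ringChar F ≠ 2)
    {A : Type uA} [DivisionRing A] [Algebra F A] [Algebra.IsCentral F A]
    {K : Type uK} [Field K] [Algebra F K] (hK : Module.finrank F K = 4)
    (a b : F) (α β : K) (hα : α ^ 2 = algebraMap F K a) (hβ : β ^ 2 = algebraMap F K b)
    (hgen : IntermediateField.adjoin F {α, β} = ⊤)
    (ι : K →ₐ[F] A)
    (hab : ¬ (QuadraticMap.weightedSumSquares F ![a, b, a * b]).Equivalent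
      (QuadraticMap.weightedSumSquares F ![(1 : F), 1, 1]))
    {V₁ : Type uV₁} [LinearOrderedCommGroupWithZero V₁] (v₁ : Valuation F V₁)
    {V₂ : Type uV₂} [LinearOrderedCommGroupWithZero V₂] (v₂ : Valuation F V₂)
    (hnd₁ : ringChar (ValuationResidueField v₁) ≠ 2)
    (hnd₂ : ringChar (ValuationResidueField v₂) ≠ 2)
    (hext₁ : v₁.ExtendsTo A) (hext₂ : v₂.ExtendsTo A)
    (E₁ E₂ : IntermediateField F K)
    (hE₁ : IsValuationInertiaField v₁ E₁) (hE₂ : IsValuationInertiaField v₂ E₂)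
    (hquad₁ : Module.finrank F E₁ = 2) (hquad₂ : Module.finrank F E₂ = 2) (hne : E₁ ≠ E₂)
    (hres₁ : ¬ Nat.card (ValuationResidueField v₁) ≡ 1 [MOD 4])
    (hres₂ : ¬ Nat.card (ValuationResidueField v₂) ≡ 1 [MOD 4])
    {M : Type*} [Field M] [Algebra F M] (j : M →ₐ[F] A) [IsGalois F M]
    (hM : Module.finrank F M = 8) (hKM : ι.range ≤ j.range) : False := by
  have h2 : (2 : F) ≠ 0 := Ring.two_ne_zero hchar
  have : FiniteDimensional F M := Module.finite_of_finrank_pos (by omega)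
  have : FiniteDimensional F K := Module.finite_of_finrank_pos (by omega)
  have : IsGalois F K := isGalois_of_biquadratic h2 hα hβ hgen
  let k : K →ₐ[F] M := (AlgEquiv.ofInjective j j.injective).symm.toAlgHom.comp
    (ι.codRestrict j.range fun x => hKM ⟨x, rfl⟩)
  let _ : Algebra K M := k.toRingHom.toAlgebra
  have : IsScalarTower F K M := IsScalarTower.of_algebraMap_eq fun x => (k.commutes x).symm
  set π : (M ≃ₐ[F] M) →* (K ≃ₐ[F] K) := AlgEquiv.restrictNormalHom K with hπ
  have hπs : Function.Surjective π := AlgEquiv.restrictNormalHom_surjective M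
  have hπc : ∀ (g : M ≃ₐ[F] M) (x : K), algebraMap K M (π g x) = g (algebraMap K M x) :=
    fun g x => AlgEquiv.restrictNormal_commutes g K x
  have hcardG : Nat.card (M ≃ₐ[F] M) = 8 := by rw [IsGalois.card_aut_eq_finrank, hM]
  have hcardV : Nat.card (K ≃ₐ[F] K) = 4 := by rw [IsGalois.card_aut_eq_finrank, hK]
  have hker2 : Nat.card π.ker = 2 := by
    have h1 := π.ker.card_mul_index
    rw [Subgroup.index_ker, MonoidHom.range_eq_top.2 hπs, Subgroup.card_top, hcardG, hcardV] at h1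
    omega
  obtain ⟨z, hz, hker⟩ : ∃ z, z ≠ 1 ∧ ∀ g, π g = 1 ↔ g = 1 ∨ g = z := by
    obtain ⟨x, y, hxy, huniv⟩ := Nat.card_eq_two_iff.1 hker2
    have hall : ∀ g, g ∈ π.ker ↔ g = x ∨ g = y := by
      intro g
      constructor
      · intro h
        have : (⟨g, h⟩ : π.ker) ∈ ({x, y} : Set _) := by rw [huniv]; trivial
        rcases this with h | h
        · exact Or.inl (congrArg Subtype.val h)
        · exact Or.inr (congrArg Subtype.val h)
      · rintro (rfl | rfl)
        exacts [x.2, y.2]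
    have hxy' : (x : M ≃ₐ[F] M) ≠ y := fun h => hxy (Subtype.ext h)
    rcases (hall 1).1 (one_mem _) with h | h
    · exact ⟨y, fun h' => hxy' (h.symm.trans h'.symm), fun g => by
        rw [← MonoidHom.mem_ker, hall, ← h]⟩
    · exact ⟨x, fun h' => hxy' (h'.trans h), fun g => by
        rw [← MonoidHom.mem_ker, hall, ← h, or_comm]⟩
  have hV := algEquiv_mul_self_of_biquadratic hα hβ hgen
  have hzz : z * z = 1 := by
    have h1 : π z = 1 := (hker z).2 (Or.inr rfl)
    rcases (hker (z * z)).1 (by rw [map_mul, h1, one_mul]) with h | h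
    · exact h
    · exact absurd (mul_eq_left.1 h) hz
  have hG : IsPGroup 2 (M ≃ₐ[F] M) := IsPGroup.of_card (n := 3) hcardG
  obtain ⟨Γ₁, _, w₁, hvw₁, hinv₁⟩ := hext₁.exists_invariant j
  obtain ⟨Γ₂, _, w₂, hvw₂, hinv₂⟩ := hext₂.exists_invariant j
  obtain ⟨σ₁, T₁, hT₁, hfix₁⟩ := exists_tameInertia hF hG hK hV v₁ hnd₁ hres₁ w₁ hvw₁ hinv₁ E₁ hE₁
    hquad₁ hz hzz
  obtain ⟨σ₂, T₂, hT₂, hfix₂⟩ := exists_tameInertia hF hG hK hV v₂ hnd₂ hres₂ w₂ hvw₂ hinv₂ E₂ hE₂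
    hquad₂ hz hzz
  have hσ : σ₁ ≠ σ₂ := by
    rintro rfl
    exact hne (SetLike.ext fun x => by rw [hfix₁, hfix₂])
  have hquat := mul_self_eq_of_tameInertia hker hz hV hcardV hσ hT₁ hT₂
  obtain ⟨hα0, hβ0, ⟨σ, hσα, hσβ⟩, τ, hτα, hτβ⟩ := exists_algEquiv_of_signs hK hα hβ hgen
  have hneg : ∀ {x : K}, x ≠ 0 → -x ≠ x := fun {x} hx h => by
    have h3 : (2 : K) * x = 0 := by linear_combination -h
    rcases mul_eq_zero.1 h3 with h4 | h4
    · exact h2 ((algebraMap F K).injective (by rw [map_ofNat, map_zero, h4]))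
    · exact hx h4
  obtain ⟨s, rfl⟩ := hπs σ
  obtain ⟨t, rfl⟩ := hπs τ
  have hs1 : π s ≠ 1 := fun h => hneg hα0 (by rw [← hσα, h, AlgEquiv.one_apply])
  have ht1 : π t ≠ 1 := fun h => hneg hβ0 (by rw [← hτβ, h, AlgEquiv.one_apply])
  have hst1 : π (s * t) ≠ 1 := fun h => hneg hα0 (by
    have := congrArg (fun f : K ≃ₐ[F] K => f α) h
    simp only [map_mul, AlgEquiv.mul_apply, hτα, hσα, AlgEquiv.one_apply] at this
    exact this)
  refine hab (weightedSumSquares_equivalent_of_quaternion (M := M) h2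
    (α := algebraMap K M α) (β := algebraMap K M β) (s := s) (t := t) (z := z) ?_ ?_ ?_ ?_ ?_ ?_ ?_ ?_
    hz (hquat s hs1) (hquat t ht1) (hquat _ hst1) hzz fun x hsx htx => ?_)
  · rw [← map_pow, hα, ← IsScalarTower.algebraMap_apply]
  · rw [← map_pow, hβ, ← IsScalarTower.algebraMap_apply]
  · exact (map_ne_zero _).2 hα0
  · exact (map_ne_zero _).2 hβ0
  · rw [← hπc, hσα, map_neg]
  · rw [← hπc, hσβ]
  · rw [← hπc, hτα]
  · rw [← hπc, hτβ, map_neg]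
  · have hzx : z x = x := by
      rw [← hquat s hs1, AlgEquiv.mul_apply, hsx, hsx]
    refine (IsGalois.mem_range_algebraMap_iff_fixed x).2 fun g => ?_
    -- The elements 1, s, t, st represent the cosets of {1, z}, and z = s². So an element fixed by s
    -- and t is fixed by the whole group and lies in F.
    have hlift : ∀ h : M ≃ₐ[F] M, h x = x → π g = π h → g x = x := by
      intro h hx hgh
      have h1 : π (g * h⁻¹) = 1 := by rw [map_mul, map_inv, hgh, mul_inv_cancel]
      have h3 : g = g * h⁻¹ * h := by group
      rw [h3, AlgEquiv.mul_apply, hx]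
      rcases (hker _).1 h1 with h | h <;> rw [h]
      · rfl
      · exact hzx
    rcases algEquiv_apply_sqrt hα (π g) with h1 | h1 <;>
      rcases algEquiv_apply_sqrt hβ (π g) with h3 | h3
    · exact hlift 1 rfl (algEquiv_ext_of_adjoin hgen (by simp [h1]) (by simp [h3]))
    · exact hlift t htx (algEquiv_ext_of_adjoin hgen (by rw [h1, hτα]) (by rw [h3, hτβ]))
    · exact hlift s hsx (algEquiv_ext_of_adjoin hgen (by rw [h1, hσα]) (by rw [h3, hσβ]))
    · refine hlift (s * t) (by rw [AlgEquiv.mul_apply, htx, hsx]) (algEquiv_ext_of_adjoin hgen ?_ ?_)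
      · rw [h1, map_mul, AlgEquiv.mul_apply, hτα, hσα]
      · rw [h3, map_mul, AlgEquiv.mul_apply, hτβ, map_neg, hσβ]

end NoGaloisExtension

/-! ### Lowest-degree terms of products of Hahn series. -/

section HahnSeriesProducts

variable {Γ R : Type*} [AddCommGroup Γ] [LinearOrder Γ] [IsOrderedAddMonoid Γ] [Ring R]

theorem HahnSeries.coeff_mul_eq_zero_of_lt_add {f g : HahnSeries Γ R} {α β γ : Γ}
    (hf : ∀ δ < α, f.coeff δ = 0) (hg : ∀ δ < β, g.coeff δ = 0) (hγ : γ < α + β) :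
    (f * g).coeff γ = 0 := by
  rw [coeff_mul]
  refine Finset.sum_eq_zero fun ij hij => ?_
  obtain ⟨h1, h2, h3⟩ := Finset.mem_antidiagonal.1 hij
  refine absurd hγ (not_lt.2 ?_)
  rw [← h3]
  exact add_le_add (not_lt.1 fun h => h1 (hf _ h)) (not_lt.1 fun h => h2 (hg _ h))

theorem HahnSeries.coeff_mul_add {f g : HahnSeries Γ R} {α β : Γ}
    (hf : ∀ δ < α, f.coeff δ = 0) (hg : ∀ δ < β, g.coeff δ = 0) :
    (f * g).coeff (α + β) = f.coeff α * g.coeff β := by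
  classical
  rw [coeff_mul]
  refine Finset.sum_eq_single (α, β) ?_ ?_
  · intro ij hij hne
    obtain ⟨h1, h2, h3⟩ := Finset.mem_antidiagonal.1 hij
    have h4 : α ≤ ij.1 := not_lt.1 fun h => h1 (hf _ h)
    have h5 : β ≤ ij.2 := not_lt.1 fun h => h2 (hg _ h)
    refine absurd (Prod.ext ?_ ?_) hne
    · refine le_antisymm (le_of_not_gt fun h => ?_) h4
      exact absurd h3 (ne_of_gt (add_lt_add_of_lt_of_le h h5))
    · refine le_antisymm (le_of_not_gt fun h => ?_) h5
      exact absurd h3 (ne_of_gt (add_lt_add_of_le_of_lt h4 h))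
  · intro h
    by_contra h0
    refine h (Finset.mem_antidiagonal.2 ⟨fun h' => h0 ?_, fun h' => h0 ?_, rfl⟩)
    · simp only [h', zero_mul]
    · simp only [h', mul_zero]

theorem HahnSeries.mul_comm_of_coeff_comm {f : HahnSeries Γ R}
    (hf : ∀ γ r, f.coeff γ * r = r * f.coeff γ) (g : HahnSeries Γ R) : f * g = g * f := by
  ext γ
  rw [coeff_mul, coeff_mul]
  refine Finset.sum_nbij' Prod.swap Prod.swap ?_ ?_ (fun _ _ => rfl) (fun _ _ => rfl)
    fun _ _ => hf _ _
  all_goals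
    intro ij hij
    obtain ⟨h1, h2, h3⟩ := Finset.mem_antidiagonal.1 hij
    exact Finset.mem_antidiagonal.2 ⟨h2, h1, (add_comm _ _).trans h3⟩

/-- A function whose support is carried by a translation into that of a Hahn series is a Hahn
series. -/
theorem HahnSeries.isPWO_support_of_translate {k : Type*} [Zero k] {G : AddSubgroup Γ}
    (f : HahnSeries Γ R) (γ : Γ) (c : G → k) (hc : ∀ δ, c δ ≠ 0 → f.coeff (δ + γ) ≠ 0) :
    (Function.support c).IsPWO := by
  intro s
  obtain ⟨m, n, hmn, hle⟩ := f.isPWO_support fun n => ⟨((s n : G) + γ : Γ), hc _ (s n).2⟩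
  have hle' : ((s m : G) : Γ) + γ ≤ (s n : G) + γ := hle
  exact ⟨m, n, hmn, (add_le_add_iff_right γ).1 hle'⟩

end HahnSeriesProducts

/-! ### Series over F supported in the kernel of ε. -/

section CentralSeries

variable {F K A Γ : Type*} [Field F] [Field K] [Algebra F K] [Ring A] [Algebra F A]
  [AddCommGroup Γ]

open MalcevNeumann

/-- The degrees that act trivially on `K`. -/
def trivialDegrees (ε : Multiplicative Γ →* (K ≃ₐ[F] K)) : AddSubgroup Γ where
  carrier := {γ | gal ε γ = 1}
  zero_mem' := by simp [gal]
  add_mem' {γ δ} hγ hδ := by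
    change gal ε (γ + δ) = 1
    rw [gal_add, hγ, hδ, mul_one]
  neg_mem' {γ} hγ := by
    change gal ε (-γ) = 1
    change gal ε γ = 1 at hγ
    rw [gal, ofAdd_neg, map_inv]
    exact inv_eq_one.2 hγ

theorem mem_trivialDegrees {ε : Multiplicative Γ →* (K ≃ₐ[F] K)} {γ : Γ} :
    γ ∈ trivialDegrees ε ↔ gal ε γ = 1 := Iff.rfl

theorem gal_sub (ε : Multiplicative Γ →* (K ≃ₐ[F] K)) (γ δ : Γ) :
    gal ε (γ - δ) = gal ε γ * (gal ε δ)⁻¹ := by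
  simp [gal, ofAdd_sub, div_eq_mul_inv]

theorem sub_mem_trivialDegrees {ε : Multiplicative Γ →* (K ≃ₐ[F] K)} {γ δ : Γ} :
    γ - δ ∈ trivialDegrees ε ↔ gal ε γ = gal ε δ := by
  rw [mem_trivialDegrees, gal_sub, mul_inv_eq_one]

variable [LinearOrder Γ] [IsOrderedAddMonoid Γ]

variable (A) in
/-- The embedding of the series over `F` with trivial degrees in the series over `A`. -/
noncomputable def centralSeries (ε : Multiplicative Γ →* (K ≃ₐ[F] K)) :
    HahnSeries (trivialDegrees ε) F →+* HahnSeries Γ A :=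
  (HahnSeries.embDomainRingHom (trivialDegrees ε).subtype Subtype.val_injective
    fun _ _ => Iff.rfl).comp
  { toFun c := c.map (algebraMap F A)
    map_one' := HahnSeries.map_one (algebraMap F A).toMonoidWithZeroHom
    map_mul' _ _ := HahnSeries.map_mul (algebraMap F A : F →ₙ+* A)
    map_zero' := HahnSeries.map_zero (algebraMap F A : ZeroHom F A)
    map_add' _ _ := HahnSeries.map_add (algebraMap F A : F →+ A) }

variable {ε : Multiplicative Γ →* (K ≃ₐ[F] K)}

theorem coeff_centralSeries (c : HahnSeries (trivialDegrees ε) F) (δ : trivialDegrees ε) :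
    (centralSeries A ε c).coeff δ = algebraMap F A (c.coeff δ) := by
  have := HahnSeries.embDomain_coeff
    (f := ⟨⟨(trivialDegrees ε).subtype, Subtype.val_injective⟩, Iff.rfl⟩)
    (x := c.map (algebraMap F A)) (a := δ)
  exact this

theorem coeff_centralSeries_of_ne (c : HahnSeries (trivialDegrees ε) F) {γ : Γ}
    (hγ : gal ε γ ≠ 1) : (centralSeries A ε c).coeff γ = 0 := by
  refine HahnSeries.embDomain_of_notMem_range
    (f := ⟨⟨(trivialDegrees ε).subtype, Subtype.val_injective⟩, Iff.rfl⟩)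
    (x := c.map (algebraMap F A)) ?_
  rintro ⟨δ, rfl⟩
  exact hγ δ.2

theorem exists_coeff_centralSeries_eq (c : HahnSeries (trivialDegrees ε) F) (γ : Γ) :
    ∃ x : F, (centralSeries A ε c).coeff γ = algebraMap F A x := by
  by_cases h : gal ε γ = 1
  · exact ⟨_, coeff_centralSeries c ⟨γ, h⟩⟩
  · exact ⟨0, by rw [coeff_centralSeries_of_ne c h, map_zero]⟩

theorem centralSeries_mul_comm (c : HahnSeries (trivialDegrees ε) F) (f : HahnSeries Γ A) :
    centralSeries A ε c * f = f * centralSeries A ε c := by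
  refine HahnSeries.mul_comm_of_coeff_comm (fun γ r => ?_) f
  obtain ⟨x, hx⟩ := exists_coeff_centralSeries_eq (A := A) c γ
  rw [hx, Algebra.commutes]

theorem centralSeries_C (x : F) :
    centralSeries A ε (HahnSeries.C x) = HahnSeries.single 0 (algebraMap F A x) := by
  ext γ
  by_cases h : gal ε γ = 1
  · rw [coeff_centralSeries (A := A) _ ⟨γ, h⟩]
    by_cases h0 : γ = 0
    · subst h0
      have : (⟨0, h⟩ : trivialDegrees ε) = 0 := rfl
      simp [this]
    · have : (⟨γ, h⟩ : trivialDegrees ε) ≠ 0 := fun h' => h0 (congrArg Subtype.val h')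
      simp [h0, this]
  · rw [coeff_centralSeries_of_ne _ h, HahnSeries.coeff_single_of_ne]
    rintro rfl
    exact h (by simp [gal])

theorem exists_centralSeries_eq {f : HahnSeries Γ A}
    (hf : ∀ γ, ∃ x : F, f.coeff γ = algebraMap F A x)
    (hne : ∀ γ, f.coeff γ ≠ 0 → gal ε γ = 1) : ∃ c, centralSeries A ε c = f := by
  classical
  by_cases hA : Nontrivial A
  swap
  · rw [not_nontrivial_iff_subsingleton] at hA
    exact ⟨0, HahnSeries.ext (funext fun _ => Subsingleton.elim _ _)⟩
  choose x hx using hf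
  refine ⟨⟨fun δ => x δ, f.isPWO_support_of_translate 0 _ fun δ hδ => ?_⟩, ?_⟩
  · rw [add_zero, hx]
    exact fun h => hδ ((map_eq_zero_iff _ (algebraMap F A).injective).1 h)
  · ext γ
    by_cases h : gal ε γ = 1
    · rw [coeff_centralSeries (A := A) _ ⟨γ, h⟩, hx]
    · rw [coeff_centralSeries_of_ne _ h]
      by_contra h'
      exact h (hne γ (Ne.symm h'))

end CentralSeries

/-! ### The twisted series ring: its center, its dimension and invertibility. -/

section TwistedSeries

open MalcevNeumann Module

variable {F K A Γ D : Type*} [Field F] [Field K] [Algebra F K] [DivisionRing A] [Algebra F A]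
  [AddCommGroup Γ] [LinearOrder Γ] [IsOrderedAddMonoid Γ]

/-- The ring embedding `Φ` identifies `D` with the series whose coefficient at `γ` induces by
conjugation the automorphism `ε(γ)` of `K`. -/
structure IsTwistedSeriesRing [Ring D] (ι : K →ₐ[F] A) (ε : Multiplicative Γ →* (K ≃ₐ[F] K))
    (Φ : D →+* HahnSeries Γ A) : Prop where
  injective : Function.Injective Φ
  mem_range_iff : ∀ f, f ∈ Φ.range ↔ ∀ γ, f.coeff γ ∈ twistedCentralizer ι (gal ε γ)

namespace IsTwistedSeriesRing

section Ring

variable [Ring D] {ι : K →ₐ[F] A} {ε : Multiplicative Γ →* (K ≃ₐ[F] K)}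
  {Φ : D →+* HahnSeries Γ A}

theorem coeff_mem (h : IsTwistedSeriesRing ι ε Φ) (x : D) (γ : Γ) :
    (Φ x).coeff γ ∈ twistedCentralizer ι (gal ε γ) :=
  (h.mem_range_iff _).1 ⟨x, rfl⟩ γ

theorem exists_eq (h : IsTwistedSeriesRing ι ε Φ) {f : HahnSeries Γ A}
    (hf : ∀ γ, f.coeff γ ∈ twistedCentralizer ι (gal ε γ)) : ∃ x, Φ x = f :=
  (h.mem_range_iff _).2 hf

theorem exists_eq_single (h : IsTwistedSeriesRing ι ε Φ) {γ : Γ} {d : A}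
    (hd : d ∈ twistedCentralizer ι (gal ε γ)) : ∃ x, Φ x = HahnSeries.single γ d := by
  refine h.exists_eq fun δ => ?_
  by_cases hδ : δ = γ
  · subst hδ
    rwa [HahnSeries.coeff_single_same]
  · rw [HahnSeries.coeff_single_of_ne hδ]
    exact zero_mem _

theorem isDomain (h : IsTwistedSeriesRing ι ε Φ) [Nontrivial D] : IsDomain D :=
  have : NoZeroDivisors D := ⟨fun {x y} hxy => by
    have := congrArg Φ hxy
    rw [map_mul, map_zero, mul_eq_zero] at this
    exact this.imp (fun hx => h.injective (hx.trans (map_zero Φ).symm))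
      (fun hy => h.injective (hy.trans (map_zero Φ).symm))⟩
  NoZeroDivisors.to_isDomain D

theorem centralSeries_mem_range (h : IsTwistedSeriesRing ι ε Φ)
    (c : HahnSeries (trivialDegrees ε) F) : centralSeries A ε c ∈ Φ.range := by
  refine (h.mem_range_iff _).2 fun γ x => ?_
  by_cases hγ : gal ε γ = 1
  · obtain ⟨y, hy⟩ := exists_coeff_centralSeries_eq (A := A) c γ
    rw [hy, hγ, Algebra.commutes]
    rfl
  · rw [coeff_centralSeries_of_ne _ hγ, mul_zero, zero_mul]

/-- The series over `F` with trivial degrees, as elements of the twisted series ring. -/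
noncomputable def scalar (h : IsTwistedSeriesRing ι ε Φ) :
    HahnSeries (trivialDegrees ε) F →+* D :=
  (RingEquiv.ofBijective Φ.rangeRestrict
    ⟨fun _ _ hxy => h.injective (congrArg Subtype.val hxy), Φ.rangeRestrict_surjective⟩).symm.toRingHom.comp
    ((centralSeries A ε).codRestrict Φ.range h.centralSeries_mem_range)

theorem apply_scalar (h : IsTwistedSeriesRing ι ε Φ) (c : HahnSeries (trivialDegrees ε) F) :
    Φ (h.scalar c) = centralSeries A ε c :=
  congrArg Subtype.val (RingEquiv.apply_symm_apply (RingEquiv.ofBijective Φ.rangeRestrict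
    ⟨fun _ _ hxy => h.injective (congrArg Subtype.val hxy), Φ.rangeRestrict_surjective⟩)
    ((centralSeries A ε).codRestrict Φ.range h.centralSeries_mem_range c))

theorem scalar_mul_comm (h : IsTwistedSeriesRing ι ε Φ) (c : HahnSeries (trivialDegrees ε) F)
    (x : D) : h.scalar c * x = x * h.scalar c := by
  apply h.injective
  rw [map_mul, map_mul, apply_scalar, centralSeries_mul_comm]

/-- A central x commutes with every monomial. As ε is surjective and A is the sum of its twisted
components, every coefficient of x commutes with all of A and lies in F. A nonzero coefficient at γ
that both commutes with K and twists it by ε(γ) forces ε(γ) = 1. -/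
theorem exists_scalar_eq (h : IsTwistedSeriesRing ι ε Φ) [Algebra.IsCentral F A]
    [FiniteDimensional F K] [IsGalois F K]
    (hε : ∀ σ, ∃ γ, gal ε γ = σ) {x : D} (hx : ∀ y, x * y = y * x) : ∃ c, h.scalar c = x := by
  have hcomm : ∀ γ r, (Φ x).coeff γ * r = r * (Φ x).coeff γ := by
    intro γ r
    obtain ⟨f, hf, rfl⟩ := exists_sum_twistedCentralizer ι r
    rw [Finset.mul_sum, Finset.sum_mul]
    refine Finset.sum_congr rfl fun σ _ => ?_
    obtain ⟨δ, rfl⟩ := hε σ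
    obtain ⟨y, hy⟩ := h.exists_eq_single (hf (gal ε δ))
    have := congrArg (fun z => (Φ z).coeff (γ + δ)) (hx y)
    simpa only [map_mul, hy, HahnSeries.coeff_mul_single, HahnSeries.coeff_single_mul,
      add_sub_cancel_right] using this
  have h1 : ∀ γ, ∃ y : F, (Φ x).coeff γ = algebraMap F A y := fun γ => by
    obtain ⟨y, hy⟩ := (Algebra.IsCentral.mem_center_iff F (D := A)).1
      (Subalgebra.mem_center_iff.2 fun r => (hcomm γ r).symm)
    exact ⟨y, hy⟩
  have h2 : ∀ γ, (Φ x).coeff γ ≠ 0 → gal ε γ = 1 := fun γ hγ => by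
    refine AlgEquiv.ext fun z => ι.injective ?_
    exact mul_left_cancel₀ hγ ((h.coeff_mem x γ z).symm.trans (hcomm γ _).symm)
  obtain ⟨c, hc⟩ := exists_centralSeries_eq h1 h2
  exact ⟨c, h.injective (by rw [apply_scalar, hc])⟩

theorem coeff_sum_centralSeries_mul_single [FiniteDimensional F K] {n : (K ≃ₐ[F] K) → ℕ}
    (g : (K ≃ₐ[F] K) → Γ) (hg : ∀ σ, gal ε (g σ) = σ)
    (b : ∀ σ, Fin (n σ) → A) (z : (Σ σ, Fin (n σ)) → HahnSeries (trivialDegrees ε) F) (γ : Γ) :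
    (∑ p, centralSeries A ε (z p) * HahnSeries.single (g p.1) (b p.1 p.2)).coeff γ =
      ∑ i, (centralSeries A ε (z ⟨gal ε γ, i⟩)).coeff (γ - g (gal ε γ)) * b (gal ε γ) i := by
  classical
  rw [HahnSeries.coeff_sum, Fintype.sum_sigma, Finset.sum_eq_single (gal ε γ)]
  · exact Finset.sum_congr rfl fun i _ => HahnSeries.coeff_mul_single
  · intro σ _ hσ
    refine Finset.sum_eq_zero fun i _ => ?_
    rw [HahnSeries.coeff_mul_single, coeff_centralSeries_of_ne, zero_mul]
    rw [Ne, ← mem_trivialDegrees, sub_mem_trivialDegrees, hg]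
    exact hσ.symm
  · simp

/-- A basis consists of the monomials of degree g(σ) whose coefficients run through an F-basis of
the σ-component of A, where g(σ) is a chosen degree over σ. Their number is the sum of the
dimensions of the components, that is, dim A. -/
theorem finrank_scalar (h : IsTwistedSeriesRing ι ε Φ)
    [FiniteDimensional F A] [FiniteDimensional F K] [IsGalois F K]
    (hε : ∀ σ, ∃ γ, gal ε γ = σ) :
    @finrank (HahnSeries (trivialDegrees ε) F) D _ _
      (h.scalar.toAlgebra' h.scalar_mul_comm).toModule = finrank F A := by
  classical
  let _ := h.scalar.toAlgebra' h.scalar_mul_comm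
  choose g hg using hε
  let n : (K ≃ₐ[F] K) → ℕ := fun σ => finrank F (twistedCentralizer ι σ)
  let b : ∀ σ, Basis (Fin (n σ)) F (twistedCentralizer ι σ) := fun σ => finBasis F _
  have hy : ∀ p : Σ σ, Fin (n σ), ∃ y : D, Φ y = HahnSeries.single (g p.1) (b p.1 p.2 : A) :=
    fun p => h.exists_eq_single (by rw [hg]; exact (b p.1 p.2).2)
  choose y hy using hy
  have hsum : ∀ z : (Σ σ, Fin (n σ)) → HahnSeries (trivialDegrees ε) F, ∀ γ,
      (Φ (∑ p, z p • y p)).coeff γ =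
        ∑ i, (centralSeries A ε (z ⟨gal ε γ, i⟩)).coeff (γ - g (gal ε γ)) *
          (b (gal ε γ) i : A) := by
    intro z γ
    rw [← coeff_sum_centralSeries_mul_single g hg (fun σ i => (b σ i : A)) z γ, map_sum]
    congr 1
    refine Finset.sum_congr rfl fun p _ => ?_
    rw [Algebra.smul_def, map_mul, hy]
    congr 1
    exact h.apply_scalar _
  have hlin : LinearIndependent (HahnSeries (trivialDegrees ε) F) y := by
    rw [Fintype.linearIndependent_iff]
    rintro z hz ⟨σ, i⟩
    ext δ
    have h1 : gal ε (δ + g σ) = σ := by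
      rw [gal_add, hg, mem_trivialDegrees.1 δ.2, one_mul]
    have h2 := hsum z (δ + g σ)
    rw [hz, map_zero, HahnSeries.coeff_zero, h1, add_sub_cancel_right] at h2
    simp only [coeff_centralSeries, ← Algebra.smul_def, ← Submodule.coe_smul] at h2
    rw [← Submodule.coe_sum, eq_comm, Submodule.coe_eq_zero] at h2
    exact Fintype.linearIndependent_iff.1 (b σ).linearIndependent
      (fun i => (z ⟨σ, i⟩).coeff δ) h2 i
  have hspan : ⊤ ≤ Submodule.span (HahnSeries (trivialDegrees ε) F) (Set.range y) := by
    intro x _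
    have hc : ∀ (p : Σ σ, Fin (n σ)) (δ : trivialDegrees ε),
        (Φ x).coeff (δ + g p.1) ∈ twistedCentralizer ι p.1 := fun p δ => by
      have := h.coeff_mem x (δ + g p.1)
      rwa [gal_add, hg, mem_trivialDegrees.1 δ.2, one_mul] at this
    let c : (p : Σ σ, Fin (n σ)) → trivialDegrees ε → F := fun p δ =>
      (b p.1).repr ⟨(Φ x).coeff (δ + g p.1), hc p δ⟩ p.2
    -- The coordinate series at (σ, i) collects the i-th coordinates of the coefficients of x in the
    -- degrees δ + g(σ) with δ ∈ ker ε.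
    let z : (Σ σ, Fin (n σ)) → HahnSeries (trivialDegrees ε) F := fun p =>
      ⟨c p, (Φ x).isPWO_support_of_translate (g p.1) _ fun δ hδ h0 => hδ (by
        have : (⟨(Φ x).coeff (δ + g p.1), hc p δ⟩ : twistedCentralizer ι p.1) = 0 := Subtype.ext h0
        simp only [c, this, map_zero, Finsupp.coe_zero, Pi.zero_apply])⟩
    have : x = ∑ p, z p • y p := by
      refine h.injective (HahnSeries.ext (funext fun γ => ?_))
      rw [hsum]
      have hγ : γ - g (gal ε γ) ∈ trivialDegrees ε := by rw [sub_mem_trivialDegrees, hg]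
      have h1 := fun i => coeff_centralSeries (A := A) (z ⟨gal ε γ, i⟩) ⟨_, hγ⟩
      simp only [h1, ← Algebra.smul_def, ← Submodule.coe_smul, ← Submodule.coe_sum]
      have h2 := (b (gal ε γ)).sum_repr ⟨(Φ x).coeff γ, h.coeff_mem x γ⟩
      have h3 := congrArg Subtype.val h2
      refine h3.symm.trans (congrArg Subtype.val ?_)
      refine Finset.sum_congr rfl fun i _ => ?_
      simp only [z, c, sub_add_cancel]
    rw [this]
    exact Submodule.sum_mem _ fun p _ =>
      Submodule.smul_mem _ _ (Submodule.subset_span (Set.mem_range_self p))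
  rw [finrank_eq_card_basis (Basis.mk hlin hspan), finrank_eq_sum_twistedCentralizer ι,
    Fintype.card_sigma]
  simp [n]

/-- The ring embeds in the Hahn series over a division ring, so it is a domain; and it is
finite-dimensional over a central field. -/
theorem isUnit_or_eq_zero (h : IsTwistedSeriesRing ι ε Φ) [Nontrivial D]
    [FiniteDimensional F A] [FiniteDimensional F K] [IsGalois F K]
    (hε : ∀ σ, ∃ γ, gal ε γ = σ) (x : D) : IsUnit x ∨ x = 0 := by
  let _ := h.scalar.toAlgebra' h.scalar_mul_comm
  have := h.isDomain
  have : FiniteDimensional (HahnSeries (trivialDegrees ε) F) D :=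
    finite_of_finrank_pos ((h.finrank_scalar hε).symm ▸ finrank_pos)
  refine or_iff_not_imp_right.2 fun hx => ?_
  obtain ⟨y, hy⟩ := FiniteDimensional.exists_mul_eq_one (HahnSeries (trivialDegrees ε) F) hx
  refine ⟨⟨x, y, hy, mul_left_cancel₀ hx ?_⟩, rfl⟩
  rw [← mul_assoc, hy, one_mul, mul_one]

end Ring

theorem finrank_center [DivisionRing D] {ι : K →ₐ[F] A} {ε : Multiplicative Γ →* (K ≃ₐ[F] K)}
    {Φ : D →+* HahnSeries Γ A} (h : IsTwistedSeriesRing ι ε Φ) [Algebra.IsCentral F A]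
    [FiniteDimensional F A] [FiniteDimensional F K] [IsGalois F K]
    (hε : ∀ σ, ∃ γ, gal ε γ = σ) : finrank (Subring.center D) D = finrank F A := by
  rw [← h.finrank_scalar hε]
  let _ := h.scalar.toAlgebra' h.scalar_mul_comm
  refine (Algebra.finrank_eq_of_equiv_equiv (RingEquiv.ofBijective
    (h.scalar.codRestrict (Subring.center D) fun c =>
      Subring.mem_center_iff.2 fun x => (h.scalar_mul_comm c x).symm) ⟨?_, ?_⟩)
    (RingEquiv.refl D) rfl).symm
  · exact fun c d hcd => h.scalar.injective (congrArg Subtype.val hcd)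
  · rintro ⟨x, hx⟩
    obtain ⟨c, hc⟩ := h.exists_scalar_eq hε fun y => (Subring.mem_center_iff.1 hx y).symm
    exact ⟨c, Subtype.ext hc⟩

end IsTwistedSeriesRing

end TwistedSeries

/-! ### Left dimension over a subfield. -/

section LeftModules

open Module

variable {F E B : Type*} [Field F] [Field E] [Algebra F E] [Ring B] [Algebra F B]

/-- A ring containing a field `E` has a left basis over `E`. -/
theorem exists_left_basis [FiniteDimensional F B] (κ : E →ₐ[F] B) :
    ∃ (m : ℕ) (b : Fin m → B), finrank F E * m = finrank F B ∧
      ∀ c : Fin m → E, ∑ i, κ (c i) * b i = 0 → c = 0 := by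
  let _ : Module E B := Module.compHom B κ.toRingHom
  have hsmul : ∀ (e : E) (x : B), e • x = κ e * x := fun _ _ => rfl
  have : IsScalarTower F E B := ⟨fun a e x => by
    rw [hsmul, hsmul, map_smul, smul_mul_assoc]⟩
  have : Module.Finite E B := Module.Finite.of_restrictScalars_finite F E B
  refine ⟨finrank E B, finBasis E B, finrank_mul_finrank F E B, fun c hc => ?_⟩
  exact funext (Fintype.linearIndependent_iff.1 (finBasis E B).linearIndependent c hc)

theorem finrank_mul_card_le_of_left_independent [FiniteDimensional F B] (κ : E →ₐ[F] B)
    {I : Type*} [Fintype I] (x : I → B) (hx : ∀ c : I → E, ∑ i, κ (c i) * x i = 0 → c = 0) :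
    finrank F E * Fintype.card I ≤ finrank F B := by
  let _ : Module E B := Module.compHom B κ.toRingHom
  have hsmul : ∀ (e : E) (x : B), e • x = κ e * x := fun _ _ => rfl
  have : IsScalarTower F E B := ⟨fun a e x => by
    rw [hsmul, hsmul, map_smul, smul_mul_assoc]⟩
  have : Module.Finite E B := Module.Finite.of_restrictScalars_finite F E B
  rw [← finrank_mul_finrank F E B]
  refine Nat.mul_le_mul_left _ (LinearIndependent.fintype_card_le_finrank (b := x) ?_)
  exact Fintype.linearIndependent_iff.2 fun c hc => congrFun (hx c hc)

end LeftModules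

/-! ### Subfields generated by commuting elements, and separability in 2-power degree. -/

section CommutativeSubfields

open Module Polynomial

/-- A commuting subset of a division algebra generates a field. -/
theorem exists_field_range_eq_adjoin {F : Type uF} {A : Type uA} [Field F] [DivisionRing A]
    [Algebra F A] [FiniteDimensional F A] {S : Set A} (hS : ∀ x ∈ S, ∀ y ∈ S, x * y = y * x) :
    ∃ (M : Type uA) (_ : Field M) (_ : Algebra F M) (j : M →ₐ[F] A),
      j.range = Algebra.adjoin F S := by
  have := Algebra.isMulCommutative_adjoin F hS
  let _ : CommRing (Algebra.adjoin F S) :=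
    { (inferInstance : Ring (Algebra.adjoin F S)) with mul_comm := mul_comm' }
  let _ : Field (Algebra.adjoin F S) := fieldOfFiniteDimensional F (Algebra.adjoin F S)
  exact ⟨Algebra.adjoin F S, inferInstance, inferInstance, (Algebra.adjoin F S).val,
    Subalgebra.range_val _⟩

variable {F A M : Type*} [Field F] [DivisionRing A] [Algebra F A] [Field M] [Algebra F M]

theorem adjoin_preimage_eq_top {S : Set A} {j : M →ₐ[F] A} (hj : j.range = Algebra.adjoin F S) :
    IntermediateField.adjoin F (j ⁻¹' S) = ⊤ := by
  refine eq_top_iff.2 fun x _ => IntermediateField.algebra_adjoin_le_adjoin F _ ?_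
  have hS : j '' (j ⁻¹' S) = S := Set.image_preimage_eq_of_subset fun s hs => by
    have : s ∈ j.range := hj ▸ Algebra.subset_adjoin hs
    exact this
  have hx : j x ∈ (Algebra.adjoin F (j ⁻¹' S)).map j := by
    rw [AlgHom.map_adjoin, hS, ← hj]
    exact ⟨x, rfl⟩
  obtain ⟨y, hy, hxy⟩ := hx
  rwa [← j.injective hxy]

/-- The degree of the minimal polynomial is a power of 2, hence nonzero in F. This is the top
coefficient of the derivative, so the derivative does not vanish. -/
theorem isSeparable_of_finrank_eq_two_pow (h2 : (2 : F) ≠ 0) [FiniteDimensional F M] {n : ℕ}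
    (hM : finrank F M = 2 ^ n) (x : M) : IsSeparable F x := by
  have hx : IsIntegral F x := Algebra.IsIntegral.isIntegral x
  refine (separable_iff_derivative_ne_zero (minpoly.irreducible hx)).2 fun h0 => ?_
  obtain ⟨k, -, hk⟩ := (Nat.dvd_prime_pow Nat.prime_two).1 (hM ▸ minpoly.degree_dvd hx)
  have hpos := minpoly.natDegree_pos hx
  have h1 := congrArg (fun p => coeff p ((minpoly F x).natDegree - 1)) h0
  simp only [coeff_derivative, coeff_zero] at h1
  rw [Nat.sub_add_cancel hpos, coeff_natDegree, (minpoly.monic hx).leadingCoeff, one_mul,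
    ← Nat.cast_succ, Nat.succ_eq_add_one, Nat.sub_add_cancel hpos, hk] at h1
  push_cast at h1
  exact pow_ne_zero k h2 h1

end CommutativeSubfields

/-! ### Integral elements of a subfield L and their constant terms. -/

section SubfieldsOfTwistedSeries

open MalcevNeumann Module

section Integers

variable {Γ L R : Type*} [AddCommGroup Γ] [LinearOrder Γ] [IsOrderedAddMonoid Γ] [CommRing L]
  [Ring R] (Ψ : L →+* HahnSeries Γ R)

/-- The elements whose series has no terms of negative degree. -/
def seriesIntegers : Subring L where
  carrier := {l | ∀ γ < 0, (Ψ l).coeff γ = 0}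
  zero_mem' γ _ := by rw [map_zero, HahnSeries.coeff_zero]
  one_mem' γ hγ := by rw [map_one, HahnSeries.coeff_one, if_neg hγ.ne]
  add_mem' {l m} hl hm γ hγ := by
    rw [map_add, HahnSeries.coeff_add, hl γ hγ, hm γ hγ, add_zero]
  neg_mem' {l} hl γ hγ := by rw [map_neg, HahnSeries.coeff_neg, hl γ hγ, neg_zero]
  mul_mem' {l m} hl hm γ hγ := by
    rw [map_mul]
    exact HahnSeries.coeff_mul_eq_zero_of_lt_add hl hm (by rwa [add_zero])

/-- The constant term of a series without terms of negative degree. -/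
noncomputable def seriesResidue : seriesIntegers Ψ →+* R where
  toFun l := (Ψ l).coeff 0
  map_one' := by simp
  map_zero' := by simp
  map_add' l m := by simp
  map_mul' l m := by
    have := HahnSeries.coeff_mul_add l.2 m.2
    rw [add_zero] at this
    simpa using this

theorem seriesResidue_apply (l : seriesIntegers Ψ) : seriesResidue Ψ l = (Ψ l).coeff 0 := rfl

end Integers

variable {F K A Γ D L : Type*} [Field F] [Field K] [Algebra F K] [DivisionRing A] [Algebra F A]
  [AddCommGroup Γ] [LinearOrder Γ] [IsOrderedAddMonoid Γ] [DivisionRing D] [Field L]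
  [Algebra (Subring.center D) L]
  {ι : K →ₐ[F] A} {ε : Multiplicative Γ →* (K ≃ₐ[F] K)} {Φ : D →+* HahnSeries Γ A}

instance isCentral_subringCenter : Algebra.IsCentral (Subring.center D) D where
  out x hx := ⟨⟨x, Subring.mem_center_iff.2 fun y => Subalgebra.mem_center_iff.1 hx y⟩, rfl⟩

/-- The series of the elements of a subfield. -/
noncomputable def subfieldSeries (Φ : D →+* HahnSeries Γ A) (j : L →ₐ[Subring.center D] D) :
    L →+* HahnSeries Γ A := Φ.comp j.toRingHom

theorem subfieldSeries_apply (Φ : D →+* HahnSeries Γ A) (j : L →ₐ[Subring.center D] D) (l : L) :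
    subfieldSeries Φ j l = Φ (j l) := rfl

namespace IsTwistedSeriesRing

theorem exists_apply_algebraMap_eq_centralSeries [Algebra.IsCentral F A] [FiniteDimensional F K] [IsGalois F K]
    (h : IsTwistedSeriesRing ι ε Φ) (hε : ∀ σ, ∃ γ, gal ε γ = σ) (j : L →ₐ[Subring.center D] D)
    (z : Subring.center D) :
    ∃ c, (subfieldSeries Φ j) (algebraMap (Subring.center D) L z) = centralSeries A ε c := by
  obtain ⟨c, hc⟩ := h.exists_scalar_eq hε (x := z) fun y => (Subring.mem_center_iff.1 z.2 y).symm
  refine ⟨c, ?_⟩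
  rw [← h.apply_scalar, hc]
  exact congrArg Φ (j.commutes z)

/-- The field of constant terms of the elements of `L` without terms of negative degree. -/
noncomputable def residueSubalgebra (h : IsTwistedSeriesRing ι ε Φ) (j : L →ₐ[Subring.center D] D) :
    Subalgebra F A where
  toSubsemiring := (seriesResidue (subfieldSeries Φ j)).range.toSubsemiring
  algebraMap_mem' x := by
    have hz : h.scalar (HahnSeries.C x) ∈ Subring.center D :=
      Subring.mem_center_iff.2 fun y => (h.scalar_mul_comm _ y).symm
    have hΨ : (subfieldSeries Φ j) (algebraMap (Subring.center D) L ⟨_, hz⟩) =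
        HahnSeries.single 0 (algebraMap F A x) := by
      rw [← centralSeries_C (ε := ε), ← h.apply_scalar]
      exact congrArg Φ (j.commutes _)
    refine ⟨⟨algebraMap (Subring.center D) L ⟨h.scalar (HahnSeries.C x), hz⟩, fun γ hγ => ?_⟩, ?_⟩
    · rw [hΨ, HahnSeries.coeff_single_of_ne hγ.ne]
    · rw [seriesResidue_apply, hΨ, HahnSeries.coeff_single_same]

theorem mem_residueSubalgebra {h : IsTwistedSeriesRing ι ε Φ} {j : L →ₐ[Subring.center D] D}
    {a : A} : a ∈ h.residueSubalgebra j ↔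
      ∃ l ∈ seriesIntegers (subfieldSeries Φ j), ((subfieldSeries Φ j) l).coeff 0 = a :=
  ⟨fun ⟨l, hl⟩ => ⟨l, l.2, hl⟩, fun ⟨l, hl, hla⟩ => ⟨⟨l, hl⟩, hla⟩⟩

theorem residueSubalgebra_comm (h : IsTwistedSeriesRing ι ε Φ) (j : L →ₐ[Subring.center D] D)
    {x y : A} (hx : x ∈ h.residueSubalgebra j) (hy : y ∈ h.residueSubalgebra j) :
    x * y = y * x := by
  obtain ⟨l, rfl⟩ := hx
  obtain ⟨m, rfl⟩ := hy
  change seriesResidue _ l * seriesResidue _ m = seriesResidue _ m * seriesResidue _ l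
  rw [← map_mul, mul_comm, map_mul]

theorem residueSubalgebra_comm_apply (h : IsTwistedSeriesRing ι ε Φ)
    (j : L →ₐ[Subring.center D] D) {x : A} (hx : x ∈ h.residueSubalgebra j) (k : K) :
    ι k * x = x * ι k := by
  obtain ⟨l, -, rfl⟩ := mem_residueSubalgebra.1 hx
  have := h.coeff_mem (j l) 0 k
  have h1 : gal ε 0 = 1 := by simp [gal]
  rwa [h1] at this

/-- Automorphisms over the center preserve the absence of terms of negative degree, since they
are induced by inner automorphisms. -/
theorem algEquiv_mem_seriesIntegers [FiniteDimensional (Subring.center D) L]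
    [IsGalois (Subring.center D) L] (h : IsTwistedSeriesRing ι ε Φ)
    (j : L →ₐ[Subring.center D] D) (g : L ≃ₐ[Subring.center D] L) {l : L}
    (hl : l ∈ seriesIntegers (subfieldSeries Φ j)) :
    g l ∈ seriesIntegers (subfieldSeries Φ j) := by
  obtain ⟨u, hu, hg⟩ := exists_conj_eq j g
  intro γ hγ
  by_contra h0
  have hu' : Φ u ≠ 0 := fun h' => hu (h.injective (h'.trans (map_zero Φ).symm))
  have hgl : (subfieldSeries Φ j) (g l) ≠ 0 := fun h' => h0 (by rw [h', HahnSeries.coeff_zero])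
  have horder : ((subfieldSeries Φ j) (g l)).order < 0 :=
    (HahnSeries.order_le_of_coeff_ne_zero h0).trans_lt hγ
  -- Compare lowest degrees in u g(l) = l u: the right side starts at or above the order of u, the
  -- left side strictly below it if g(l) has a negative term.
  have h1 : Φ u * (subfieldSeries Φ j) (g l) = (subfieldSeries Φ j) l * Φ u := by
    have : u * j (g l) = j l * u := by rw [hg, mul_assoc, mul_inv_cancel_left₀ hu]
    exact (map_mul Φ _ _).symm.trans ((congrArg Φ this).trans (map_mul Φ _ _))
  have h2 := HahnSeries.coeff_mul_order_add_order (Φ u) ((subfieldSeries Φ j) (g l))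
  rw [h1, HahnSeries.coeff_mul_eq_zero_of_lt_add hl
    fun _ => HahnSeries.coeff_eq_zero_of_lt_order] at h2
  · exact mul_ne_zero (HahnSeries.leadingCoeff_ne_zero.2 hu')
      (HahnSeries.leadingCoeff_ne_zero.2 hgl) h2.symm
  · rw [add_comm]
    exact add_lt_add_left horder _

open Polynomial in
/-- The residues of a Galois extension of the center have minimal polynomials that split over
every field of residues. -/
theorem splits_minpoly_of_mem_residueSubalgebra [FiniteDimensional (Subring.center D) L]
    [IsGalois (Subring.center D) L] [Algebra.IsCentral F A] [FiniteDimensional F K]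
    [IsGalois F K] (h : IsTwistedSeriesRing ι ε Φ) (hε : ∀ σ, ∃ γ, gal ε γ = σ)
    (j : L →ₐ[Subring.center D] D) {M : Type*} [Field M] [Algebra F M] (jM : M →ₐ[F] A)
    (hM : h.residueSubalgebra j ≤ jM.range) {x : M} (hx : jM x ∈ h.residueSubalgebra j) :
    ((minpoly F x).map (algebraMap F M)).Splits := by
  have hM' : ∀ l : seriesIntegers (subfieldSeries Φ j),
      seriesResidue (subfieldSeries Φ j) l ∈ jM.toRingHom.range := fun l => hM ⟨l, rfl⟩
  let φ : seriesIntegers (subfieldSeries Φ j) →+* M :=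
    (RingEquiv.ofBijective jM.toRingHom.rangeRestrict
      ⟨fun _ _ hxy => jM.injective (congrArg Subtype.val hxy),
        jM.toRingHom.rangeRestrict_surjective⟩).symm.toRingHom.comp
      ((seriesResidue (subfieldSeries Φ j)).codRestrict jM.toRingHom.range hM')
  have hφ : ∀ l, jM (φ l) = seriesResidue (subfieldSeries Φ j) l := fun l =>
    congrArg Subtype.val (RingEquiv.apply_symm_apply
      (RingEquiv.ofBijective jM.toRingHom.rangeRestrict
        ⟨fun _ _ hxy => jM.injective (congrArg Subtype.val hxy),
          jM.toRingHom.rangeRestrict_surjective⟩)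
      ((seriesResidue (subfieldSeries Φ j)).codRestrict jM.toRingHom.range hM' l))
  obtain ⟨l, hl⟩ := hx
  have hlx : φ l = x := jM.injective ((hφ l).trans hl)
  -- P is the orbit polynomial of l over L. Its coefficients are Galois-fixed, hence central, so
  -- their constant terms lie in F. Reducing P gives a polynomial over F that splits in M and
  -- vanishes at x.
  let P : (seriesIntegers (subfieldSeries Φ j))[X] :=
    ∏ g : L ≃ₐ[Subring.center D] L, (X - C ⟨g l, h.algEquiv_mem_seriesIntegers j g l.2⟩)
  have hP : P.map (seriesIntegers (subfieldSeries Φ j)).subtype =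
      ∏ g : L ≃ₐ[Subring.center D] L, (X - C (g l)) := by
    simp only [P, Polynomial.map_prod, Polynomial.map_sub, map_X, map_C]
    rfl
  have hfix : ∀ (n : ℕ) (g : L ≃ₐ[Subring.center D] L), g (P.coeff n) = P.coeff n := by
    intro n g
    have h1 : ((P.coeff n : seriesIntegers (subfieldSeries Φ j)) : L) =
        (∏ g : L ≃ₐ[Subring.center D] L, (X - C (g l))).coeff n := by
      rw [← hP, coeff_map]
      rfl
    rw [h1, ← AlgEquiv.coe_ringEquiv, ← RingEquiv.coe_toRingHom, ← coeff_map, Polynomial.map_prod]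
    congr 1
    refine Fintype.prod_equiv (Equiv.mulLeft g) _ _ fun g' => ?_
    simp
  have hcoeff : ∀ n, ∃ y : F, φ (P.coeff n) = algebraMap F M y := by
    intro n
    obtain ⟨z, hz⟩ := (IsGalois.mem_bot_iff_fixed (F := Subring.center D) (E := L)
      (P.coeff n : L)).2 (hfix n)
    obtain ⟨c, hc⟩ := h.exists_apply_algebraMap_eq_centralSeries hε j z
    obtain ⟨y, hy⟩ := exists_coeff_centralSeries_eq (A := A) c 0
    refine ⟨y, jM.injective ?_⟩
    change jM _ = jM _
    rw [hφ, seriesResidue_apply, ← hz, jM.commutes, ← hy, ← hc]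
    rfl
  obtain ⟨q, hq⟩ : ∃ q : F[X], q.map (algebraMap F M) = P.map φ := by
    rw [← mem_lifts, lifts_iff_coeff_lifts]
    intro n
    obtain ⟨y, hy⟩ := hcoeff n
    exact ⟨y, by rw [coeff_map, hy]⟩
  have hPφ : P.map φ = ∏ g : L ≃ₐ[Subring.center D] L,
      (X - C (φ ⟨g l, h.algEquiv_mem_seriesIntegers j g l.2⟩)) := by
    simp only [P, Polynomial.map_prod, Polynomial.map_sub, map_X, map_C]
  have hP0 : P.map φ ≠ 0 := by
    rw [hPφ]
    exact (monic_prod_of_monic _ _ fun g _ => monic_X_sub_C _).ne_zero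
  refine Splits.of_dvd (g := P.map φ) ?_ hP0 ?_
  · rw [hPφ]
    exact Splits.prod fun g _ => Splits.X_sub_C _
  · rw [← hq]
    refine Polynomial.map_dvd _ (minpoly.dvd F x ?_)
    rw [aeval_def, ← eval_map, hq, hPφ, eval_prod]
    refine Finset.prod_eq_zero (Finset.mem_univ 1) ?_
    rw [eval_sub, eval_X, eval_C, sub_eq_zero, ← hlx]
    rfl

end IsTwistedSeriesRing

end SubfieldsOfTwistedSeries

/-! ### Residue fields and leading terms of Galois subfields. -/

section NoncrossedSeries

open MalcevNeumann Module

namespace IsTwistedSeriesRing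

/-- If no Galois extension of `F` of degree `8` lies between `K` and `A`, the constant terms of a
Galois extension of the center lie in `K`. -/
theorem residueSubalgebra_le_range {F : Type uF} {K : Type uK} {A : Type uA} {Γ D L : Type*}
    [Field F] [Field K] [Algebra F K] [DivisionRing A] [Algebra F A] [Algebra.IsCentral F A]
    [AddCommGroup Γ] [LinearOrder Γ] [IsOrderedAddMonoid Γ] [DivisionRing D] [Field L]
    [Algebra (Subring.center D) L] [FiniteDimensional (Subring.center D) L]
    [IsGalois (Subring.center D) L] [IsGalois F K] {ι : K →ₐ[F] A}
    {ε : Multiplicative Γ →* (K ≃ₐ[F] K)} {Φ : D →+* HahnSeries Γ A}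
    (h : IsTwistedSeriesRing ι ε Φ) (hε : ∀ σ, ∃ γ, gal ε γ = σ) (h2 : (2 : F) ≠ 0)
    (hA : finrank F A = 8 ^ 2) (hK : finrank F K = 4)
    (hno : ¬ ∃ (M : Type uA) (_ : Field M) (_ : Algebra F M) (j : M →ₐ[F] A),
      IsGalois F M ∧ finrank F M = 8 ∧ ι.range ≤ j.range)
    (j : L →ₐ[Subring.center D] D) : h.residueSubalgebra j ≤ ι.range := by
  have : FiniteDimensional F A := finite_of_finrank_pos (by rw [hA]; norm_num)
  have : FiniteDimensional F K := finite_of_finrank_pos (by rw [hK]; norm_num)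
  let S : Set A := Set.range ι ∪ h.residueSubalgebra j
  have hS : ∀ x ∈ S, ∀ y ∈ S, x * y = y * x := by
    rintro _ (⟨x, rfl⟩ | hx) _ (⟨y, rfl⟩ | hy)
    · rw [← map_mul, mul_comm, map_mul]
    · exact h.residueSubalgebra_comm_apply j hy x
    · exact (h.residueSubalgebra_comm_apply j hx y).symm
    · exact h.residueSubalgebra_comm j hx hy
  obtain ⟨M, _, _, jM, hjM⟩ := exists_field_range_eq_adjoin (F := F) hS
  have hιM : ι.range ≤ jM.range := by
    rintro _ ⟨x, rfl⟩
    rw [hjM]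
    exact Algebra.subset_adjoin (Or.inl ⟨x, rfl⟩)
  have hresM : h.residueSubalgebra j ≤ jM.range := fun x hx => by
    rw [hjM]
    exact Algebra.subset_adjoin (Or.inr hx)
  have : FiniteDimensional F M := FiniteDimensional.of_injective jM.toLinearMap jM.injective
  -- A is a left vector space over M, so [M : F] divides 64.
  obtain ⟨n, hn⟩ : ∃ n, finrank F M = 2 ^ n := by
    obtain ⟨m, _, hm, -⟩ := exists_left_basis jM
    have : finrank F M ∣ 2 ^ 6 := ⟨m, by rw [hm, hA]; norm_num⟩
    obtain ⟨n, -, hn⟩ := (Nat.dvd_prime_pow Nat.prime_two).1 this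
    exact ⟨n, hn⟩
  let κ : K →ₐ[F] M := ((AlgEquiv.ofInjective jM jM.injective).symm.toAlgHom.comp
    (Subalgebra.inclusion hιM)).comp ι.rangeRestrict
  have hκ : ∀ k, jM (κ k) = ι k := fun k => congrArg Subtype.val
    ((AlgEquiv.ofInjective jM jM.injective).apply_symm_apply
      (Subalgebra.inclusion hιM (ι.rangeRestrict k)))
  have hgal : IsGalois F M := by
    refine isGalois_of_adjoin_eq_top _ (adjoin_preimage_eq_top hjM) fun x hx =>
      ⟨isSeparable_of_finrank_eq_two_pow h2 hn x, ?_⟩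
    rcases hx with ⟨k, hk⟩ | hx
    · have hx : κ k = x := jM.injective ((hκ k).trans hk)
      have h1 := (Normal.splits (inferInstance : Normal F K) k).map κ.toRingHom
      rw [Polynomial.map_map] at h1
      rw [← hx, minpoly.algHom_eq κ κ.injective]
      convert h1
      exact κ.comp_algebraMap.symm
    · exact h.splits_minpoly_of_mem_residueSubalgebra hε j jM hresM hx
  have hsq := finrank_sq_le_of_commutative jM
  rw [hA] at hsq
  have hle : finrank F M ≤ 8 := (Nat.pow_le_pow_iff_left two_ne_zero).1 hsq
  have hge : 4 ≤ finrank F M := by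
    rw [← hK]
    exact LinearMap.finrank_le_finrank_of_injective (f := κ.toLinearMap) κ.injective
  have hne : finrank F M ≠ 8 := fun h8 => hno ⟨M, _, _, jM, hgal, h8, hιM⟩
  -- The degree is a power of 2 between 4 and 8, and 8 is excluded because M would be a forbidden
  -- Galois extension. Hence M is the image of K.
  have h4 : finrank F M = 4 := by
    rw [hn] at hle hge hne ⊢
    have : n < 4 := (Nat.pow_lt_pow_iff_right (a := 2) (by norm_num)).1 (by omega)
    interval_cases n <;> omega
  have hrange : ι.range = jM.range := by
    refine Subalgebra.eq_of_le_of_finrank_eq hιM ?_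
    rw [← (AlgEquiv.ofInjective jM jM.injective).toLinearEquiv.finrank_eq,
      ← (AlgEquiv.ofInjective ι ι.injective).toLinearEquiv.finrank_eq, h4, hK]
  rw [hrange]
  exact hresM

variable {F K A Γ D L : Type*} [Field F] [Field K] [Algebra F K] [DivisionRing A] [Algebra F A]
  [AddCommGroup Γ] [LinearOrder Γ] [IsOrderedAddMonoid Γ] [DivisionRing D] [Field L]
  [Algebra (Subring.center D) L]
  {ι : K →ₐ[F] A} {ε : Multiplicative Γ →* (K ≃ₐ[F] K)} {Φ : D →+* HahnSeries Γ A}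

/-- The elements of `K` that are constant terms of elements of `L`. -/
noncomputable def residueField [FiniteDimensional F K] (h : IsTwistedSeriesRing ι ε Φ)
    (j : L →ₐ[Subring.center D] D) : IntermediateField F K :=
  ((h.residueSubalgebra j).comap ι).toIntermediateField fun x hx =>
    Subalgebra.inv_mem_of_algebraic ((h.residueSubalgebra j).comap ι) (x := ⟨x, hx⟩)
      (Algebra.IsAlgebraic.isAlgebraic (R := F) x)

theorem mem_residueField [FiniteDimensional F K] {h : IsTwistedSeriesRing ι ε Φ}
    {j : L →ₐ[Subring.center D] D} {x : K} :
    x ∈ h.residueField j ↔ ∃ l ∈ seriesIntegers (subfieldSeries Φ j),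
      (subfieldSeries Φ j l).coeff 0 = ι x :=
  mem_residueSubalgebra (h := h) (j := j) (a := ι x)

theorem subfieldSeries_ne_zero (h : IsTwistedSeriesRing ι ε Φ) (j : L →ₐ[Subring.center D] D)
    {l : L} (hl : l ≠ 0) : subfieldSeries Φ j l ≠ 0 := fun h' =>
  hl (j.injective (h.injective (h'.trans (by rw [map_zero, map_zero]))))

/-- The degrees of leading terms of elements of `L` act trivially on its residue field. -/
theorem gal_order_mem_fixingSubgroup [FiniteDimensional F K] (h : IsTwistedSeriesRing ι ε Φ)
    (j : L →ₐ[Subring.center D] D) {l : L} (hl : l ≠ 0) :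
    gal ε (subfieldSeries Φ j l).order ∈ (h.residueField j).fixingSubgroup := by
  rw [IntermediateField.mem_fixingSubgroup_iff]
  intro k hk
  obtain ⟨m, hm, hmk⟩ := mem_residueField.1 hk
  -- Since l and m commute, so do the leading coefficient of l and the constant term k of m; but the
  -- former twists k by the automorphism of its degree.
  have h1 := HahnSeries.coeff_mul_add (f := subfieldSeries Φ j m) (g := subfieldSeries Φ j l) hm
    fun _ => HahnSeries.coeff_eq_zero_of_lt_order
  have h2 := HahnSeries.coeff_mul_add (f := subfieldSeries Φ j l) (g := subfieldSeries Φ j m)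
    (fun _ => HahnSeries.coeff_eq_zero_of_lt_order) hm
  rw [← map_mul, mul_comm, map_mul, zero_add, ← add_zero (HahnSeries.order _), h2, hmk,
    add_zero] at h1
  refine ι.injective (mul_left_cancel₀ (a := (subfieldSeries Φ j l).leadingCoeff)
    (HahnSeries.leadingCoeff_ne_zero.2 (h.subfieldSeries_ne_zero j hl)) ?_)
  have h3 := h.coeff_mem (j l) (subfieldSeries Φ j l).order k
  rw [HahnSeries.leadingCoeff_eq]
  exact h3.symm.trans h1.symm

/-- If the residue field of `L` lies in `K`, leading coefficients of the same degree differ by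
elements of that field. -/
theorem exists_coeff_eq_mul [FiniteDimensional F K] (h : IsTwistedSeriesRing ι ε Φ)
    (j : L →ₐ[Subring.center D] D) (hres : h.residueSubalgebra j ≤ ι.range) {l : L} (hl : l ≠ 0)
    {m : L} (hm : ∀ γ < (subfieldSeries Φ j l).order, (subfieldSeries Φ j m).coeff γ = 0) :
    ∃ k : h.residueField j, (subfieldSeries Φ j m).coeff (subfieldSeries Φ j l).order =
      (subfieldSeries Φ j l).leadingCoeff * ι k := by
  have hl' := h.subfieldSeries_ne_zero j hl
  have hmul : subfieldSeries Φ j l * subfieldSeries Φ j (l⁻¹ * m) = subfieldSeries Φ j m := by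
    rw [← map_mul, mul_inv_cancel_left₀ hl]
  -- The quotient of m by l has no negative terms because m starts no earlier than l. Its constant
  -- term, which lies in K, is the required factor.
  have hint : l⁻¹ * m ∈ seriesIntegers (subfieldSeries Φ j) := by
    intro γ hγ
    by_contra h0
    have hne : subfieldSeries Φ j (l⁻¹ * m) ≠ 0 := fun h' => h0 (by rw [h', HahnSeries.coeff_zero])
    have horder : (subfieldSeries Φ j (l⁻¹ * m)).order < 0 :=
      (HahnSeries.order_le_of_coeff_ne_zero h0).trans_lt hγ
    have h1 := HahnSeries.coeff_mul_order_add_order (subfieldSeries Φ j l)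
      (subfieldSeries Φ j (l⁻¹ * m))
    rw [hmul, hm _ (by simpa using horder)] at h1
    exact mul_ne_zero (HahnSeries.leadingCoeff_ne_zero.2 hl')
      (HahnSeries.leadingCoeff_ne_zero.2 hne) h1.symm
  obtain ⟨k, hk⟩ := hres (mem_residueSubalgebra.2 ⟨_, hint, rfl⟩)
  refine ⟨⟨k, mem_residueField.2 ⟨_, hint, hk.symm⟩⟩, ?_⟩
  have h1 := HahnSeries.coeff_mul_add (f := subfieldSeries Φ j l)
    (fun _ => HahnSeries.coeff_eq_zero_of_lt_order) hint
  rw [hmul, add_zero, ← hk] at h1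
  rw [h1, HahnSeries.leadingCoeff_eq]
  rfl

/-- If the residue field of a subfield `L` lies in `K`, then `[L : Z]` times the dimension of the
centralizer of `K` is at most the dimension of `D` over its center `Z`. -/
theorem finrank_mul_le_of_residueSubalgebra_le [IsGalois F K] [FiniteDimensional F K]
    [FiniteDimensional F A] [Algebra.IsCentral F A] [FiniteDimensional (Subring.center D) D]
    (h : IsTwistedSeriesRing ι ε Φ)
    (hε : ∀ σ, ∃ γ, gal ε γ = σ) (j : L →ₐ[Subring.center D] D)
    (hres : h.residueSubalgebra j ≤ ι.range) :
    finrank (Subring.center D) L * finrank F (Subalgebra.centralizer F (Set.range ι)) ≤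
      finrank (Subring.center D) D := by
  classical
  let E := h.residueField j
  let B := Subalgebra.centralizer F (Set.range ι)
  have hιB : ∀ x, ι x ∈ B := fun x => by
    rw [Subalgebra.mem_centralizer_iff]
    rintro _ ⟨y, rfl⟩
    rw [← map_mul, mul_comm, map_mul]
  obtain ⟨m, b, hm, hb⟩ := exists_left_basis ((ι.codRestrict B hιB).comp E.val)
  have hb' : ∀ c : Fin m → E, ∑ i, ι (c i) * (b i : A) = 0 → c = 0 := fun c hc =>
    hb c (Subtype.ext (by simpa using hc))
  choose g hg using hε
  choose u hu hu0 using fun σ => twistedCentralizer_ne_bot ι σ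
  have hbu : ∀ σ i, (b i : A) * u σ ∈ twistedCentralizer ι (gal ε (g σ)) := fun σ i x => by
    have := (Subalgebra.mem_centralizer_iff F).1 (b i).2 _ ⟨x, rfl⟩
    rw [hg, ← mul_assoc, this, mul_assoc, hu σ x, mul_assoc]
  choose x hx using fun σ i => h.exists_eq_single (hbu σ i)
  let Q := (K ≃ₐ[F] K) ⧸ E.fixingSubgroup
  -- The index of Gal(K/E) is [E : F], and m is the left dimension of C_A(K) over E. So the family
  -- indexed by cosets and basis elements has [E : F] · m = dim C_A(K) members.
  have hcard : finrank F B = Fintype.card (Q × Fin m) := by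
    have h1 := E.fixingSubgroup.card_eq_card_quotient_mul_card_subgroup
    rw [IsGalois.card_aut_eq_finrank, IsGalois.card_fixingSubgroup_eq_finrank,
      ← finrank_mul_finrank F E K] at h1
    have h2 := Nat.eq_of_mul_eq_mul_right finrank_pos h1
    rw [Fintype.card_prod, Fintype.card_fin, ← Nat.card_eq_fintype_card, ← h2, hm]
  rw [hcard]
  refine finrank_mul_card_le_of_left_independent j (fun p : Q × Fin m => x p.1.out p.2) ?_
  intro c hc
  by_contra hc0
  let P : Finset (Q × Fin m) := Finset.univ.filter fun p => c p ≠ 0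
  have hP : P.Nonempty := by
    obtain ⟨p, hp⟩ := Function.ne_iff.1 hc0
    exact ⟨p, Finset.mem_filter.2 ⟨Finset.mem_univ _, hp⟩⟩
  -- The relation is examined in the lowest degree that any of its nonzero terms reaches.
  obtain ⟨⟨q₀, i₀⟩, hp₀, hmin⟩ := P.exists_min_image
    (fun p => (subfieldSeries Φ j (c p)).order + g p.1.out) hP
  have hc₀ : c (q₀, i₀) ≠ 0 := (Finset.mem_filter.1 hp₀).2
  set δ := (subfieldSeries Φ j (c (q₀, i₀))).order with hδ
  have hzero : ∀ p : Q × Fin m, ∀ γ, γ + g p.1.out < δ + g q₀.out →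
      (subfieldSeries Φ j (c p)).coeff γ = 0 := by
    intro p γ hγ
    by_cases hp : c p = 0
    · rw [hp, map_zero, HahnSeries.coeff_zero]
    · refine HahnSeries.coeff_eq_zero_of_lt_order ?_
      have := hγ.trans_le (hmin p (Finset.mem_filter.2 ⟨Finset.mem_univ _, hp⟩))
      exact lt_of_add_lt_add_right this
  -- Orders of elements of L map into Gal(K/E). Two terms starting in the same degree therefore have
  -- coset representatives that agree modulo Gal(K/E), so only the coset q₀ contributes.
  have hne : ∀ p : Q × Fin m, p.1 ≠ q₀ →
      (subfieldSeries Φ j (c p)).coeff (δ + g q₀.out - g p.1.out) = 0 := by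
    intro p hpq
    by_contra h0
    have hp : c p ≠ 0 := fun h' => h0 (by rw [h', map_zero, HahnSeries.coeff_zero])
    have horder : (subfieldSeries Φ j (c p)).order = δ + g q₀.out - g p.1.out := by
      refine le_antisymm (HahnSeries.order_le_of_coeff_ne_zero h0) (sub_le_iff_le_add.2 ?_)
      exact hmin p (Finset.mem_filter.2 ⟨Finset.mem_univ _, hp⟩)
    have h1 := h.gal_order_mem_fixingSubgroup j hp
    have h2 := h.gal_order_mem_fixingSubgroup j hc₀
    rw [horder, show δ + g q₀.out - g p.1.out = δ + (-g p.1.out + g q₀.out) by abel, gal_add] at h1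
    have h3 := (Subgroup.mul_mem_cancel_left _ h2).1 h1
    refine hpq ?_
    rw [← p.1.out_eq, ← q₀.out_eq]
    refine QuotientGroup.eq.2 ?_
    have h4 : gal ε (-g p.1.out) = (p.1.out)⁻¹ := by
      rw [← zero_sub, gal_sub, hg]
      simp [gal]
    rwa [gal_add, h4, hg] at h3
  have hsum : ∑ i, (subfieldSeries Φ j (c (q₀, i))).coeff δ * (b i : A) = 0 := by
    have h1 := congrArg (fun y => (Φ y).coeff (δ + g q₀.out)) hc
    simp only [map_sum, map_mul, hx, HahnSeries.coeff_sum, HahnSeries.coeff_mul_single,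
      map_zero, HahnSeries.coeff_zero] at h1
    rw [Fintype.sum_prod_type, Finset.sum_eq_single q₀] at h1
    · simp only [add_sub_cancel_right, ← mul_assoc, ← Finset.sum_mul] at h1
      exact (mul_eq_zero.1 h1).resolve_right (hu0 _)
    · intro q _ hq
      refine Finset.sum_eq_zero fun i _ => ?_
      have := hne (q, i) hq
      rw [subfieldSeries_apply] at this
      rw [this, zero_mul]
    · simp
  choose k hk using fun i => h.exists_coeff_eq_mul j hres hc₀ (m := c (q₀, i)) fun γ hγ =>
    hzero (q₀, i) γ (add_lt_add_left hγ _)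
  have hlead : (subfieldSeries Φ j (c (q₀, i₀))).leadingCoeff ≠ 0 :=
    HahnSeries.leadingCoeff_ne_zero.2 (h.subfieldSeries_ne_zero j hc₀)
  -- After the common leading coefficient is cancelled, the lowest-degree equation is a relation
  -- over E among the basis elements of C_A(K). All its coefficients vanish, including the one at
  -- i₀, which contradicts the nonvanishing of that leading coefficient.
  have hk0 : k = 0 := by
    refine hb' k ((mul_eq_zero.1 ?_).resolve_left hlead)
    rw [Finset.mul_sum, ← hsum]
    refine Finset.sum_congr rfl fun i _ => ?_
    rw [← mul_assoc, ← hk i]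
  have h1 := hk i₀
  rw [hk0] at h1
  refine hlead ?_
  rw [HahnSeries.leadingCoeff_eq, h1]
  simp

end IsTwistedSeriesRing

end NoncrossedSeries

/-! ### Assembly: the Mal'cev–Neumann ring is a noncrossed product. -/

section NoncrossedProducts

open Module

namespace IsTwistedSeriesRing

open MalcevNeumann

/-- A Galois maximal subfield has degree 8 over the center, while dim C_A(K) = 64/4 = 16; the
leading-term bound would give 8 · 16 ≤ 64. -/
theorem not_isCrossedProductOverCenter {F : Type uF} {K : Type uK} {A : Type uA} {Γ D : Type*}
    [Field F] [Field K] [Algebra F K] [DivisionRing A] [Algebra F A] [Algebra.IsCentral F A]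
    [AddCommGroup Γ] [LinearOrder Γ] [IsOrderedAddMonoid Γ] [DivisionRing D]
    [IsGalois F K] {ι : K →ₐ[F] A}
    {ε : Multiplicative Γ →* (K ≃ₐ[F] K)} {Φ : D →+* HahnSeries Γ A}
    (h : IsTwistedSeriesRing ι ε Φ) (hε : ∀ σ, ∃ γ, gal ε γ = σ) (h2 : (2 : F) ≠ 0)
    (hA : finrank F A = 8 ^ 2) (hK : finrank F K = 4)
    (hno : ¬ ∃ (M : Type uA) (_ : Field M) (_ : Algebra F M) (j : M →ₐ[F] A),
      IsGalois F M ∧ finrank F M = 8 ∧ ι.range ≤ j.range) :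
    ¬ IsCrossedProductOverCenter D := by
  rintro ⟨L, _, _, j, _, hmax⟩
  have : FiniteDimensional F A := finite_of_finrank_pos (by rw [hA]; norm_num)
  have : FiniteDimensional F K := finite_of_finrank_pos (by rw [hK]; norm_num)
  have hD : finrank (Subring.center D) D = 8 ^ 2 := (h.finrank_center hε).trans hA
  have : FiniteDimensional (Subring.center D) D :=
    finite_of_finrank_pos (by rw [hD]; norm_num)
  have : FiniteDimensional (Subring.center D) L :=
    FiniteDimensional.of_injective j.toLinearMap j.injective
  have hL := finrank_sq_eq_of_maximal j hmax
  have hle := h.finrank_mul_le_of_residueSubalgebra_le hε j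
    (h.residueSubalgebra_le_range hε h2 hA hK hno j)
  have hB := finrank_eq_mul_finrank_centralizer ι (twistedCentralizer_ne_bot ι)
  rw [hD] at hL hle
  rw [Nat.pow_left_injective two_ne_zero hL] at hle
  rw [hA, hK] at hB
  omega

end IsTwistedSeriesRing

namespace MalcevNeumann

variable {F K A Γ : Type*} [Field F] [Field K] [Algebra F K] [DivisionRing A] [Algebra F A]
  {ι : K →ₐ[F] A} [AddCommGroup Γ] [LinearOrder Γ] [IsOrderedAddMonoid Γ]

/-- The embedding `toSeries` as a ring homomorphism. -/
noncomputable def toSeriesHom (U : GaloisUnits ι) (ε : Multiplicative Γ →* (K ≃ₐ[F] K)) :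
    MalcevNeumann U ε →+* HahnSeries Γ A where
  toFun := toSeries
  map_one' := toSeries_one
  map_mul' := toSeries_mul
  map_zero' := toSeries_zero
  map_add' := toSeries_add

/-- The σ-component of A is u_σ C_A(K), so dividing each coefficient on the left by its unit
recovers the Mal'cev–Neumann series. -/
theorem isTwistedSeriesRing_toSeriesHom (U : GaloisUnits ι)
    (ε : Multiplicative Γ →* (K ≃ₐ[F] K)) : IsTwistedSeriesRing ι ε (toSeriesHom U ε) where
  injective := toSeries_injective
  mem_range_iff f := by
    refine ⟨?_, fun hf => ?_⟩
    · rintro ⟨x, rfl⟩ γ k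
      change ι k * ((U.unit (gal ε γ) : A) * (x.coeff γ : A)) =
        (U.unit (gal ε γ) : A) * (x.coeff γ : A) * ι (gal ε γ k)
      rw [← mul_assoc, mul_unit, mul_assoc, comm_of_mem, mul_assoc]
    · have hmem : ∀ γ, ((U.unit (gal ε γ))⁻¹ : Aˣ) * f.coeff γ ∈ centralizerOf ι := by
        intro γ
        rw [Subalgebra.mem_centralizer_iff]
        rintro _ ⟨k, rfl⟩
        obtain ⟨k, rfl⟩ := (gal ε γ).surjective k
        rw [← mul_assoc, inv_mul_unit, mul_assoc, hf γ k, mul_assoc]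
      let x : HahnSeries Γ (centralizerOf ι) :=
        ⟨fun γ => ⟨_, hmem γ⟩, f.isPWO_support.mono fun γ hγ h0 => hγ (Subtype.ext (by
          change (_ : A) * f.coeff γ = 0
          rw [h0, mul_zero]))⟩
      refine ⟨(x : MalcevNeumann U ε), HahnSeries.ext (funext fun γ => ?_)⟩
      exact Units.mul_inv_cancel_left _ _

/-- If no Galois extension of `F` of degree `8` lies between `K` and `A`, then the
Mal'cev–Neumann series form a noncrossed product division algebra. -/
theorem isNoncrossedProductDivisionAlgebra {F : Type uF} {K : Type uK} {A : Type uA}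
    {Γ : Type uΓ} [Field F] [Field K] [Algebra F K] [DivisionRing A] [Algebra F A]
    [Algebra.IsCentral F A] [AddCommGroup Γ] [LinearOrder Γ] [IsOrderedAddMonoid Γ]
    [IsGalois F K] {ι : K →ₐ[F] A} (U : GaloisUnits ι) (ε : Multiplicative Γ →* (K ≃ₐ[F] K))
    (hε : ∀ σ, ∃ γ, gal ε γ = σ) (h2 : (2 : F) ≠ 0)
    (hA : finrank F A = 8 ^ 2) (hK : finrank F K = 4)
    (hno : ¬ ∃ (M : Type uA) (_ : Field M) (_ : Algebra F M) (j : M →ₐ[F] A),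
      IsGalois F M ∧ finrank F M = 8 ∧ ι.range ≤ j.range) :
    IsNoncrossedProductDivisionAlgebra (MalcevNeumann U ε) 8 := by
  have : FiniteDimensional F A := finite_of_finrank_pos (by rw [hA]; norm_num)
  have : FiniteDimensional F K := finite_of_finrank_pos (by rw [hK]; norm_num)
  have h := isTwistedSeriesRing_toSeriesHom U ε
  refine ⟨h.isUnit_or_eq_zero hε, ?_⟩
  let _ := DivisionRing.ofIsUnitOrEqZero (h.isUnit_or_eq_zero hε)
  exact ⟨⟨by norm_num, (IsTwistedSeriesRing.finrank_center (D := MalcevNeumann U ε) h hε).trans hA⟩,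
    IsTwistedSeriesRing.not_isCrossedProductOverCenter (D := MalcevNeumann U ε) h hε h2 hA hK hno⟩

end MalcevNeumann

theorem exists_zpow_mul_zpow_eq {F K : Type*} [Field F] [Field K] [Algebra F K] {a b : F}
    {α β : K} (hα : α ^ 2 = algebraMap F K a) (hβ : β ^ 2 = algebraMap F K b)
    (hgen : IntermediateField.adjoin F {α, β} = ⊤) {σ τ : K ≃ₐ[F] K} (hσα : σ α = -α)
    (hσβ : σ β = β) (hτα : τ α = α) (hτβ : τ β = -β) (ρ : K ≃ₐ[F] K) :
    ∃ r s : ℤ, σ ^ r * τ ^ s = ρ := by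
  rcases algEquiv_apply_sqrt hα ρ with h1 | h1 <;> rcases algEquiv_apply_sqrt hβ ρ with h2 | h2
  · exact ⟨0, 0, algEquiv_ext_of_adjoin hgen (by simp [h1]) (by simp [h2])⟩
  · exact ⟨0, 1, algEquiv_ext_of_adjoin hgen (by simp [h1, hτα]) (by simp [h2, hτβ])⟩
  · exact ⟨1, 0, algEquiv_ext_of_adjoin hgen (by simp [h1, hσα]) (by simp [h2, hσβ])⟩
  · exact ⟨1, 1, algEquiv_ext_of_adjoin hgen (by simp [h1, hτα, hσα])
      (by simp [h2, hτβ, hσβ])⟩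

end NoncrossedProducts

theorem theorem2p7
    {F : Type uF} [Field F] (hF : IsGlobalField F) (hchar : ringChar F ≠ 2)
    -- the central division algebra `A` of degree 8
    {A : Type uA} [DivisionRing A] [Algebra F A] [Algebra.IsCentral F A]
    (hA : Module.finrank F A = 8 ^ 2)
    -- the biquadratic extension `K = F(√a, √b)`, with `α = √a` and `β = √b`, contained in `A`
    {K : Type uK} [Field K] [Algebra F K] (hK : Module.finrank F K = 4)
    (a b : F) (α β : K) (hα : α ^ 2 = algebraMap F K a) (hβ : β ^ 2 = algebraMap F K b)
    (hgen : IntermediateField.adjoin F {α, β} = ⊤)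
    (ι : K →ₐ[F] A)
    -- `⟨a, b, ab⟩` is not isometric to `⟨1, 1, 1⟩`
    (hab : ¬ (QuadraticMap.weightedSumSquares F ![a, b, a * b]).Equivalent
      (QuadraticMap.weightedSumSquares F ![(1 : F), 1, 1]))
    -- the two nondyadic valuations
    {V₁ : Type uV₁} [LinearOrderedCommGroupWithZero V₁] (v₁ : Valuation F V₁)
    {V₂ : Type uV₂} [LinearOrderedCommGroupWithZero V₂] (v₂ : Valuation F V₂)
    (hnd₁ : ringChar (ValuationResidueField v₁) ≠ 2)
    (hnd₂ : ringChar (ValuationResidueField v₂) ≠ 2)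
    (hext₁ : v₁.ExtendsTo A) (hext₂ : v₂.ExtendsTo A)
    -- their inertia fields in `K/F` are distinct quadratic extensions of `F`
    (E₁ E₂ : IntermediateField F K)
    (hE₁ : IsValuationInertiaField v₁ E₁) (hE₂ : IsValuationInertiaField v₂ E₂)
    (hquad₁ : Module.finrank F E₁ = 2) (hquad₂ : Module.finrank F E₂ = 2) (hne : E₁ ≠ E₂)
    -- the sizes of the residue fields
    (hres₁ : ¬ Nat.card (ValuationResidueField v₁) ≡ 1 [MOD 4])
    (hres₂ : ¬ Nat.card (ValuationResidueField v₂) ≡ 1 [MOD 4]) :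
    -- no Galois extension `M/F` of degree 8 satisfies `K ⊆ M ⊆ A`
    (¬ ∃ (M : Type uA) (_ : Field M) (_ : Algebra F M) (j : M →ₐ[F] A),
      IsGalois F M ∧ Module.finrank F M = 8 ∧ ι.range ≤ j.range) ∧
    -- for every choice of the data that define it, the Mal'cev-Neumann ring
    -- `C_A(K)((ℤ × ℤ))` is a division algebra of degree 8 and not a crossed product
    (∀ (Γ : Type uΓ) [AddCommGroup Γ] [LinearOrder Γ] [IsOrderedAddMonoid Γ] (e : Γ ≃+ ℤ × ℤ)
      (σ τ : K ≃ₐ[F] K) (_ : σ α = -α) (_ : σ β = β) (_ : τ α = α) (_ : τ β = -β)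
      (ε : Multiplicative Γ →* (K ≃ₐ[F] K))
      (_ : ∀ γ : Γ, ε (Multiplicative.ofAdd γ) = σ ^ (e γ).1 * τ ^ (e γ).2)
      (U : GaloisUnits ι),
      IsNoncrossedProductDivisionAlgebra (MalcevNeumann U ε) 8) := by
  have h2 : (2 : F) ≠ 0 := Ring.two_ne_zero hchar
  have hgal : IsGalois F K := isGalois_of_biquadratic h2 hα hβ hgen
  have hno : ¬ ∃ (M : Type uA) (_ : Field M) (_ : Algebra F M) (j : M →ₐ[F] A),
      IsGalois F M ∧ Module.finrank F M = 8 ∧ ι.range ≤ j.range := by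
    rintro ⟨M, _, _, j, _, hM, hKM⟩
    exact not_exists_isGalois_of_degree_eight hF hchar hK a b α β hα hβ hgen ι hab v₁ v₂ hnd₁ hnd₂
      hext₁ hext₂ E₁ E₂ hE₁ hE₂ hquad₁ hquad₂ hne hres₁ hres₂ j hM hKM
  refine ⟨hno, fun Γ _ _ _ e σ τ hσα hσβ hτα hτβ ε hε U => ?_⟩
  refine MalcevNeumann.isNoncrossedProductDivisionAlgebra U ε (fun ρ => ?_) h2 hA hK hno
  obtain ⟨r, s, hrs⟩ := exists_zpow_mul_zpow_eq hα hβ hgen hσα hσβ hτα hτβ ρ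
  exact ⟨e.symm (r, s), by rw [MalcevNeumann.gal, hε, e.apply_symm_apply, hrs]⟩
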